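/- Let $d\ge 1$, let $\mathbb{T}^d=\mathbb{R}^d/\mathbb{Z}^d$, let $\kappa\in\{-1,0,1\}$ ($\kappa=-1$ for fermions, $\kappa=1$ for bosons, $\kappa=0$ in the classical case), and let $M(p)=(2\pi)^{-d/2}e^{-|p|^2/2}$ for $p\in\mathbb{R}^d$. Consider the equation $$\partial_t f+p\cdot\nabla_x(f+\kappa f^2)=\operatorname{div}_p\big(\nabla_p f+p(f+\kappa f^2)\big),\qquad f(0,x,p)=f_0(x,p),\qquad (1)$$ for $t\ge 0$, $x\in\mathbb{T}^d$, $p\in\mathbb{R}^d$. A (global) weak solution of (1) with initial condition $f_0\in L^1_{\mathrm{loc}}(\mathbb{T}^d\times\mathbb{R}^d)$ is a real-valued function $f\in C([0,\infty),L^1\cap L^2(\mathbb{T}^d\times\mathbb{R}^d))$ such that $$\int_0^\infty\!\int_{\mathbb{T}^d}\!\int_{\mathbb{R}^d} f\big[\partial_t\varphi+(1+\kappa f)\,p\cdot\nabla_x\varphi-(1+\kappa f)\,p\cdot\nabla_p\varphi+\Delta_p\varphi\big]\,dp\,dx\,dt+\int_{\mathbb{T}^d}\!\int_{\mathbb{R}^d}\varphi|_{t=0}\,f_0\,dp\,dx=0$$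 for all $\varphi\in C_c^\infty([0,\infty)\times\mathbb{T}^d\times\mathbb{R}^d)$. We say that $f$ is regular if its distributional gradients satisfy $$\nabla_x f,\ \nabla_p f\in L^2_{\mathrm{loc}}\big([0,\infty),L^1\cap L^2(\mathbb{T}^d\times\mathbb{R}^d)\big).$$ (a) Let $f$ and $g$ be regular weak solutions of (1) with initial conditions $f_0$ and $g_0$, respectively. If $f_0(x,p)\le g_0(x,p)$ for almost every $(x,p)$, then for every $t\ge 0$, $f(t,x,p)\le g(t,x,p)$ for almost every $(x,p)\in\mathbb{T}^d\times\mathbb{R}^d$. (b) In particular, let $f$ be a regular weak solution of (1) with initial condition $f_0$, and let $\beta_->0$ and $\beta_+>0$ be constants, with $\beta_+<(2\pi)^{d/2}$ if $\kappa=1$, such that $$\frac{\beta_-M(p)}{1-\kappa\beta_-M(p)}\le f_0(x,p)\le\frac{\beta_+M(p)}{1-\kappa\beta_+M(p)}\qquad\text{for almost every }(x,p)\in\mathbb{T}^d\times\mathbb{R}^d.$$ Then for every $t\ge 0$, $$\frac{\beta_-M(p)}{1-\kappa\beta_-M(p)}\le f(t,x,p)\le\frac{\beta_+M(p)}{1-\kappa\beta_+M(p)}\qquad\text{for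 almost every }(x,p)\in\mathbb{T}^d\times\mathbb{R}^d.$$ -/

import Mathlib

open MeasureTheory Set Filter Topology
open scoped ContDiff RealInnerProductSpace

noncomputable section

namespace QFP

/-- The unit torus `𝕋^d = ℝ^d / ℤ^d`; its `volume` is the normalized Haar (Lebesgue) measure. -/
abbrev Torus (d : ℕ) : Type := UnitAddTorus (Fin d)

/-- Momentum space `ℝ^d` with the Euclidean norm. -/
abbrev Mom (d : ℕ) : Type := EuclideanSpace ℝ (Fin d)

/-- Phase space `𝕋^d × ℝ^d`, with the product Lebesgue measure `volume`. -/
abbrev Phase (d : ℕ) : Type := Torus d × Mom d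

variable {d : ℕ}

/-- The quotient map `ℝ^d → 𝕋^d`. -/
def toTorus (x : Mom d) : Torus d := fun i => (x i : UnitAddCircle)

/-- The Maxwellian `M(p) = (2π)^{-d/2} exp(-|p|²/2)`. -/
def maxwellian (p : Mom d) : ℝ :=
  1 / (2 * Real.pi) ^ ((d : ℝ) / 2) * Real.exp (-‖p‖ ^ 2 / 2)

/-- The equilibrium profile `β M(p) / (1 - κ β M(p))`. -/
def equilibrium (κ β : ℝ) (p : Mom d) : ℝ :=
  β * maxwellian p / (1 - κ * β * maxwellian p)

/-- Smooth compactly supported functions on `ℝ × 𝕋^d × ℝ^d`. Smoothness on the torus is smoothness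
of the `ℤ^d`-periodic lift. The elements of `C_c^∞([0,∞) × 𝕋^d × ℝ^d)` are exactly the restrictions
of these functions to `t ≥ 0`. -/
structure IsTestFunction (φ : ℝ × Torus d × Mom d → ℝ) : Prop where
  smooth : ContDiff ℝ ∞ (fun y : ℝ × Mom d × Mom d => φ (y.1, toTorus y.2.1, y.2.2))
  compact_support : HasCompactSupport φ

/-- The time derivative `∂_t φ (t, x, p)`. -/
def derivT (φ : ℝ × Torus d × Mom d → ℝ) (t : ℝ) (z : Phase d) : ℝ :=
  deriv (fun s : ℝ => φ (s, z.1, z.2)) t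

/-- The directional derivative `v · ∇_x φ (t, x, p)` in the torus variable. -/
def derivX (φ : ℝ × Torus d × Mom d → ℝ) (v : Mom d) (t : ℝ) (z : Phase d) : ℝ :=
  deriv (fun s : ℝ => φ (t, z.1 + toTorus (s • v), z.2)) 0

/-- The directional derivative `v · ∇_p φ (t, x, p)` in the momentum variable. -/
def derivP (φ : ℝ × Torus d × Mom d → ℝ) (v : Mom d) (t : ℝ) (z : Phase d) : ℝ :=
  fderiv ℝ (fun q : Mom d => φ (t, z.1, q)) z.2 v

/-- The Laplacian `Δ_p φ (t, x, p)` in the momentum variable. -/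
def laplaceP (φ : ℝ × Torus d × Mom d → ℝ) (t : ℝ) (z : Phase d) : ℝ :=
  Laplacian.laplacian (fun q : Mom d => φ (t, z.1, q)) z.2

/-- Joint measurability on `(0,∞) × 𝕋^d × ℝ^d` (with respect to the completed Lebesgue measure). -/
def JointlyMeasurable {E : Type*} [TopologicalSpace E] (u : ℝ → Phase d → E) : Prop :=
  AEStronglyMeasurable (fun y : ℝ × Phase d => u y.1 y.2)
    ((volume.restrict (Ioi (0 : ℝ))).prod volume)

/-- `u ∈ C([0,∞), L¹ ∩ L²(𝕋^d × ℝ^d))`, for a measurable representative `u(t,x,p)`; values at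
negative times play no role. -/
structure IsContL1L2 (u : ℝ → Phase d → ℝ) : Prop where
  measurable : JointlyMeasurable u
  memLp_one : ∀ t, 0 ≤ t → MemLp (u t) 1 volume
  memLp_two : ∀ t, 0 ≤ t → MemLp (u t) 2 volume
  cont_one : ∀ t, 0 ≤ t →
    Tendsto (fun s => eLpNorm (u s - u t) 1 volume) (𝓝[Ici 0] t) (𝓝 0)
  cont_two : ∀ t, 0 ≤ t →
    Tendsto (fun s => eLpNorm (u s - u t) 2 volume) (𝓝[Ici 0] t) (𝓝 0)

/-- `f` is a global weak solution of
`∂_t f + p · ∇_x (f + κ f²) = div_p (∇_p f + p (f + κ f²))`, `f(0) = f₀`. -/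
structure IsWeakSolution (κ : ℝ) (f : ℝ → Phase d → ℝ) (f₀ : Phase d → ℝ) : Prop where
  cont : IsContL1L2 f
  init_locallyIntegrable : LocallyIntegrable f₀ volume
  weak_eq : ∀ φ : ℝ × Torus d × Mom d → ℝ, IsTestFunction φ →
    (∫ t in Ioi (0 : ℝ), ∫ z : Phase d,
        f t z * (derivT φ t z
          + (1 + κ * f t z) * derivX φ z.2 t z
          - (1 + κ * f t z) * derivP φ z.2 t z
          + laplaceP φ t z))
      + ∫ z : Phase d, φ (0, z) * f₀ z = 0

/-- `G ∈ L²_loc([0,∞), L¹ ∩ L²(𝕋^d × ℝ^d))` for a vector field `G`. -/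
structure IsL2locL1L2 (G : ℝ → Phase d → Mom d) : Prop where
  measurable : JointlyMeasurable G
  sq_one : ∀ T : ℝ, 0 < T → ∫⁻ t in Ioo 0 T, eLpNorm (G t) 1 volume ^ 2 < ⊤
  sq_two : ∀ T : ℝ, 0 < T → ∫⁻ t in Ioo 0 T, eLpNorm (G t) 2 volume ^ 2 < ⊤

/-- `G` is the gradient `∇_x u` in the sense of distributions on `(0,∞) × 𝕋^d × ℝ^d`. -/
def IsWeakGradX (u : ℝ → Phase d → ℝ) (G : ℝ → Phase d → Mom d) : Prop :=
  ∀ φ : ℝ × Torus d × Mom d → ℝ, IsTestFunction φ → tsupport φ ⊆ {y | 0 < y.1} → ∀ v : Mom d,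
    ∫ t in Ioi (0 : ℝ), ∫ z : Phase d, u t z * derivX φ v t z
      = -∫ t in Ioi (0 : ℝ), ∫ z : Phase d, ⟪G t z, v⟫ * φ (t, z)

/-- `G` is the gradient `∇_p u` in the sense of distributions on `(0,∞) × 𝕋^d × ℝ^d`. -/
def IsWeakGradP (u : ℝ → Phase d → ℝ) (G : ℝ → Phase d → Mom d) : Prop :=
  ∀ φ : ℝ × Torus d × Mom d → ℝ, IsTestFunction φ → tsupport φ ⊆ {y | 0 < y.1} → ∀ v : Mom d,
    ∫ t in Ioi (0 : ℝ), ∫ z : Phase d, u t z * derivP φ v t z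
      = -∫ t in Ioi (0 : ℝ), ∫ z : Phase d, ⟪G t z, v⟫ * φ (t, z)

/-- `∇_x u, ∇_p u ∈ L²_loc([0,∞), L¹ ∩ L²(𝕋^d × ℝ^d))`. -/
def HasGradRegularity (u : ℝ → Phase d → ℝ) : Prop :=
  (∃ G, IsWeakGradX u G ∧ IsL2locL1L2 G) ∧ (∃ G, IsWeakGradP u G ∧ IsL2locL1L2 G)

end QFP

end

/-!
The comparison principle is a Kato (or `L¹` contraction) argument for `u = f - g`, which satisfies

`∂ₜ u + p · ∇ₓ(a u) = Δₚ u + div_p (p a u)`, with `a = 1 + κ (f + g)`.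

Multiplying by a smooth approximation `H_l(u)` of the Heaviside function, the Laplacian contributes
a term of the right sign by convexity, and integrating the transport terms by parts leaves the
remainders `u H_l'(u) a ∂u`, in which `a ∂u` is integrable on sets of bounded momenta, because `f`,
`g` and their gradients are in `L¹ ∩ L²`. As `u H_l'(u)` is bounded and tends to zero, the positive
part of `u` is a subsolution in the sense of distributions.

The formal steps are justified by mollification, and a single mollification does not serve for
both. The equation, with the transport terms treated as an integrable source on a set of bounded
momenta, is linear in `u` and is mollified in `renormalization_le`. The derivatives of the source
are then moved back to the test function by `weak_chain_rule`, in whose proof `f` and `g` are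
mollified. Their combination is `IsSolutionPair.softPos_le`, and its limit is
`IsSolutionPair.kato`.

Kato's inequality is tested with `θ(t) χ(ε p)`. The only term which grows with `p` contains
`(ε p) · ∇χ(ε p)`, which is bounded and tends to zero pointwise, so that no moments of `f` and `g`
are needed (`integral_deriv_mul_posPart_nonneg`). Hence the integral of `(f - g)⁺` at time `t` does
not exceed its initial value (`integral_posPart_le`), which is determined by the initial data, as a
weak solution attains its initial datum (`IsWeakSolution.initial`). This proves `comparison`.

The equilibria `E = β M / (1 - κ β M)` satisfy `∇E = -p (E + κ E²)`, so that they are stationary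
solutions, and regular by Gaussian bounds (`isWeakSolution_equilibrium`); the bounds by equilibria
are then instances of the comparison principle. For bosons the lower profile is covered as well,
since the lower and upper bounds can only be compatible if both parameters are subcritical
(`lt_of_equilibrium_le`).

All derivatives are taken along one-parameter subgroups of the locally compact group
`ℝ × 𝕋^d × ℝ^d`, for which convolution and integration by parts need no coordinates.
-/

namespace QFP

/-! ### Derivatives along one-parameter subgroups and convolutions -/

section OneParameter

variable {G : Type*} [AddCommGroup G]

/-- `φ'` is the derivative of `φ` along the one-parameter subgroup `γ` of the group `G`, at every
point. On phase space this covers the time derivative and the directional derivatives in position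
and momentum alike. -/
def HasDerivAlong (γ : ℝ →+ G) (φ φ' : G → ℝ) : Prop :=
  ∀ y, HasDerivAt (fun s : ℝ => φ (y + γ s)) (φ' y) 0

theorem HasDerivAlong.hasDerivAt {γ : ℝ →+ G} {φ φ' : G → ℝ} (h : HasDerivAlong γ φ φ')
    (y : G) (s : ℝ) : HasDerivAt (fun s : ℝ => φ (y + γ s)) (φ' (y + γ s)) s := by
  have h1 := h (y + γ s)
  have h2 : HasDerivAt (fun r : ℝ => r - s) 1 s := (hasDerivAt_id s).sub_const s
  have h3 : HasDerivAt (fun s' : ℝ => φ (y + γ s + γ s')) (φ' (y + γ s)) (s - s) := by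
    simpa using h1
  have h4 := HasDerivAt.comp (h := fun r : ℝ => r - s) s h3 h2
  refine (h4.congr_deriv (mul_one _)).congr_of_eventuallyEq (Eventually.of_forall fun r => ?_)
  simp [add_assoc, ← map_add]

theorem HasDerivAlong.mul {γ : ℝ →+ G} {φ φ' ψ ψ' : G → ℝ} (h : HasDerivAlong γ φ φ')
    (h' : HasDerivAlong γ ψ ψ') :
    HasDerivAlong γ (fun y => φ y * ψ y) (fun y => φ' y * ψ y + φ y * ψ' y) := by
  intro y
  have := (h y).fun_mul (h' y)
  simpa using this

theorem HasDerivAlong.add {γ : ℝ →+ G} {φ φ' ψ ψ' : G → ℝ} (h : HasDerivAlong γ φ φ')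
    (h' : HasDerivAlong γ ψ ψ') :
    HasDerivAlong γ (fun y => φ y + ψ y) (fun y => φ' y + ψ' y) := fun y => (h y).add (h' y)

theorem HasDerivAlong.sub {γ : ℝ →+ G} {φ φ' ψ ψ' : G → ℝ} (h : HasDerivAlong γ φ φ')
    (h' : HasDerivAlong γ ψ ψ') :
    HasDerivAlong γ (fun y => φ y - ψ y) (fun y => φ' y - ψ' y) := fun y => (h y).sub (h' y)

theorem HasDerivAlong.const_mul {γ : ℝ →+ G} {φ φ' : G → ℝ} (h : HasDerivAlong γ φ φ') (c : ℝ) :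
    HasDerivAlong γ (fun y => c * φ y) (fun y => c * φ' y) := fun y => (h y).const_mul c

theorem HasDerivAlong.comp {γ : ℝ →+ G} {φ φ' : G → ℝ} {H H' : ℝ → ℝ}
    (hH : ∀ r, HasDerivAt H (H' r) r) (h : HasDerivAlong γ φ φ') :
    HasDerivAlong γ (fun y => H (φ y)) (fun y => H' (φ y) * φ' y) := by
  intro y
  have h1 : HasDerivAt H (H' (φ y)) (φ (y + γ 0)) := by simpa using hH (φ y)
  exact h1.comp (0 : ℝ) (h y)

theorem HasDerivAlong.congr {γ : ℝ →+ G} {φ φ' ψ' : G → ℝ} (h : HasDerivAlong γ φ φ')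
    (e : ∀ y, φ' y = ψ' y) : HasDerivAlong γ φ ψ' := fun y => e y ▸ h y

theorem HasDerivAlong.unique {γ : ℝ →+ G} {φ φ' ψ' : G → ℝ} (h : HasDerivAlong γ φ φ')
    (h' : HasDerivAlong γ φ ψ') : φ' = ψ' := funext fun y => (h y).unique (h' y)

variable [TopologicalSpace G] [IsTopologicalAddGroup G]

theorem HasDerivAlong.eq_zero_of_notMem_tsupport {γ : ℝ →+ G} (hγ : Continuous γ) {φ φ' : G → ℝ}
    (h : HasDerivAlong γ φ φ') {y : G} (hy : y ∉ tsupport φ) : φ' y = 0 := by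
  have h1 : ∀ᶠ s : ℝ in 𝓝 0, φ (y + γ s) = 0 := by
    have hc : Tendsto (fun s : ℝ => y + γ s) (𝓝 0) (𝓝 y) := by
      have : Continuous fun s : ℝ => y + γ s := by fun_prop
      simpa using this.tendsto 0
    have ho : (tsupport φ)ᶜ ∈ 𝓝 y := (isClosed_tsupport φ).isOpen_compl.mem_nhds hy
    filter_upwards [hc.eventually ho] with s hs
    exact image_eq_zero_of_notMem_tsupport hs
  have h2 : HasDerivAt (fun s : ℝ => φ (y + γ s)) 0 0 :=
    (hasDerivAt_const (0 : ℝ) (0 : ℝ)).congr_of_eventuallyEq h1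
  exact (h y).unique h2

theorem HasDerivAlong.tsupport_subset {γ : ℝ →+ G} (hγ : Continuous γ) {φ φ' : G → ℝ}
    (h : HasDerivAlong γ φ φ') : tsupport φ' ⊆ tsupport φ := by
  refine closure_minimal (fun y hy => ?_) (isClosed_tsupport φ)
  by_contra hn
  exact hy (h.eq_zero_of_notMem_tsupport hγ hn)

theorem HasDerivAlong.hasCompactSupport {γ : ℝ →+ G} (hγ : Continuous γ) {φ φ' : G → ℝ}
    (h : HasDerivAlong γ φ φ') (hc : HasCompactSupport φ) : HasCompactSupport φ' :=
  IsCompact.of_isClosed_subset hc (isClosed_tsupport _) (h.tsupport_subset hγ)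

variable [MeasurableSpace G]

/-- The convolution `u * ρ` on the group `G`. -/
noncomputable def conv (μ : Measure G) (u ρ : G → ℝ) (y : G) : ℝ := ∫ z, u z * ρ (y - z) ∂μ

variable [BorelSpace G] {μ : Measure G}

theorem continuous_conv {u ρ : G → ℝ} (hu : LocallyIntegrable u μ) (hρ : Continuous ρ)
    (hc : HasCompactSupport ρ) : Continuous (conv μ u ρ) :=
  hc.continuous_convolution_right (ContinuousLinearMap.mul ℝ ℝ) hu hρ

variable [T2Space G]

theorem integrable_mul_comp_sub [LocallyCompactSpace G] [SecondCountableTopology G]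
    {u ρ : G → ℝ} (hu : LocallyIntegrable u μ) (hρ : Continuous ρ)
    (hc : HasCompactSupport ρ) (y : G) : Integrable (fun z => u z * ρ (y - z)) μ := by
  have h1 : HasCompactSupport (fun z => ρ (y - z)) :=
    hc.comp_homeomorph (Homeomorph.subLeft y)
  have := hu.integrable_smul_left_of_hasCompactSupport (g := fun z => ρ (y - z)) (by fun_prop) h1
  refine this.congr (Eventually.of_forall fun z => ?_)
  simp [mul_comm]

/-- Convolution with a compactly supported `C¹` kernel may be differentiated under the integral
sign. -/
theorem hasDerivAlong_conv [LocallyCompactSpace G] [SecondCountableTopology G]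
    {γ : ℝ →+ G} (hγ : Continuous γ) {u ρ ρ' : G → ℝ} (hu : LocallyIntegrable u μ)
    (hρ : Continuous ρ) (hρ' : Continuous ρ') (hc : HasCompactSupport ρ)
    (h : HasDerivAlong γ ρ ρ') : HasDerivAlong γ (conv μ u ρ) (conv μ u ρ') := by
  intro y
  have hc' : HasCompactSupport ρ' := h.hasCompactSupport hγ hc
  obtain ⟨C, hC⟩ := hc'.exists_bound_of_continuous hρ'
  have hC0 : 0 ≤ C := (norm_nonneg _).trans (hC 0)
  -- The kernels of all difference quotients live in one compact set.
  set K : Set G := (fun q : ℝ × G => y + γ q.1 - q.2) '' (Icc (-1 : ℝ) 1 ×ˢ tsupport ρ') with hK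
  have hKc : IsCompact K :=
    (isCompact_Icc.prod hc').image (by fun_prop)
  have hKi : Integrable (fun z => C * K.indicator (fun z => ‖u z‖) z) μ := by
    refine Integrable.const_mul ?_ C
    exact (integrable_indicator_iff hKc.isClosed.measurableSet).2
      ((hu.integrableOn_isCompact hKc).norm)
  have key := hasDerivAt_integral_of_dominated_loc_of_deriv_le (μ := μ) (𝕜 := ℝ)
    (F := fun s z => u z * ρ (y + γ s - z)) (F' := fun s z => u z * ρ' (y + γ s - z))
    (x₀ := (0 : ℝ)) (s := Ioo (-1) 1) (bound := fun z => C * K.indicator (fun z => ‖u z‖) z)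
    (Ioo_mem_nhds (by norm_num) (by norm_num))
    (Eventually.of_forall fun s => (integrable_mul_comp_sub hu hρ hc (y + γ s)).1)
    (integrable_mul_comp_sub hu hρ hc (y + γ 0))
    (integrable_mul_comp_sub hu hρ' hc' (y + γ 0)).1
    (Eventually.of_forall fun z s hs => ?_) hKi (Eventually.of_forall fun z s _ => ?_)
  · have := key.2
    simpa [conv] using this
  · by_cases hz : y + γ s - z ∈ tsupport ρ'
    · have hzK : z ∈ K := ⟨(s, y + γ s - z), ⟨Ioo_subset_Icc_self hs, hz⟩, by simp⟩
      rw [indicator_of_mem hzK, norm_mul, mul_comm]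
      exact mul_le_mul_of_nonneg_right (hC _) (norm_nonneg _)
    · rw [image_eq_zero_of_notMem_tsupport hz]
      simp only [mul_zero, norm_zero]
      exact mul_nonneg hC0 (indicator_nonneg (fun _ _ => norm_nonneg _) _)
  · have h1 := (h.hasDerivAt (y - z) s).const_mul (u z)
    have e : ∀ r : ℝ, y + γ r - z = y - z + γ r := fun r => by abel
    simp only [e]
    exact h1

variable [LocallyCompactSpace G] [SecondCountableTopology G] [μ.IsAddHaarMeasure]

/-- The integral of a derivative along a one-parameter subgroup vanishes, as the Haar integral of
`φ` is invariant under translations. -/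
theorem integral_deriv_eq_zero {γ : ℝ →+ G} (hγ : Continuous γ) {φ φ' : G → ℝ}
    (hφ : Continuous φ) (hφ' : Continuous φ') (hc : HasCompactSupport φ)
    (h : HasDerivAlong γ φ φ') : ∫ y, φ' y ∂μ = 0 := by
  have h1 := hasDerivAlong_conv (μ := μ) hγ (u := fun _ => 1)
    (continuous_const.locallyIntegrable) hφ hφ' hc h 0
  have e : ∀ ρ : G → ℝ, ∀ y, conv μ (fun _ => 1) ρ y = ∫ z, ρ z ∂μ := fun ρ y => by
    simp only [conv, one_mul]
    exact integral_sub_left_eq_self ρ μ y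
  simp only [e] at h1
  exact h1.unique (hasDerivAt_const _ _)

/-- Integration by parts along a one-parameter subgroup. -/
theorem integral_mul_deriv_eq_neg {γ : ℝ →+ G} (hγ : Continuous γ) {φ φ' ψ ψ' : G → ℝ}
    (hφ : Continuous φ) (hφ' : Continuous φ') (hψ : Continuous ψ) (hψ' : Continuous ψ')
    (hc : HasCompactSupport ψ) (h : HasDerivAlong γ φ φ') (h' : HasDerivAlong γ ψ ψ') :
    ∫ y, φ y * ψ' y ∂μ = -∫ y, φ' y * ψ y ∂μ := by
  have hc' : HasCompactSupport ψ' := h'.hasCompactSupport hγ hc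
  have h1 := integral_deriv_eq_zero (μ := μ) hγ (hφ.mul hψ)
    ((hφ'.mul hψ).add (hφ.mul hψ')) (hc.mul_left) (h.mul h')
  have i1 : Integrable (fun y => φ' y * ψ y) μ :=
    (hφ'.mul hψ).integrable_of_hasCompactSupport hc.mul_left
  have i2 : Integrable (fun y => φ y * ψ' y) μ :=
    (hφ.mul hψ').integrable_of_hasCompactSupport hc'.mul_left
  replace h1 : ∫ y, (φ' y * ψ y + φ y * ψ' y) ∂μ = 0 := h1
  rw [integral_add i1 i2] at h1
  linarith

end OneParameter

open scoped ENNReal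

/-! ### Approximate identities -/

section ApproximateIdentity

variable {G : Type*} [AddCommGroup G] [TopologicalSpace G] [IsTopologicalAddGroup G]
  [T2Space G] [MeasurableSpace G] [BorelSpace G] [LocallyCompactSpace G]
  [SecondCountableTopology G] {μ : Measure G} [μ.IsAddHaarMeasure]

/-- A sequence of nonnegative continuous kernels of mass one whose supports shrink to the neutral
element. -/
structure IsApproxIdentity (μ : Measure G) (ρ : ℕ → G → ℝ) : Prop where
  continuous : ∀ n, Continuous (ρ n)
  hasCompactSupport : ∀ n, HasCompactSupport (ρ n)
  nonneg : ∀ n y, 0 ≤ ρ n y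
  integral_eq_one : ∀ n, ∫ y, ρ n y ∂μ = 1
  tsupport_subset : ∀ U ∈ 𝓝 (0 : G), ∀ᶠ n in atTop, tsupport (ρ n) ⊆ U

/-- The convolution with a probability density `ρ` is an average of translates. The proof is Jensen's
inequality for the probability measure `ρ μ`, followed by Tonelli's theorem. -/
theorem eLpNorm_conv_sub_le {p : ℝ≥0∞} (hp1 : 1 ≤ p) (hp : p ≠ ⊤) {u ρ : G → ℝ}
    (hum : StronglyMeasurable u) (hu : LocallyIntegrable u μ) (hρ : Continuous ρ)
    (hc : HasCompactSupport ρ) (h0 : ∀ y, 0 ≤ ρ y) (h1 : ∫ y, ρ y ∂μ = 1) {ε : ℝ≥0∞}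
    (hε : ∀ h ∈ tsupport ρ, eLpNorm (fun y => u (y - h) - u y) p μ ≤ ε) :
    eLpNorm (conv μ u ρ - u) p μ ≤ ε := by
  have hp0 : p ≠ 0 := (zero_lt_one.trans_le hp1).ne'
  have hq : 0 < p.toReal := ENNReal.toReal_pos hp0 hp
  set ν : Measure G := μ.withDensity (fun h => ENNReal.ofReal (ρ h)) with hν
  have hρm : Measurable fun h => ENNReal.ofReal (ρ h) := hρ.measurable.ennreal_ofReal
  have hρi : Integrable ρ μ := hρ.integrable_of_hasCompactSupport hc
  have : IsProbabilityMeasure ν := by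
    constructor
    rw [hν, withDensity_apply _ MeasurableSet.univ, Measure.restrict_univ,
      ← ofReal_integral_eq_lintegral_ofReal hρi (Eventually.of_forall h0), h1, ENNReal.ofReal_one]
  have hm : StronglyMeasurable (fun q : G × G => u (q.1 - q.2) - u q.1) :=
    (hum.comp_measurable measurable_sub).sub (hum.comp_measurable measurable_fst)
  have hpt : ∀ y, ‖(conv μ u ρ - u) y‖ₑ ^ p.toReal
      ≤ ∫⁻ h, ‖u (y - h) - u y‖ₑ ^ p.toReal ∂ν := by
    intro y
    have e1 : conv μ u ρ y = ∫ h, u (y - h) * ρ h ∂μ := by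
      rw [conv, ← integral_sub_left_eq_self _ μ y]
      simp
    have i1 : Integrable (fun h => u (y - h) * ρ h) μ := by
      have := (integrable_mul_comp_sub hu hρ hc y).comp_sub_left y
      simpa using this
    have e2 : (conv μ u ρ - u) y = ∫ h, (u (y - h) - u y) ∂ν := by
      rw [hν, integral_withDensity_eq_integral_toReal_smul hρm
        (Eventually.of_forall fun _ => ENNReal.ofReal_lt_top)]
      have : ∀ h, (ENNReal.ofReal (ρ h)).toReal • (u (y - h) - u y)
          = u (y - h) * ρ h - u y * ρ h := fun h => by
        rw [ENNReal.toReal_ofReal (h0 h), smul_eq_mul]; ring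
      simp only [this]
      rw [integral_sub i1 (hρi.const_mul _), integral_const_mul, h1, Pi.sub_apply, e1, mul_one]
    have hmy : AEStronglyMeasurable (fun h => u (y - h) - u y) ν :=
      (hm.comp_measurable measurable_prodMk_left).aestronglyMeasurable
    have e3 : ‖(conv μ u ρ - u) y‖ₑ ≤ eLpNorm (fun h => u (y - h) - u y) p ν := by
      rw [e2]
      refine (enorm_integral_le_lintegral_enorm _).trans ?_
      rw [← eLpNorm_one_eq_lintegral_enorm]
      exact eLpNorm_le_eLpNorm_of_exponent_le hp1 hmy
    rw [eLpNorm_eq_lintegral_rpow_enorm_toReal hp0 hp] at e3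
    refine (ENNReal.rpow_le_rpow e3 hq.le).trans (le_of_eq ?_)
    rw [← ENNReal.rpow_mul, one_div, inv_mul_cancel₀ hq.ne', ENNReal.rpow_one]
  have hν0 : ν (tsupport ρ)ᶜ = 0 := by
    rw [hν, withDensity_apply _ (isClosed_tsupport ρ).measurableSet.compl]
    refine setLIntegral_eq_zero (isClosed_tsupport ρ).measurableSet.compl fun y hy => ?_
    simp [image_eq_zero_of_notMem_tsupport hy]
  have hae : ∀ᵐ h ∂ν, h ∈ tsupport ρ := by
    rw [ae_iff]; exact hν0
  rw [eLpNorm_eq_lintegral_rpow_enorm_toReal hp0 hp, one_div,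
    ENNReal.rpow_inv_le_iff hq]
  calc ∫⁻ y, ‖(conv μ u ρ - u) y‖ₑ ^ p.toReal ∂μ
      ≤ ∫⁻ y, ∫⁻ h, ‖u (y - h) - u y‖ₑ ^ p.toReal ∂ν ∂μ := lintegral_mono hpt
    _ = ∫⁻ h, ∫⁻ y, ‖u (y - h) - u y‖ₑ ^ p.toReal ∂μ ∂ν := by
        refine lintegral_lintegral_swap ?_
        exact (hm.enorm.pow_const _).aemeasurable
    _ ≤ ∫⁻ _h, ε ^ p.toReal ∂ν := by
        refine lintegral_mono_ae (hae.mono fun h hh => ?_)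
        have := hε h hh
        rwa [eLpNorm_eq_lintegral_rpow_enorm_toReal hp0 hp, one_div,
          ENNReal.rpow_inv_le_iff hq] at this
    _ = ε ^ p.toReal := by simp

/-- Translations are continuous in `L^p`. -/
theorem tendsto_eLpNorm_translate_sub {p : ℝ≥0∞} (hp1 : 1 ≤ p) (hp : p ≠ ⊤) {u : G → ℝ}
    (hu : MemLp u p μ) :
    Tendsto (fun h : G => eLpNorm (fun y => u (y - h) - u y) p μ) (𝓝 0) (𝓝 0) := by
  have : Fact (1 ≤ p) := ⟨hp1⟩
  let T : C(G, C(G, G)) :=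
    (ContinuousMap.mk (fun a : G × G => a.2 - a.1) (by fun_prop)).curry
  have hT : ∀ h, MeasurePreserving (T h) μ μ := fun h => measurePreserving_sub_right μ h
  have h1 := Filter.Tendsto.compMeasurePreservingLp (l := 𝓝 (0 : G))
    (tendsto_const_nhds (x := hu.toLp u)) (T.continuous.tendsto 0) hT (hT 0) hp
  have h2 := (tendsto_iff_edist_tendsto_0).1 h1
  refine h2.congr fun h => ?_
  rw [Lp.edist_def]
  refine eLpNorm_congr_ae ?_
  have a1 := Lp.coeFn_compMeasurePreserving (hu.toLp u) (hT h)
  have a2 := Lp.coeFn_compMeasurePreserving (hu.toLp u) (hT 0)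
  have a3 := hu.coeFn_toLp
  have a4 := (hT h).quasiMeasurePreserving.ae_eq_comp a3
  have a5 := (hT 0).quasiMeasurePreserving.ae_eq_comp a3
  filter_upwards [a1, a2, a4, a5] with y b1 b2 b4 b5
  simp only [Pi.sub_apply, b1, b2, b4, b5]
  simp [T]

theorem tendsto_eLpNorm_conv_sub {p : ℝ≥0∞} (hp1 : 1 ≤ p) (hp : p ≠ ⊤) {u : G → ℝ}
    (hu : MemLp u p μ) {ρ : ℕ → G → ℝ} (hρ : IsApproxIdentity μ ρ) :
    Tendsto (fun n => eLpNorm (conv μ u (ρ n) - u) p μ) atTop (𝓝 0) := by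
  set v := hu.1.mk u with hv
  have huv : u =ᵐ[μ] v := hu.1.ae_eq_mk
  have hvm : StronglyMeasurable v := hu.1.stronglyMeasurable_mk
  have hvL : MemLp v p μ := hu.ae_eq huv
  have e : ∀ n, eLpNorm (conv μ u (ρ n) - u) p μ = eLpNorm (conv μ v (ρ n) - v) p μ := by
    intro n
    refine eLpNorm_congr_ae ?_
    filter_upwards [huv] with y hy
    simp only [Pi.sub_apply, hy]
    congr 1
    refine integral_congr_ae ?_
    filter_upwards [huv] with z hz
    rw [hz]
  simp only [e]
  rw [ENNReal.tendsto_nhds_zero]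
  intro ε hε
  have h1 := (ENNReal.tendsto_nhds_zero.1 (tendsto_eLpNorm_translate_sub hp1 hp hvL)) ε hε
  filter_upwards [hρ.tsupport_subset _ h1] with n hn
  exact eLpNorm_conv_sub_le hp1 hp hvm (hvL.locallyIntegrable hp1) (hρ.continuous n)
    (hρ.hasCompactSupport n) (hρ.nonneg n) (hρ.integral_eq_one n) fun h hh => hn hh

end ApproximateIdentity

/-! ### Convergence in `L^p` -/

section StrongConvergence

variable {α : Type*} [MeasurableSpace α] {μ : Measure α}

/-- Convergence in `L^p` of a sequence of measurable functions, not assumed to lie in `L^p`, to an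
element of `L^p`. -/
structure TendstoLp (p : ℝ≥0∞) (μ : Measure α) (X : ℕ → α → ℝ) (Y : α → ℝ) : Prop where
  aestronglyMeasurable : ∀ n, AEStronglyMeasurable (X n) μ
  memLp : MemLp Y p μ
  tendsto : Tendsto (fun n => eLpNorm (X n - Y) p μ) atTop (𝓝 0)

theorem TendstoLp.eventually_memLp {p : ℝ≥0∞} {X : ℕ → α → ℝ} {Y : α → ℝ}
    (h : TendstoLp p μ X Y) : ∀ᶠ n in atTop, MemLp (X n) p μ := by
  have h1 : ∀ᶠ n in atTop, eLpNorm (X n - Y) p μ < 1 :=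
    h.tendsto.eventually (Iio_mem_nhds zero_lt_one)
  filter_upwards [h1] with n hn
  have : MemLp (X n - Y) p μ :=
    ⟨(h.aestronglyMeasurable n).sub h.memLp.1, hn.trans ENNReal.one_lt_top⟩
  simpa using this.add h.memLp

theorem TendstoLp.comp_strictMono {p : ℝ≥0∞} {X : ℕ → α → ℝ} {Y : α → ℝ}
    (h : TendstoLp p μ X Y) {ns : ℕ → ℕ} (hns : StrictMono ns) :
    TendstoLp p μ (fun n => X (ns n)) Y :=
  ⟨fun _ => h.aestronglyMeasurable _, h.memLp, h.tendsto.comp hns.tendsto_atTop⟩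

theorem TendstoLp.add {p : ℝ≥0∞} (hp : 1 ≤ p) {X X' : ℕ → α → ℝ} {Y Y' : α → ℝ}
    (h : TendstoLp p μ X Y) (h' : TendstoLp p μ X' Y') :
    TendstoLp p μ (fun n y => X n y + X' n y) (fun y => Y y + Y' y) := by
  refine ⟨fun n => (h.aestronglyMeasurable n).add (h'.aestronglyMeasurable n),
    h.memLp.add h'.memLp, ?_⟩
  have h1 := h.tendsto.add h'.tendsto
  rw [add_zero] at h1
  refine tendsto_of_tendsto_of_tendsto_of_le_of_le tendsto_const_nhds h1 (fun _ => zero_le)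
    fun n => ?_
  have e : (fun y => X n y + X' n y) - (fun y => Y y + Y' y) = (X n - Y) + (X' n - Y') := by
    ext y; simp only [Pi.sub_apply, Pi.add_apply]; ring
  simp only [e]
  exact eLpNorm_add_le ((h.aestronglyMeasurable n).sub h.memLp.1)
    ((h'.aestronglyMeasurable n).sub h'.memLp.1) hp

theorem TendstoLp.const_mul {p : ℝ≥0∞} {X : ℕ → α → ℝ} {Y : α → ℝ}
    (h : TendstoLp p μ X Y) (c : ℝ) :
    TendstoLp p μ (fun n y => c * X n y) (fun y => c * Y y) := by
  refine ⟨fun n => (h.aestronglyMeasurable n).const_mul c, h.memLp.const_mul c, ?_⟩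
  have h1 := ENNReal.Tendsto.const_mul (a := ‖c‖ₑ) h.tendsto (Or.inr enorm_ne_top)
  rw [mul_zero] at h1
  refine h1.congr fun n => ?_
  have e : (fun y => c * X n y) - (fun y => c * Y y) = c • (X n - Y) := by
    ext y; simp only [Pi.sub_apply, Pi.smul_apply, smul_eq_mul]; ring
  rw [e, eLpNorm_const_smul]

theorem TendstoLp.sub {p : ℝ≥0∞} (hp : 1 ≤ p) {X X' : ℕ → α → ℝ} {Y Y' : α → ℝ}
    (h : TendstoLp p μ X Y) (h' : TendstoLp p μ X' Y') :
    TendstoLp p μ (fun n y => X n y - X' n y) (fun y => Y y - Y' y) := by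
  have := h.add hp (h'.const_mul (-1))
  simpa [sub_eq_add_neg] using this

/-- Products of sequences converging in `L²` converge in `L¹`. -/
theorem TendstoLp.mul {X X' : ℕ → α → ℝ} {Y Y' : α → ℝ}
    (h : TendstoLp 2 μ X Y) (h' : TendstoLp 2 μ X' Y') :
    TendstoLp 1 μ (fun n y => X n y * X' n y) (fun y => Y y * Y' y) := by
  refine ⟨fun n => (h.aestronglyMeasurable n).mul (h'.aestronglyMeasurable n),
    h'.memLp.mul' h.memLp, ?_⟩
  -- `XX' - YY' = (X - Y)(X' - Y') + (X - Y)Y' + Y(X' - Y')`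
  have t1 : Tendsto (fun n => eLpNorm (X n - Y) 2 μ * eLpNorm (X' n - Y') 2 μ
      + eLpNorm (X n - Y) 2 μ * eLpNorm Y' 2 μ + eLpNorm Y 2 μ * eLpNorm (X' n - Y') 2 μ)
      atTop (𝓝 (0 * 0 + 0 * eLpNorm Y' 2 μ + eLpNorm Y 2 μ * 0)) :=
    ((ENNReal.Tendsto.mul h.tendsto (Or.inr ENNReal.zero_ne_top) h'.tendsto
      (Or.inr ENNReal.zero_ne_top)).add
      (ENNReal.Tendsto.mul_const h.tendsto (Or.inr h'.memLp.2.ne))).add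
      (ENNReal.Tendsto.const_mul h'.tendsto (Or.inr h.memLp.2.ne))
  simp only [mul_zero, zero_mul, add_zero] at t1
  refine tendsto_of_tendsto_of_tendsto_of_le_of_le tendsto_const_nhds t1 (fun _ => zero_le)
    fun n => ?_
  have m1 := (h.aestronglyMeasurable n).sub h.memLp.1
  have m2 := (h'.aestronglyMeasurable n).sub h'.memLp.1
  have e : (fun y => X n y * X' n y) - (fun y => Y y * Y' y)
      = (X n - Y) • (X' n - Y') + (X n - Y) • Y' + Y • (X' n - Y') := by
    ext y; simp only [Pi.sub_apply, Pi.add_apply, Pi.mul_apply, smul_eq_mul]; ring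
  simp only [e]
  refine (eLpNorm_add_le ((m1.smul m2).add (m1.smul h'.memLp.1)) (h.memLp.1.smul m2) le_rfl).trans ?_
  refine add_le_add ((eLpNorm_add_le (m1.smul m2) (m1.smul h'.memLp.1) le_rfl).trans ?_) ?_
  · exact add_le_add (eLpNorm_smul_le_mul_eLpNorm m2 m1) (eLpNorm_smul_le_mul_eLpNorm h'.memLp.1 m1)
  · exact eLpNorm_smul_le_mul_eLpNorm m2 h.memLp.1

theorem TendstoLp.exists_ae_tendsto {p : ℝ≥0∞} (hp : 1 ≤ p) {X : ℕ → α → ℝ} {Y : α → ℝ}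
    (h : TendstoLp p μ X Y) :
    ∃ ns : ℕ → ℕ, StrictMono ns ∧ ∀ᵐ y ∂μ, Tendsto (fun n => X (ns n) y) atTop (𝓝 (Y y)) :=
  (tendstoInMeasure_of_tendsto_eLpNorm (zero_lt_one.trans_le hp).ne' h.aestronglyMeasurable
    h.memLp.1 h.tendsto).exists_seq_tendsto_ae

/-- A product of an `L¹`-convergent sequence and a bounded, almost everywhere convergent one. -/
theorem tendsto_integral_mul {X m : ℕ → α → ℝ} {Y m₀ : α → ℝ} {C : ℝ}
    (h : TendstoLp 1 μ X Y) (hm : ∀ n, AEStronglyMeasurable (m n) μ) (hC : ∀ n y, |m n y| ≤ C)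
    (hm0 : ∀ᵐ y ∂μ, Tendsto (fun n => m n y) atTop (𝓝 (m₀ y))) :
    Tendsto (fun n => ∫ y, m n y * X n y ∂μ) atTop (𝓝 (∫ y, m₀ y * Y y ∂μ)) := by
  have hY : Integrable Y μ := memLp_one_iff_integrable.1 h.memLp
  have t1 : Tendsto (fun n => ∫ y, m n y * Y y ∂μ) atTop (𝓝 (∫ y, m₀ y * Y y ∂μ)) := by
    refine tendsto_integral_of_dominated_convergence (fun y => C * ‖Y y‖)
      (fun n => (hm n).mul hY.1) (hY.norm.const_mul C) (fun n => Eventually.of_forall fun y => ?_)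
      (hm0.mono fun y hy => hy.mul_const _)
    rw [norm_mul]
    exact mul_le_mul_of_nonneg_right (hC n y) (norm_nonneg _)
  have t2 : Tendsto (fun n => ∫ y, m n y * (X n y - Y y) ∂μ) atTop (𝓝 0) := by
    have t3 : Tendsto (fun n => C * (eLpNorm (X n - Y) 1 μ).toReal) atTop (𝓝 (C * 0)) :=
      ((ENNReal.tendsto_toReal ENNReal.zero_ne_top).comp h.tendsto).const_mul C
    rw [mul_zero] at t3
    refine squeeze_zero_norm' ?_ t3
    filter_upwards [h.eventually_memLp] with n hn
    have hi : Integrable (X n - Y) μ := memLp_one_iff_integrable.1 (hn.sub h.memLp)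
    refine (norm_integral_le_integral_norm _).trans ?_
    have e : (eLpNorm (X n - Y) 1 μ).toReal = ∫ y, ‖(X n - Y) y‖ ∂μ := by
      rw [integral_norm_eq_lintegral_enorm hi.1, eLpNorm_one_eq_lintegral_enorm]
    rw [e, ← integral_const_mul]
    refine integral_mono_of_nonneg (Eventually.of_forall fun _ => norm_nonneg _)
      (hi.norm.const_mul C) (Eventually.of_forall fun y => ?_)
    simp only [norm_mul]
    exact mul_le_mul_of_nonneg_right (hC n y) (norm_nonneg _)
  have t4 := t2.add t1
  rw [zero_add] at t4
  refine t4.congr' ?_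
  filter_upwards [h.eventually_memLp] with n hn
  have hi : Integrable (fun y => X n y - Y y) μ := memLp_one_iff_integrable.1 (hn.sub h.memLp)
  rw [← integral_add (hi.bdd_mul (hm n) (Eventually.of_forall (hC n)))
    (hY.bdd_mul (hm n) (Eventually.of_forall (hC n)))]
  refine integral_congr_ae (Eventually.of_forall fun y => ?_)
  ring

end StrongConvergence

/-! ### Smooth functions and mollifiers on space-time -/

section SpaceTime

variable {d : ℕ}

instance instIsAddHaarMeasurePhase : (volume : Measure (Phase d)).IsAddHaarMeasure :=
  Measure.prod.instIsAddHaarMeasure _ _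

/-- Space-time `ℝ × 𝕋^d × ℝ^d`, a locally compact abelian group with Haar measure `volume`. -/
abbrev SpaceTime (d : ℕ) : Type := ℝ × Phase d

instance instIsAddHaarMeasureSpaceTime : (volume : Measure (SpaceTime d)).IsAddHaarMeasure :=
  Measure.prod.instIsAddHaarMeasure _ _

/-- The universal cover `ℝ × ℝ^d × ℝ^d` of space-time. -/
abbrev Cover (d : ℕ) : Type := ℝ × Mom d × Mom d

theorem toTorus_add (x y : Mom d) : toTorus (x + y) = toTorus x + toTorus y := by
  ext i; simp [toTorus]

theorem toTorus_zero : toTorus (0 : Mom d) = 0 := by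
  ext i; simp [toTorus]

theorem isOpenQuotientMap_toTorus : IsOpenQuotientMap (toTorus (d := d)) := by
  have h1 : IsOpenQuotientMap
      (Pi.map (fun (_ : Fin d) (x : ℝ) => (x : UnitAddCircle))) :=
    IsOpenQuotientMap.piMap fun _ => QuotientAddGroup.isOpenQuotientMap_mk
  exact h1.comp (EuclideanSpace.equiv (Fin d) ℝ).toHomeomorph.isOpenQuotientMap

theorem continuous_toTorus : Continuous (toTorus (d := d)) := isOpenQuotientMap_toTorus.continuous

/-- The covering homomorphism `ℝ × ℝ^d × ℝ^d → ℝ × 𝕋^d × ℝ^d`. -/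
def proj : Cover d →+ SpaceTime d where
  toFun x := (x.1, toTorus x.2.1, x.2.2)
  map_zero' := by simp [toTorus_zero]
  map_add' x y := by simp [toTorus_add]

theorem proj_apply (x : Cover d) : proj x = (x.1, toTorus x.2.1, x.2.2) := rfl

theorem isOpenQuotientMap_proj : IsOpenQuotientMap (proj (d := d)) :=
  IsOpenQuotientMap.id.prodMap (isOpenQuotientMap_toTorus.prodMap IsOpenQuotientMap.id)

theorem continuous_proj : Continuous (proj (d := d)) := isOpenQuotientMap_proj.continuous

theorem proj_surjective : Function.Surjective (proj (d := d)) := isOpenQuotientMap_proj.surjective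

/-- The one-parameter subgroup of space-time with velocity `v`. -/
def line (v : Cover d) : ℝ →+ SpaceTime d where
  toFun s := proj (s • v)
  map_zero' := by rw [zero_smul, map_zero]
  map_add' s r := by rw [add_smul, map_add]

theorem line_apply (v : Cover d) (s : ℝ) : line v s = proj (s • v) := rfl

theorem continuous_line (v : Cover d) : Continuous (line v) :=
  continuous_proj.comp (by fun_prop : Continuous fun s : ℝ => s • v)

/-- Smoothness on space-time, that is, smoothness of the periodic lift. -/
def IsSmooth (φ : SpaceTime d → ℝ) : Prop := ContDiff ℝ ∞ (fun x => φ (proj x))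

/-- The derivative of `φ` in the direction `v`. -/
noncomputable def dirD (v : Cover d) (φ : SpaceTime d → ℝ) (y : SpaceTime d) : ℝ :=
  deriv (fun s : ℝ => φ (y + line v s)) 0

theorem IsSmooth.hasDerivAt_proj {φ : SpaceTime d → ℝ} (h : IsSmooth φ) (v x : Cover d) :
    HasDerivAt (fun s : ℝ => φ (proj x + line v s))
      (fderiv ℝ (fun x => φ (proj x)) x v) 0 := by
  have h1 : HasFDerivAt (fun x => φ (proj x)) (fderiv ℝ (fun x => φ (proj x)) x)
      (x + (0 : ℝ) • v) := by
    rw [zero_smul, add_zero]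
    exact (h.differentiable (by simp) x).hasFDerivAt
  have h2 : HasDerivAt (fun s : ℝ => x + s • v) v 0 := by
    simpa using ((hasDerivAt_id (0 : ℝ)).smul_const v).const_add x
  have h3 := h1.comp_hasDerivAt (0 : ℝ) h2
  simpa [Function.comp_def, line_apply] using h3

theorem IsSmooth.dirD_proj {φ : SpaceTime d → ℝ} (h : IsSmooth φ) (v x : Cover d) :
    dirD v φ (proj x) = fderiv ℝ (fun x => φ (proj x)) x v := (h.hasDerivAt_proj v x).deriv

theorem IsSmooth.hasDerivAlong {φ : SpaceTime d → ℝ} (h : IsSmooth φ) (v : Cover d) :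
    HasDerivAlong (line v) φ (dirD v φ) := by
  intro y
  obtain ⟨x, rfl⟩ := proj_surjective y
  rw [h.dirD_proj]
  exact h.hasDerivAt_proj v x

theorem IsSmooth.dirD {φ : SpaceTime d → ℝ} (h : IsSmooth φ) (v : Cover d) :
    IsSmooth (dirD v φ) := by
  have e : (fun x => QFP.dirD v φ (proj x)) = fun x => fderiv ℝ (fun x => φ (proj x)) x v :=
    funext fun x => h.dirD_proj v x
  rw [IsSmooth, e]
  exact (h.fderiv_right (m := ∞) (by simp)).clm_apply contDiff_const

theorem IsSmooth.continuous {φ : SpaceTime d → ℝ} (h : IsSmooth φ) : Continuous φ :=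
  isOpenQuotientMap_proj.isQuotientMap.continuous_iff.2 (ContDiff.continuous h)

theorem IsSmooth.mul {φ ψ : SpaceTime d → ℝ} (h : IsSmooth φ) (h' : IsSmooth ψ) :
    IsSmooth (fun y => φ y * ψ y) := ContDiff.mul h h'

theorem IsSmooth.comp {φ : SpaceTime d → ℝ} {H : ℝ → ℝ} (hH : ContDiff ℝ ∞ H) (h : IsSmooth φ) :
    IsSmooth (fun y => H (φ y)) := ContDiff.comp hH h

theorem isSmooth_comp_fst {θ : ℝ → ℝ} (h : ContDiff ℝ ∞ θ) :
    IsSmooth (d := d) (fun y => θ y.1) := ContDiff.comp h contDiff_fst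

theorem isSmooth_comp_snd_snd {χ : Mom d → ℝ} (h : ContDiff ℝ ∞ χ) :
    IsSmooth (d := d) (fun y => χ y.2.2) :=
  ContDiff.comp (f := fun x : Cover d => x.2.2) h (contDiff_snd.comp contDiff_snd)

theorem IsTestFunction.isSmooth {φ : SpaceTime d → ℝ} (h : IsTestFunction φ) : IsSmooth φ := h.1

theorem IsTestFunction.continuous {φ : SpaceTime d → ℝ} (h : IsTestFunction φ) : Continuous φ :=
  h.isSmooth.continuous

theorem IsTestFunction.hasDerivAlong {φ : SpaceTime d → ℝ} (h : IsTestFunction φ) (v : Cover d) :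
    HasDerivAlong (line v) φ (QFP.dirD v φ) := h.isSmooth.hasDerivAlong v

theorem IsTestFunction.tsupport_dirD {φ : SpaceTime d → ℝ} (h : IsTestFunction φ) (v : Cover d) :
    tsupport (QFP.dirD v φ) ⊆ tsupport φ := (h.hasDerivAlong v).tsupport_subset (continuous_line v)

theorem IsTestFunction.dirD {φ : SpaceTime d → ℝ} (h : IsTestFunction φ) (v : Cover d) :
    IsTestFunction (dirD v φ) :=
  ⟨h.isSmooth.dirD v, (h.hasDerivAlong v).hasCompactSupport (continuous_line v) h.2⟩

theorem IsTestFunction.mul_left {φ ψ : SpaceTime d → ℝ} (h : IsTestFunction φ) (h' : IsSmooth ψ) :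
    IsTestFunction (fun y => ψ y * φ y) :=
  ⟨h'.mul h.isSmooth, HasCompactSupport.mul_left h.2⟩

theorem IsTestFunction.comp_sub_left {φ : SpaceTime d → ℝ} (h : IsTestFunction φ)
    (y : SpaceTime d) : IsTestFunction (fun z => φ (y - z)) := by
  obtain ⟨x, rfl⟩ := proj_surjective y
  refine ⟨?_, h.2.comp_homeomorph (Homeomorph.subLeft (proj x))⟩
  have e : (fun z : Cover d => φ (proj x - (z.1, toTorus z.2.1, z.2.2)))
      = fun z => (fun x => φ (proj x)) (x - z) := by
    ext z; simp only [← proj_apply, map_sub]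
  rw [e]
  exact ContDiff.comp (f := fun z : Cover d => x - z) h.1 (contDiff_const.sub contDiff_id)

theorem dirD_comp_sub_left (φ : SpaceTime d → ℝ) (v : Cover d) (y z : SpaceTime d) :
    dirD v (fun z => φ (y - z)) z = -dirD v φ (y - z) := by
  have e : (fun s : ℝ => φ (y - (z + line v s))) = fun s : ℝ => φ (y - z + line v (-s)) := by
    ext s; rw [map_neg]; congr 1; abel
  simp only [dirD, e]
  have := deriv_comp_neg (fun s => φ (y - z + line v s)) 0
  simpa using this

/-- The unit vector of the time direction. -/
def dirT : Cover d := (1, 0, 0)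

/-- The coordinate vectors of the position directions. -/
noncomputable def dirX (i : Fin d) : Cover d := (0, EuclideanSpace.single i 1, 0)

/-- The coordinate vectors of the momentum directions. -/
noncomputable def dirP (i : Fin d) : Cover d := (0, 0, EuclideanSpace.single i 1)

theorem derivT_eq (φ : SpaceTime d → ℝ) (t : ℝ) (z : Phase d) :
    derivT φ t z = dirD dirT φ (t, z) := by
  have := deriv_comp_const_add (fun s : ℝ => φ (s, z.1, z.2)) t 0
  rw [add_zero] at this
  rw [derivT, ← this, dirD]
  simp [line_apply, proj_apply, dirT, toTorus_zero, Prod.add_def]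

theorem derivX_eq (φ : SpaceTime d → ℝ) (v : Mom d) (t : ℝ) (z : Phase d) :
    derivX φ v t z = dirD (0, v, 0) φ (t, z) := by
  simp [derivX, dirD, line_apply, proj_apply, Prod.add_def]

theorem IsSmooth.contDiff_momentum {φ : SpaceTime d → ℝ} (h : IsSmooth φ) (t : ℝ) (x : Torus d) :
    ContDiff ℝ ∞ (fun q : Mom d => φ (t, x, q)) := by
  obtain ⟨x, rfl⟩ := isOpenQuotientMap_toTorus.surjective x
  exact ContDiff.comp (f := fun q : Mom d => ((t, x, q) : Cover d)) h (by fun_prop)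

theorem IsSmooth.derivP_eq {φ : SpaceTime d → ℝ} (h : IsSmooth φ) (v : Mom d) (t : ℝ)
    (z : Phase d) : derivP φ v t z = QFP.dirD (0, 0, v) φ (t, z) := by
  have h1 : HasFDerivAt (fun q : Mom d => φ (t, z.1, q))
      (fderiv ℝ (fun q : Mom d => φ (t, z.1, q)) z.2) (z.2 + (0 : ℝ) • v) := by
    rw [zero_smul, add_zero]
    exact ((h.contDiff_momentum t z.1).differentiable (by simp) z.2).hasFDerivAt
  have h2 : HasDerivAt (fun s : ℝ => z.2 + s • v) v 0 := by
    simpa using ((hasDerivAt_id (0 : ℝ)).smul_const v).const_add z.2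
  have h3 := (h1.comp_hasDerivAt (0 : ℝ) h2).deriv
  rw [derivP, ← h3, QFP.dirD]
  simp [Function.comp_def, line_apply, proj_apply, toTorus_zero, Prod.add_def]

theorem IsSmooth.laplaceP_eq {φ : SpaceTime d → ℝ} (h : IsSmooth φ) (t : ℝ) (z : Phase d) :
    laplaceP φ t z = ∑ i, QFP.dirD (dirP i) (QFP.dirD (dirP i) φ) (t, z) := by
  rw [laplaceP, InnerProductSpace.laplacian_eq_iteratedFDeriv_orthonormalBasis _
    (EuclideanSpace.basisFun (Fin d) ℝ)]
  refine Finset.sum_congr rfl fun i _ => ?_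
  set b := EuclideanSpace.basisFun (Fin d) ℝ i with hb
  have hbe : b = EuclideanSpace.single i 1 := by simp [hb]
  have hs := h.contDiff_momentum t z.1
  have e1 : ∀ (ψ : SpaceTime d → ℝ), IsSmooth ψ → ∀ q : Mom d,
      QFP.dirD (dirP i) ψ (t, z.1, q) = fderiv ℝ (fun q : Mom d => ψ (t, z.1, q)) q b := by
    intro ψ hψ q
    rw [hbe]
    exact (hψ.derivP_eq _ t (z.1, q)).symm
  have e2 := e1 _ (h.dirD (dirP i)) z.2
  have e3 : (fun q : Mom d => QFP.dirD (dirP i) φ (t, z.1, q))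
      = fun q => fderiv ℝ (fun q : Mom d => φ (t, z.1, q)) q b := funext (e1 φ h)
  rw [e3] at e2
  rw [show (t, z) = (t, z.1, z.2) from rfl, e2, iteratedFDeriv_two_apply]
  have h4 : DifferentiableAt ℝ (fderiv ℝ (fun q : Mom d => φ (t, z.1, q))) z.2 :=
    (hs.fderiv_right (m := ∞) (by simp)).differentiable (by simp) z.2
  rw [fderiv_clm_apply h4 (differentiableAt_const _)]
  simp

theorem IsSmooth.dirD_sum_smul {φ : SpaceTime d → ℝ} (h : IsSmooth φ) {ι : Type*}
    (s : Finset ι) (c : ι → ℝ) (v : ι → Cover d) (y : SpaceTime d) :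
    QFP.dirD (∑ i ∈ s, c i • v i) φ y = ∑ i ∈ s, c i * QFP.dirD (v i) φ y := by
  obtain ⟨x, rfl⟩ := proj_surjective y
  simp [h.dirD_proj, map_sum]

theorem euclidean_eq_sum (p : Mom d) : p = ∑ i, p i • EuclideanSpace.single i (1 : ℝ) := by
  have := (EuclideanSpace.basisFun (Fin d) ℝ).sum_repr p
  simpa using this.symm

theorem IsSmooth.derivX_eq_sum {φ : SpaceTime d → ℝ} (h : IsSmooth φ) (p : Mom d) (t : ℝ)
    (z : Phase d) : derivX φ p t z = ∑ i, p i * QFP.dirD (dirX i) φ (t, z) := by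
  rw [derivX_eq, ← h.dirD_sum_smul]
  congr 1
  conv_lhs => rw [euclidean_eq_sum p]
  ext1
  · simp [dirX, Prod.fst_sum]
  · ext1 <;> simp [dirX, Prod.fst_sum, Prod.snd_sum]

theorem IsSmooth.derivP_eq_sum {φ : SpaceTime d → ℝ} (h : IsSmooth φ) (p : Mom d) (t : ℝ)
    (z : Phase d) : derivP φ p t z = ∑ i, p i * QFP.dirD (dirP i) φ (t, z) := by
  rw [h.derivP_eq, ← h.dirD_sum_smul]
  congr 1
  conv_lhs => rw [euclidean_eq_sum p]
  ext1
  · simp [dirP, Prod.fst_sum]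
  · ext1 <;> simp [dirP, Prod.fst_sum, Prod.snd_sum]

/-- A smooth proper function on space-time which vanishes at the origin only; it plays the role of
the square of the distance to the origin. -/
noncomputable def gauge (y : SpaceTime d) : ℝ :=
  y.1 ^ 2 + (∑ i, (1 - (fourier 1 (y.2.1 i) : ℂ).re)) + ‖y.2.2‖ ^ 2

theorem isSmooth_gauge : IsSmooth (gauge (d := d)) := by
  have e : ∀ x : Cover d, gauge (proj x)
      = x.1 ^ 2 + (∑ i, (1 - Real.cos (2 * Real.pi * x.2.1 i))) + ‖x.2.2‖ ^ 2 := by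
    intro x
    simp only [gauge, proj_apply, toTorus]
    congr 2
    refine Finset.sum_congr rfl fun i _ => ?_
    rw [fourier_coe_apply]
    have : (2 * ↑Real.pi * Complex.I * ((1 : ℤ) : ℂ) * ((x.2.1 i : ℝ) : ℂ) / ((1 : ℝ) : ℂ))
        = ((2 * Real.pi * x.2.1 i : ℝ) : ℂ) * Complex.I := by push_cast; ring
    rw [this, Complex.exp_ofReal_mul_I_re]
  rw [IsSmooth, funext e]
  refine ((contDiff_fst.pow 2).add (ContDiff.sum fun i _ => contDiff_const.sub
    (Real.contDiff_cos.comp (contDiff_const.mul ?_)))).add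
    ((contDiff_norm_sq ℝ).comp (contDiff_snd.comp contDiff_snd))
  fun_prop

theorem one_sub_re_fourier_nonneg (x : UnitAddCircle) : 0 ≤ 1 - (fourier 1 x : ℂ).re := by
  have h1 : ‖(fourier 1 x : ℂ)‖ = 1 := by rw [fourier_apply]; exact Circle.norm_coe _
  have := Complex.re_le_norm (fourier 1 x : ℂ)
  linarith

theorem gauge_nonneg (y : SpaceTime d) : 0 ≤ gauge y := by
  have := Finset.sum_nonneg fun i (_ : i ∈ Finset.univ) => one_sub_re_fourier_nonneg (y.2.1 i)
  unfold gauge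
  positivity

theorem eq_zero_of_gauge_eq_zero {y : SpaceTime d} (h : gauge y = 0) : y = 0 := by
  have h0 := fun i => one_sub_re_fourier_nonneg (y.2.1 i)
  have hs := Finset.sum_nonneg fun i (_ : i ∈ Finset.univ) => h0 i
  unfold gauge at h
  have h1 : y.1 ^ 2 = 0 := by nlinarith [sq_nonneg y.1, sq_nonneg ‖y.2.2‖]
  have h2 : ‖y.2.2‖ ^ 2 = 0 := by nlinarith [sq_nonneg y.1, sq_nonneg ‖y.2.2‖]
  have h3 : ∑ i, (1 - (fourier 1 (y.2.1 i) : ℂ).re) = 0 := by linarith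
  have h4 := (Finset.sum_eq_zero_iff_of_nonneg fun i _ => h0 i).1 h3
  refine Prod.ext (by simpa using h1) (Prod.ext ?_ (by simpa using h2))
  funext i
  have h5 : (fourier 1 (y.2.1 i) : ℂ).re = 1 := by linarith [h4 i (Finset.mem_univ i)]
  have h6 : ‖(fourier 1 (y.2.1 i) : ℂ)‖ = 1 := by rw [fourier_apply]; exact Circle.norm_coe _
  have h7 : (fourier 1 (y.2.1 i) : ℂ) = 1 := by
    have : (fourier 1 (y.2.1 i) : ℂ).im = 0 := by
      have := Complex.sq_norm (fourier 1 (y.2.1 i) : ℂ)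
      rw [Complex.normSq_apply, h6, h5] at this
      nlinarith
    exact Complex.ext (by simpa using h5) (by simpa using this)
  rw [fourier_apply, one_smul, Circle.coe_eq_one] at h7
  exact AddCircle.injective_toCircle one_ne_zero (by simpa using h7)

theorem isCompact_gauge_le : IsCompact {y : SpaceTime d | gauge y ≤ 1} := by
  refine IsCompact.of_isClosed_subset (s := Icc (-1 : ℝ) 1 ×ˢ (univ ×ˢ Metric.closedBall 0 1))
    (isCompact_Icc.prod (isCompact_univ.prod (isCompact_closedBall _ _)))
    (isClosed_le isSmooth_gauge.continuous continuous_const) fun y hy => ?_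
  have hs := Finset.sum_nonneg fun i (_ : i ∈ Finset.univ) =>
    one_sub_re_fourier_nonneg (y.2.1 i)
  simp only [mem_ofPred_eq, gauge] at hy
  have h1 : y.1 ^ 2 ≤ 1 := by nlinarith [sq_nonneg ‖y.2.2‖]
  have h2 : ‖y.2.2‖ ^ 2 ≤ 1 := by nlinarith [sq_nonneg y.1]
  refine ⟨⟨by nlinarith, by nlinarith⟩, mem_univ _, ?_⟩
  rw [mem_closedBall_zero_iff]
  nlinarith [norm_nonneg y.2.2]

/-- Mollifiers exist on space-time: an approximate identity of test functions. -/
theorem exists_mollifier (d : ℕ) : ∃ ρ : ℕ → SpaceTime d → ℝ,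
    IsApproxIdentity volume ρ ∧ ∀ n, IsTestFunction (ρ n) := by
  let r : ℕ → SpaceTime d → ℝ := fun n y => Real.smoothTransition (1 - (n + 1) * gauge y)
  have hrs : ∀ n, IsSmooth (r n) := fun n =>
    isSmooth_gauge.comp (H := fun s => Real.smoothTransition (1 - (n + 1) * s))
      (Real.smoothTransition.contDiff.comp (by fun_prop))
  have hr0 : ∀ n y, 0 ≤ r n y := fun n y => Real.smoothTransition.nonneg _
  have hts : ∀ n, tsupport (r n) ⊆ {y | (n + 1) * gauge y ≤ 1} := by
    intro n
    refine closure_minimal (fun y hy => ?_)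
      (isClosed_le (continuous_const.mul isSmooth_gauge.continuous) continuous_const)
    by_contra hn
    simp only [mem_ofPred_eq, not_le] at hn
    exact hy (Real.smoothTransition.zero_of_nonpos (by linarith))
  have hrc : ∀ n, HasCompactSupport (r n) := fun n => by
    refine IsCompact.of_isClosed_subset isCompact_gauge_le (isClosed_tsupport _)
      fun y hy => ?_
    have h1 : ((n : ℝ) + 1) * gauge y ≤ 1 := hts n hy
    have h2 := gauge_nonneg y
    have h3 : (0 : ℝ) ≤ n := n.cast_nonneg
    simp only [mem_ofPred_eq]
    nlinarith
  have hpos : ∀ n, 0 < ∫ y, r n y := fun n => by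
    refine (hrs n).continuous.integral_pos_of_hasCompactSupport_nonneg_nonzero (hrc n) (hr0 n)
      (x := 0) ?_
    have : gauge (0 : SpaceTime d) = 0 := by simp [gauge]
    simp [r, this, Real.smoothTransition.one]
  have htest : ∀ n, IsTestFunction (fun y => (∫ y, r n y)⁻¹ * r n y) := fun n =>
    IsTestFunction.mul_left ⟨hrs n, hrc n⟩ (ψ := fun _ => (∫ y, r n y)⁻¹) contDiff_const
  refine ⟨fun n y => (∫ y, r n y)⁻¹ * r n y, ⟨fun n => (htest n).continuous,
    fun n => (htest n).2, fun n y => mul_nonneg (inv_nonneg.2 (hpos n).le) (hr0 n y),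
    fun n => ?_, fun U hU => ?_⟩, htest⟩
  · rw [integral_const_mul, inv_mul_cancel₀ (hpos n).ne']
  · -- Outside a neighbourhood of the origin the gauge has a positive minimum on a compact set.
    obtain ⟨V, hVU, hVo, hV0⟩ := mem_nhds_iff.1 hU
    have hK : IsCompact ({y : SpaceTime d | gauge y ≤ 1} ∩ Vᶜ) :=
      isCompact_gauge_le.inter_right hVo.isClosed_compl
    have hm : ∃ m > 0, ∀ y ∈ {y : SpaceTime d | gauge y ≤ 1} ∩ Vᶜ, m ≤ gauge y := by
      rcases ({y : SpaceTime d | gauge y ≤ 1} ∩ Vᶜ).eq_empty_or_nonempty with he | hne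
      · exact ⟨1, one_pos, by simp [he]⟩
      · obtain ⟨y₀, hy₀, hmin⟩ := hK.exists_isMinOn hne isSmooth_gauge.continuous.continuousOn
        refine ⟨gauge y₀, (gauge_nonneg y₀).lt_of_ne fun h => hy₀.2 ?_, fun y hy => hmin hy⟩
        rw [eq_zero_of_gauge_eq_zero h.symm]
        exact hV0
    obtain ⟨m, hm0, hm⟩ := hm
    obtain ⟨N, hN⟩ := exists_nat_gt (1 / m)
    filter_upwards [eventually_ge_atTop N] with n hn y hy
    have h1 : ((n : ℝ) + 1) * gauge y ≤ 1 := hts n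
      (tsupport_mul_subset_right (f := fun _ => (∫ y, r n y)⁻¹) hy)
    have h2 := gauge_nonneg y
    have h3 : (0 : ℝ) ≤ n := n.cast_nonneg
    refine hVU (by_contra fun hyV => ?_)
    have h4 := hm y ⟨by simp only [mem_ofPred_eq]; nlinarith, hyV⟩
    have h5 : (N : ℝ) ≤ n := Nat.cast_le.2 hn
    rw [div_lt_iff₀ hm0] at hN
    nlinarith

end SpaceTime

/-! ### Weak derivatives, the chain rule and renormalization -/

section WeakDerivative

variable {d : ℕ}

/-- `F` is the derivative of `u` in the direction `v`, in the sense of distributions on `Ω`. -/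
def HasWeakDeriv (Ω : Set (SpaceTime d)) (v : Cover d) (u F : SpaceTime d → ℝ) : Prop :=
  ∀ φ : SpaceTime d → ℝ, IsTestFunction φ → tsupport φ ⊆ Ω →
    ∫ y, u y * dirD v φ y = -∫ y, F y * φ y

/-- For large `n`, the mollified function at a point of the compact set `K` depends on the values in
`Ω` only. -/
theorem IsApproxIdentity.eventually_tsupport_subset {ρ : ℕ → SpaceTime d → ℝ}
    (hρ : IsApproxIdentity volume ρ) {K Ω : Set (SpaceTime d)} (hK : IsCompact K) (hΩ : IsOpen Ω)
    (hKΩ : K ⊆ Ω) : ∀ᶠ n in atTop, ∀ y ∈ K, tsupport (fun z => ρ n (y - z)) ⊆ Ω := by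
  obtain ⟨V, hV, hVK⟩ := compact_open_separated_add_left hK hΩ hKΩ
  have hV' : -V ∈ 𝓝 (0 : SpaceTime d) := by
    have := neg_mem_nhds_zero (SpaceTime d) hV
    exact this
  filter_upwards [hρ.tsupport_subset _ hV'] with n hn y hy z hz
  have h1 : y - z ∈ tsupport (ρ n) :=
    tsupport_comp_subset_preimage (ρ n) (f := fun z => y - z) (by fun_prop) hz
  have h2 : z - y ∈ V := by simpa using hn h1
  have := hVK (add_mem_add h2 hy)
  simpa using this

/-- Mollification commutes with the weak derivative, at points where the kernel does not see the
complement of `Ω`. -/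
theorem HasWeakDeriv.conv_dirD {Ω : Set (SpaceTime d)} {v : Cover d} {u F ρ : SpaceTime d → ℝ}
    (h : HasWeakDeriv Ω v u F) (hρ : IsTestFunction ρ) {y : SpaceTime d}
    (hy : tsupport (fun z => ρ (y - z)) ⊆ Ω) :
    conv volume u (dirD v ρ) y = conv volume F ρ y := by
  have := h _ (hρ.comp_sub_left y) hy
  simp only [dirD_comp_sub_left, mul_neg, integral_neg, neg_inj] at this
  exact this

/-- Membership in `L¹ ∩ L²`. -/
def MemL1L2 (u : SpaceTime d → ℝ) : Prop := MemLp u 1 volume ∧ MemLp u 2 volume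

theorem tendstoLp_conv {p : ENNReal} (hp1 : 1 ≤ p) (hp : p ≠ ⊤) {u : SpaceTime d → ℝ}
    (hu : MemLp u p volume) {ρ : ℕ → SpaceTime d → ℝ} (hρ : IsApproxIdentity volume ρ) :
    TendstoLp p volume (fun n => conv volume u (ρ n)) u :=
  ⟨fun n => (continuous_conv (hu.locallyIntegrable hp1) (hρ.continuous n)
    (hρ.hasCompactSupport n)).aestronglyMeasurable, hu, tendsto_eLpNorm_conv_sub hp1 hp hu hρ⟩

/-- The product and chain rules for `H(u) w` with `u = f - g` and `w = u + κ (f² - g²)`. They hold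
for the mollified functions, and every term is the product of an `L¹`-convergent sequence and a
bounded one: the term containing `H'` is written as `u H'(u)` times `(1 + κ (f + g)) ∂u`. -/
theorem weak_chain_rule {Ω : Set (SpaceTime d)} (hΩ : IsOpen Ω) {v : Cover d} {κ C : ℝ}
    {f g F G : SpaceTime d → ℝ} (hf : MemL1L2 f) (hg : MemL1L2 g) (hF : MemL1L2 F)
    (hG : MemL1L2 G) (hfF : HasWeakDeriv Ω v f F) (hgG : HasWeakDeriv Ω v g G)
    {H H' : ℝ → ℝ} (hH : ∀ r, HasDerivAt H (H' r) r) (hH' : Continuous H')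
    (hHC : ∀ r, |H r| ≤ C) (hHC' : ∀ r, |r * H' r| ≤ C)
    {ψ : SpaceTime d → ℝ} (hψ : IsTestFunction ψ) (hψΩ : tsupport ψ ⊆ Ω) :
    ∫ y, (dirD v ψ y * H (f y - g y)) * ((f y - g y) + κ * (f y * f y - g y * g y))
      = -((∫ y, (ψ y * H (f y - g y)) * ((F y - G y) + 2 * κ * (f y * F y - g y * G y)))
        + ∫ y, (ψ y * ((f y - g y) * H' (f y - g y)))
            * ((F y - G y) + κ * ((f y + g y) * (F y - G y)))) := by
  obtain ⟨ρ, hρ, hρt⟩ := exists_mollifier d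
  have hHc : Continuous H := continuous_iff_continuousAt.2 fun r => (hH r).continuousAt
  have hC0 : 0 ≤ C := (abs_nonneg _).trans (hHC 0)
  have t1 : ∀ {u : SpaceTime d → ℝ}, MemL1L2 u →
      TendstoLp 1 volume (fun n => conv volume u (ρ n)) u :=
    fun hu => tendstoLp_conv le_rfl (by simp) hu.1 hρ
  have t2 : ∀ {u : SpaceTime d → ℝ}, MemL1L2 u →
      TendstoLp 2 volume (fun n => conv volume u (ρ n)) u :=
    fun hu => tendstoLp_conv (by norm_num) (by simp) hu.2 hρ
  have cc : ∀ {u : SpaceTime d → ℝ}, MemL1L2 u → ∀ n, Continuous (conv volume u (ρ n)) :=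
    fun hu n => continuous_conv (hu.1.locallyIntegrable le_rfl) (hρ.continuous n)
      (hρ.hasCompactSupport n)
  obtain ⟨ns, hns, hae⟩ := ((t1 hf).sub le_rfl (t1 hg)).exists_ae_tendsto le_rfl
  have tw := (((t1 hf).sub le_rfl (t1 hg)).add le_rfl
    ((((t2 hf).mul (t2 hf)).sub le_rfl ((t2 hg).mul (t2 hg))).const_mul κ)).comp_strictMono hns
  have tW := (((t1 hF).sub le_rfl (t1 hG)).add le_rfl
    ((((t2 hf).mul (t2 hF)).sub le_rfl ((t2 hg).mul (t2 hG))).const_mul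
      (2 * κ))).comp_strictMono hns
  have tZ := (((t1 hF).sub le_rfl (t1 hG)).add le_rfl
    ((((t2 hf).add (by norm_num) (t2 hg)).mul
      ((t2 hF).sub (by norm_num) (t2 hG))).const_mul κ)).comp_strictMono hns
  obtain ⟨C₁, hC₁⟩ := hψ.2.exists_bound_of_continuous hψ.continuous
  obtain ⟨C₂, hC₂⟩ := (hψ.dirD v).2.exists_bound_of_continuous (hψ.dirD v).continuous
  have bd : ∀ {a b A B : ℝ}, |a| ≤ A → |b| ≤ B → |a * b| ≤ A * B := fun ha hb => by
    rw [abs_mul]; exact mul_le_mul ha hb (abs_nonneg _) ((abs_nonneg _).trans ha)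
  have cu : ∀ n, Continuous fun y => conv volume f (ρ n) y - conv volume g (ρ n) y :=
    fun n => (cc hf n).sub (cc hg n)
  have l1 := tendsto_integral_mul (C := C₂ * C) tw
    (m := fun n y => dirD v ψ y
      * H (conv volume f (ρ (ns n)) y - conv volume g (ρ (ns n)) y))
    (m₀ := fun y => dirD v ψ y * H (f y - g y))
    (fun n => ((hψ.dirD v).continuous.mul (hHc.comp (cu _))).aestronglyMeasurable)
    (fun n y => bd (hC₂ y) (hHC _))
    (hae.mono fun y hy => ((hHc.tendsto _).comp hy).const_mul _)
  have l2 := tendsto_integral_mul (C := C₁ * C) tW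
    (m := fun n y => ψ y * H (conv volume f (ρ (ns n)) y - conv volume g (ρ (ns n)) y))
    (m₀ := fun y => ψ y * H (f y - g y))
    (fun n => (hψ.continuous.mul (hHc.comp (cu _))).aestronglyMeasurable)
    (fun n y => bd (hC₁ y) (hHC _))
    (hae.mono fun y hy => ((hHc.tendsto _).comp hy).const_mul _)
  have l3 := tendsto_integral_mul (C := C₁ * C) tZ
    (m := fun n y => ψ y * ((conv volume f (ρ (ns n)) y - conv volume g (ρ (ns n)) y)
      * H' (conv volume f (ρ (ns n)) y - conv volume g (ρ (ns n)) y)))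
    (m₀ := fun y => ψ y * ((f y - g y) * H' (f y - g y)))
    (fun n => (hψ.continuous.mul ((cu _).mul (hH'.comp (cu _)))).aestronglyMeasurable)
    (fun n y => bd (hC₁ y) (hHC' _))
    (hae.mono fun y hy => (hy.mul ((hH'.tendsto _).comp hy)).const_mul _)
  refine tendsto_nhds_unique l1 (((l2.add l3).neg).congr' ?_)
  have hev := hns.tendsto_atTop.eventually
    (hρ.eventually_tsupport_subset hψ.2 hΩ hψΩ)
  filter_upwards [hev] with n hn
  set N := ns n
  have lf := hf.1.locallyIntegrable le_rfl
  have lg := hg.1.locallyIntegrable le_rfl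
  have df := hasDerivAlong_conv (μ := volume) (continuous_line v) lf (hρ.continuous N)
    ((hρt N).dirD v).continuous (hρ.hasCompactSupport N) ((hρt N).hasDerivAlong v)
  have dg := hasDerivAlong_conv (μ := volume) (continuous_line v) lg (hρ.continuous N)
    ((hρt N).dirD v).continuous (hρ.hasCompactSupport N) ((hρt N).hasDerivAlong v)
  have cf' : Continuous (conv volume f (dirD v (ρ N))) :=
    continuous_conv lf ((hρt N).dirD v).continuous ((hρt N).dirD v).2
  have cg' : Continuous (conv volume g (dirD v (ρ N))) :=
    continuous_conv lg ((hρt N).dirD v).continuous ((hρt N).dirD v).2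
  have cf := cc hf N
  have cg := cc hg N
  have cF := cc hF N
  have cG := cc hG N
  set f₁ := conv volume f (ρ N)
  set g₁ := conv volume g (ρ N)
  set f₂ := conv volume f (dirD v (ρ N)) with hf₂
  set g₂ := conv volume g (dirD v (ρ N)) with hg₂
  have cH : Continuous fun y => H (f₁ y - g₁ y) := hHc.comp (cf.sub cg)
  have cH' : Continuous fun y => H' (f₁ y - g₁ y) := hH'.comp (cf.sub cg)
  have dw := ((df.sub dg).add (((df.mul df).sub (dg.mul dg)).const_mul κ))
  have dHw := ((df.sub dg).comp hH).mul dw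
  have ibp := integral_mul_deriv_eq_neg (μ := volume) (continuous_line v) (by fun_prop)
    (by fun_prop) hψ.continuous (hψ.dirD v).continuous hψ.2 dHw (hψ.hasDerivAlong v)
  have e1 : (∫ y, (dirD v ψ y * H (f₁ y - g₁ y)) * ((f₁ y - g₁ y)
      + κ * (f₁ y * f₁ y - g₁ y * g₁ y)))
      = ∫ y, H (f₁ y - g₁ y) * ((f₁ y - g₁ y)
      + κ * (f₁ y * f₁ y - g₁ y * g₁ y)) * dirD v ψ y :=
    integral_congr_ae (Eventually.of_forall fun y => by ring)
  rw [e1, ibp, neg_inj, ← integral_add]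
  · refine integral_congr_ae (Eventually.of_forall fun y => ?_)
    by_cases hy : y ∈ tsupport ψ
    · have ef : f₂ y = conv volume F (ρ N) y := hfF.conv_dirD (hρt N) (hn y hy)
      have eg : g₂ y = conv volume G (ρ N) y := hgG.conv_dirD (hρt N) (hn y hy)
      simp only [ef, eg]
      ring
    · simp [image_eq_zero_of_notMem_tsupport hy]
  · refine Continuous.integrable_of_hasCompactSupport ?_ ?_
    · have := hψ.continuous
      fun_prop
    · exact (hψ.2.mul_right).mul_right
  · refine Continuous.integrable_of_hasCompactSupport ?_ ?_
    · have := hψ.continuous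
      fun_prop
    · exact (hψ.2.mul_right).mul_right

/-- The case `H = 1` of the chain rule: the weak derivative of `f - g + κ (f² - g²)`. -/
theorem hasWeakDeriv_flux {Ω : Set (SpaceTime d)} (hΩ : IsOpen Ω) {v : Cover d} {κ : ℝ}
    {f g F G : SpaceTime d → ℝ} (hf : MemL1L2 f) (hg : MemL1L2 g) (hF : MemL1L2 F)
    (hG : MemL1L2 G) (hfF : HasWeakDeriv Ω v f F) (hgG : HasWeakDeriv Ω v g G) :
    HasWeakDeriv Ω v (fun y => (f y - g y) + κ * (f y * f y - g y * g y))
      (fun y => (F y - G y) + 2 * κ * (f y * F y - g y * G y)) := by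
  intro φ hφ hφΩ
  have := weak_chain_rule (κ := κ) (C := 1) hΩ hf hg hF hG hfF hgG (H := fun _ => 1)
    (H' := fun _ => 0)
    (fun r => hasDerivAt_const r 1) continuous_const (by simp) (by simp) hφ hφΩ
  simp only [mul_one, mul_zero, zero_mul, integral_zero, add_zero] at this
  simp only [mul_comm _ (dirD v φ _), mul_comm _ (φ _)]
  exact this

theorem TendstoLp.comp_lipschitz {α : Type*} [MeasurableSpace α] {μ : Measure α}
    {X : ℕ → α → ℝ} {Y : α → ℝ} (h : TendstoLp 1 μ X Y) {Φ : ℝ → ℝ} {C : ℝ}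
    (hΦ : ∀ a b, |Φ a - Φ b| ≤ C * |a - b|) (hΦ0 : Φ 0 = 0) (hc : Continuous Φ) :
    TendstoLp 1 μ (fun n y => Φ (X n y)) (fun y => Φ (Y y)) := by
  refine ⟨fun n => hc.comp_aestronglyMeasurable (h.aestronglyMeasurable n), ?_, ?_⟩
  · refine MemLp.of_le_mul (c := C) h.memLp (hc.comp_aestronglyMeasurable h.memLp.1)
      (Eventually.of_forall fun y => ?_)
    simpa [hΦ0] using hΦ (Y y) 0
  · have h1 := ENNReal.Tendsto.const_mul (a := ENNReal.ofReal C) h.tendsto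
      (Or.inr ENNReal.ofReal_ne_top)
    rw [mul_zero] at h1
    refine tendsto_of_tendsto_of_tendsto_of_le_of_le tendsto_const_nhds h1 (fun _ => zero_le)
      fun n => eLpNorm_le_mul_eLpNorm_of_ae_le_mul (Eventually.of_forall fun y => ?_) 1
    exact hΦ _ _

/-- Renormalization of a weak solution of `∂ₜ u = A + Δₚ u` by a convex function `Φ`, with
derivatives `H` and `H'`. The mollified solution solves the mollified equation pointwise, and the
term `Φ''(u) |∇ₚ u|²`, which would not pass to the limit for free, has a sign. -/
theorem renormalization_le {Ω : Set (SpaceTime d)} (hΩ : IsOpen Ω) {C : ℝ}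
    {u A : SpaceTime d → ℝ} (hu : MemLp u 1 volume) (hA : MemLp A 1 volume)
    (heq : ∀ φ : SpaceTime d → ℝ, IsTestFunction φ → tsupport φ ⊆ Ω →
      ∫ y, u y * (dirD dirT φ y + ∑ i, dirD (dirP i) (dirD (dirP i) φ) y) = -∫ y, A y * φ y)
    {Φ H H' : ℝ → ℝ} (hΦ : ∀ r, HasDerivAt Φ (H r) r) (hH : ∀ r, HasDerivAt H (H' r) r)
    (hH' : Continuous H') (hHC : ∀ r, |H r| ≤ C) (hconv : ∀ r, 0 ≤ H' r) (hΦ0 : Φ 0 = 0)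
    {ψ : SpaceTime d → ℝ} (hψ : IsTestFunction ψ) (hψΩ : tsupport ψ ⊆ Ω) (hψ0 : ∀ y, 0 ≤ ψ y) :
    -∫ y, dirD dirT ψ y * Φ (u y)
      ≤ (∫ y, (ψ y * H (u y)) * A y)
        + ∑ i, ∫ y, dirD (dirP i) (dirD (dirP i) ψ) y * Φ (u y) := by
  obtain ⟨ρ, hρ, hρt⟩ := exists_mollifier d
  have hHc : Continuous H := continuous_iff_continuousAt.2 fun r => (hH r).continuousAt
  have hΦc : Continuous Φ := continuous_iff_continuousAt.2 fun r => (hΦ r).continuousAt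
  have hlip : ∀ a b, |Φ a - Φ b| ≤ C * |a - b| := fun a b =>
    convex_univ.norm_image_sub_le_of_norm_hasDerivWithin_le (f := Φ) (f' := H)
      (fun r _ => (hΦ r).hasDerivWithinAt) (fun r _ => hHC r) (mem_univ b) (mem_univ a)
  have tu := tendstoLp_conv le_rfl (by simp) hu hρ
  have tA := tendstoLp_conv le_rfl (by simp) hA hρ
  obtain ⟨ns, hns, hae⟩ := tu.exists_ae_tendsto le_rfl
  have tΦ := (tu.comp_strictMono hns).comp_lipschitz hlip hΦ0 hΦc
  have lu := hu.locallyIntegrable le_rfl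
  have lA := hA.locallyIntegrable le_rfl
  have cu : ∀ n, Continuous (conv volume u (ρ n)) := fun n =>
    continuous_conv lu (hρ.continuous n) (hρ.hasCompactSupport n)
  have cA : ∀ n, Continuous (conv volume A (ρ n)) := fun n =>
    continuous_conv lA (hρ.continuous n) (hρ.hasCompactSupport n)
  have lim : ∀ q : SpaceTime d → ℝ, IsTestFunction q →
      Tendsto (fun n => ∫ y, q y * Φ (conv volume u (ρ (ns n)) y)) atTop
        (𝓝 (∫ y, q y * Φ (u y))) := fun q hq => by
    obtain ⟨C₁, hC₁⟩ := hq.2.exists_bound_of_continuous hq.continuous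
    exact tendsto_integral_mul (C := C₁) (m := fun _ => q) (m₀ := q) tΦ
      (fun _ => hq.continuous.aestronglyMeasurable) (fun _ y => hC₁ y)
      (Eventually.of_forall fun y => tendsto_const_nhds)
  have limA : Tendsto (fun n => ∫ y, (ψ y * H (conv volume u (ρ (ns n)) y))
      * conv volume A (ρ (ns n)) y) atTop (𝓝 (∫ y, (ψ y * H (u y)) * A y)) := by
    obtain ⟨C₁, hC₁⟩ := hψ.2.exists_bound_of_continuous hψ.continuous
    refine tendsto_integral_mul (C := C₁ * C)
      (m := fun n y => ψ y * H (conv volume u (ρ (ns n)) y)) (m₀ := fun y => ψ y * H (u y))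
      (tA.comp_strictMono hns)
      (fun n => (hψ.continuous.mul (hHc.comp (cu _))).aestronglyMeasurable) (fun n y => ?_)
      (hae.mono fun y hy => ((hHc.tendsto _).comp hy).const_mul _)
    rw [abs_mul]
    exact mul_le_mul (hC₁ y) (hHC _) (abs_nonneg _) ((abs_nonneg _).trans (hC₁ y))
  refine le_of_tendsto_of_tendsto (lim _ (hψ.dirD _)).neg
    (limA.add (tendsto_finsetSum _ fun i _ => lim _ ((hψ.dirD (dirP i)).dirD (dirP i)))) ?_
  filter_upwards [hns.tendsto_atTop.eventually
    (hρ.eventually_tsupport_subset hψ.2 hΩ hψΩ)] with n hn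
  set N := ns n
  -- The derivatives of the mollified solution.
  have dconv : ∀ {σ : SpaceTime d → ℝ}, IsTestFunction σ → ∀ v : Cover d,
      HasDerivAlong (line v) (conv volume u σ) (conv volume u (dirD v σ)) := fun hσ v =>
    hasDerivAlong_conv (continuous_line v) lu hσ.continuous (hσ.dirD v).continuous hσ.2
      (hσ.hasDerivAlong v)
  have cconv : ∀ {σ : SpaceTime d → ℝ}, IsTestFunction σ → Continuous (conv volume u σ) :=
    fun hσ => continuous_conv lu hσ.continuous hσ.2
  have hpde : ∀ y ∈ tsupport ψ, conv volume u (dirD dirT (ρ N)) y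
      = conv volume A (ρ N) y + ∑ i, conv volume u (dirD (dirP i) (dirD (dirP i) (ρ N))) y := by
    intro y hy
    have h1 := heq _ ((hρt N).comp_sub_left y) (hn y hy)
    have h2 : ∀ i, ∀ z, dirD (dirP i) (dirD (dirP i) fun z => ρ N (y - z)) z
        = dirD (dirP i) (dirD (dirP i) (ρ N)) (y - z) := by
      intro i z
      have e : (dirD (dirP i) fun z => ρ N (y - z))
          = fun z => (-1 : ℝ) * dirD (dirP i) (ρ N) (y - z) := by
        ext z; rw [dirD_comp_sub_left, neg_one_mul]
      have h3 : HasDerivAlong (line (dirP i)) (fun z => dirD (dirP i) (ρ N) (y - z)) _ :=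
        (((hρt N).dirD (dirP i)).comp_sub_left y).hasDerivAlong (dirP i)
      have h4 := ((h3.const_mul (-1)) z).deriv
      rw [e]
      refine h4.trans ?_
      simp only [dirD_comp_sub_left]
      ring
    simp only [dirD_comp_sub_left, h2, mul_add, Finset.mul_sum] at h1
    have ii : ∀ {σ : SpaceTime d → ℝ}, IsTestFunction σ →
        Integrable (fun z => u z * σ (y - z)) volume := fun hσ =>
      integrable_mul_comp_sub lu hσ.continuous hσ.2 y
    have i1 : Integrable (fun z => u z * -dirD dirT (ρ N) (y - z)) := by
      simpa using (ii ((hρt N).dirD dirT)).neg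
    have i2 : ∀ i, Integrable (fun z => u z * dirD (dirP i) (dirD (dirP i) (ρ N)) (y - z)) :=
      fun i => ii (((hρt N).dirD _).dirD _)
    rw [integral_add i1 (integrable_finsetSum _ fun i _ => i2 i),
      integral_finsetSum _ fun i _ => i2 i] at h1
    simp only [mul_neg, integral_neg] at h1
    simp only [conv]
    linarith
  have cuN := cu N
  have cAN := cA N
  set U := conv volume u (ρ N) with hU
  have cH : Continuous fun y => H (U y) := hHc.comp cuN
  have cΦ : Continuous fun y => Φ (U y) := hΦc.comp cuN
  have cH' : Continuous fun y => H' (U y) := hH'.comp cuN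
  have cψ := hψ.continuous
  have integ : ∀ q : SpaceTime d → ℝ, Continuous q → Integrable (fun y => ψ y * q y) := fun q hq =>
    (cψ.mul hq).integrable_of_hasCompactSupport hψ.2.mul_right
  have cT : Continuous (conv volume u (dirD dirT (ρ N))) := cconv ((hρt N).dirD _)
  have hT : -∫ y, dirD dirT ψ y * Φ (U y)
      = ∫ y, ψ y * (H (U y) * conv volume u (dirD dirT (ρ N)) y) := by
    have := integral_mul_deriv_eq_neg (μ := volume) (continuous_line dirT) cΦ
      (cH.mul cT) cψ (hψ.dirD dirT).continuous hψ.2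
      ((dconv (hρt N) dirT).comp hΦ) (hψ.hasDerivAlong dirT)
    simp only [mul_comm (dirD dirT ψ _), mul_comm (ψ _)]
    rw [this, neg_neg]
    rfl
  have hP : ∀ i, ∫ y, ψ y * (H (U y) * conv volume u (dirD (dirP i) (dirD (dirP i) (ρ N))) y)
      ≤ ∫ y, dirD (dirP i) (dirD (dirP i) ψ) y * Φ (U y) := by
    intro i
    have c1 : Continuous (conv volume u (dirD (dirP i) (ρ N))) := cconv ((hρt N).dirD _)
    have c2 : Continuous (conv volume u (dirD (dirP i) (dirD (dirP i) (ρ N)))) :=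
      cconv (((hρt N).dirD _).dirD _)
    have d1 := (dconv (hρt N) (dirP i)).comp hΦ
    have d2 := ((dconv (hρt N) (dirP i)).comp hH).mul (dconv ((hρt N).dirD (dirP i)) (dirP i))
    have b1 := integral_mul_deriv_eq_neg (μ := volume) (continuous_line (dirP i)) cΦ
      (cH.mul c1) (hψ.dirD (dirP i)).continuous ((hψ.dirD (dirP i)).dirD (dirP i)).continuous
      (hψ.dirD (dirP i)).2 d1 ((hψ.dirD (dirP i)).hasDerivAlong (dirP i))
    have b2 := integral_mul_deriv_eq_neg (μ := volume) (continuous_line (dirP i))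
      (cH.mul c1) (((cH'.mul c1).mul c1).add (cH.mul c2)) cψ (hψ.dirD (dirP i)).continuous
      hψ.2 d2 (hψ.hasDerivAlong (dirP i))
    simp only [mul_comm (dirD (dirP i) (dirD (dirP i) ψ) _), mul_comm (ψ _)]
    rw [b1, b2, neg_neg]
    refine integral_mono ?_ ?_ fun y => ?_
    · simpa only [mul_comm (ψ _), Pi.mul_apply] using integ _ (cH.mul c2)
    · simpa only [mul_comm (ψ _)] using integ _ (((cH'.mul c1).mul c1).add (cH.mul c2))
    · simp only [Pi.mul_apply, Pi.add_apply]
      refine mul_le_mul_of_nonneg_right ?_ (hψ0 y)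
      have : 0 ≤ H' (U y) * conv volume u (dirD (dirP i) (ρ N)) y
          * conv volume u (dirD (dirP i) (ρ N)) y := by
        rw [mul_assoc]
        exact mul_nonneg (hconv _) (mul_self_nonneg _)
      linarith
  rw [hT]
  have hsplit : ∫ y, ψ y * (H (U y) * conv volume u (dirD dirT (ρ N)) y)
      = (∫ y, (ψ y * H (U y)) * conv volume A (ρ N) y) + ∑ i,
        ∫ y, ψ y * (H (U y) * conv volume u (dirD (dirP i) (dirD (dirP i) (ρ N))) y) := by
    have i2 : ∀ i, Integrable fun y =>
        ψ y * (H (U y) * conv volume u (dirD (dirP i) (dirD (dirP i) (ρ N))) y) := fun i =>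
      integ _ (cH.mul (cconv (((hρt N).dirD _).dirD _)))
    have i1 : Integrable fun y => (ψ y * H (U y)) * conv volume A (ρ N) y := by
      simpa only [mul_assoc, Pi.mul_apply] using integ _ (cH.mul cAN)
    rw [← integral_finsetSum _ fun i _ => i2 i,
      ← integral_add i1 (integrable_finsetSum _ fun i _ => i2 i)]
    refine integral_congr_ae (Eventually.of_forall fun y => ?_)
    by_cases hy : y ∈ tsupport ψ
    · simp only [hpde y hy, ← Finset.mul_sum]
      ring
    · simp [image_eq_zero_of_notMem_tsupport hy]
  rw [hsplit]
  exact add_le_add le_rfl (Finset.sum_le_sum fun i _ => hP i)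

end WeakDerivative

/-! ### Kato's inequality -/

section Kato

variable {d : ℕ}

/-- A convex approximation of the positive part, within distance `1 / l` of it. -/
noncomputable def softPos (l s : ℝ) : ℝ := (l * s + √(1 + (l * s) ^ 2) - 1) / (2 * l)

/-- The derivative of `softPos l`, an approximation of the Heaviside function. -/
noncomputable def softStep (l s : ℝ) : ℝ := (1 + l * s / √(1 + (l * s) ^ 2)) / 2

/-- The derivative of `softStep l`. -/
noncomputable def softDelta (l s : ℝ) : ℝ :=
  l / (2 * ((1 + (l * s) ^ 2) * √(1 + (l * s) ^ 2)))

theorem hasDerivAt_sqrt_one_add_sq (l s : ℝ) :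
    HasDerivAt (fun s => √(1 + (l * s) ^ 2)) (l * (l * s) / √(1 + (l * s) ^ 2)) s := by
  have h1 : HasDerivAt (fun s => 1 + (l * s) ^ 2) (2 * (l * s) * l) s := by
    have := (((hasDerivAt_id s).const_mul l).pow 2).const_add 1
    simpa using this
  have h0 : (0 : ℝ) < 1 + (l * s) ^ 2 := by positivity
  have := h1.sqrt h0.ne'
  refine this.congr_deriv ?_
  have : √(1 + (l * s) ^ 2) ≠ 0 := (Real.sqrt_pos.2 h0).ne'
  field_simp

theorem hasDerivAt_softPos {l : ℝ} (hl : 0 < l) (s : ℝ) :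
    HasDerivAt (softPos l) (softStep l s) s := by
  have h := (((((hasDerivAt_id s).const_mul l).add
    (hasDerivAt_sqrt_one_add_sq l s))).sub_const 1).div_const (2 * l)
  refine h.congr_deriv ?_
  have h0 : √(1 + (l * s) ^ 2) ≠ 0 := (Real.sqrt_pos.2 (by positivity)).ne'
  rw [softStep]
  field_simp

theorem hasDerivAt_softStep (l s : ℝ) : HasDerivAt (softStep l) (softDelta l s) s := by
  have hp : (0 : ℝ) < 1 + (l * s) ^ 2 := by positivity
  have h0 : √(1 + (l * s) ^ 2) ≠ 0 := (Real.sqrt_pos.2 hp).ne'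
  have h := ((((hasDerivAt_id s).const_mul l).div
    (hasDerivAt_sqrt_one_add_sq l s) h0).const_add 1).div_const 2
  refine h.congr_deriv ?_
  have hs : √(1 + (l * s) ^ 2) ^ 2 = 1 + (l * s) ^ 2 := Real.sq_sqrt hp.le
  rw [softDelta]
  simp only [id, mul_one]
  set q := √(1 + (l * s) ^ 2)
  rw [← hs]
  field_simp
  rw [hs]
  ring

theorem continuous_softDelta (l : ℝ) : Continuous (softDelta l) := by
  unfold softDelta
  refine continuous_const.div (by fun_prop) fun s => ?_
  have hp : (0 : ℝ) < 1 + (l * s) ^ 2 := by positivity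
  have := Real.sqrt_pos.2 hp
  positivity

theorem softDelta_nonneg {l : ℝ} (hl : 0 < l) (s : ℝ) : 0 ≤ softDelta l s := by
  unfold softDelta; positivity

theorem softPos_zero (l : ℝ) : softPos l 0 = 0 := by simp [softPos]

theorem abs_lt_sqrt_one_add_sq (r : ℝ) : |r| < √(1 + r ^ 2) := by
  rw [← Real.sqrt_sq_eq_abs]
  exact Real.sqrt_lt_sqrt (sq_nonneg r) (by linarith)

theorem abs_softStep_le (l s : ℝ) : |softStep l s| ≤ 1 := by
  have h := abs_lt_sqrt_one_add_sq (l * s)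
  have h0 : (0 : ℝ) < √(1 + (l * s) ^ 2) := (abs_nonneg _).trans_lt h
  have h1 : |l * s / √(1 + (l * s) ^ 2)| ≤ 1 := by
    rw [abs_div, abs_of_pos h0, div_le_one h0]
    exact h.le
  rw [abs_le] at h1 ⊢
  unfold softStep
  constructor <;> linarith [h1.1, h1.2]

theorem abs_mul_softDelta (l s : ℝ) :
    |s * softDelta l s| = |l * s| / (2 * ((1 + (l * s) ^ 2) * √(1 + (l * s) ^ 2))) := by
  have h0 : (0 : ℝ) ≤ 2 * ((1 + (l * s) ^ 2) * √(1 + (l * s) ^ 2)) := by positivity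
  rw [softDelta, mul_div_assoc', abs_div, abs_of_nonneg h0, mul_comm s l]

theorem abs_mul_softDelta_le (l s : ℝ) :
    |s * softDelta l s| ≤ (1 + (l * s) ^ 2)⁻¹ := by
  have h := abs_lt_sqrt_one_add_sq (l * s)
  have h0 : (0 : ℝ) < √(1 + (l * s) ^ 2) := (abs_nonneg _).trans_lt h
  have hp : (0 : ℝ) < 1 + (l * s) ^ 2 := by positivity
  rw [abs_mul_softDelta, inv_eq_one_div, div_le_div_iff₀ (by positivity) hp]
  nlinarith [mul_pos hp h0]

theorem abs_mul_softDelta_le_one (l s : ℝ) : |s * softDelta l s| ≤ 1 :=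
  (abs_mul_softDelta_le l s).trans (inv_le_one_of_one_le₀ (by nlinarith [sq_nonneg (l * s)]))

/-- Although `softDelta l` concentrates at the origin, the factor `s` makes it vanish in the limit:
this removes the terms in which the derivatives of `f` and `g` are left over. -/
theorem tendsto_mul_softDelta (s : ℝ) :
    Tendsto (fun n : ℕ => s * softDelta (n + 1) s) atTop (𝓝 0) := by
  rcases eq_or_ne s 0 with rfl | hs
  · simp
  refine squeeze_zero_norm (fun n => abs_mul_softDelta_le _ s) ?_
  refine tendsto_inv_atTop_zero.comp (tendsto_atTop_add_const_left _ _ ?_)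
  have h1 : Tendsto (fun n : ℕ => ((n : ℝ) + 1) * |s|) atTop atTop :=
    (tendsto_natCast_atTop_atTop.atTop_add tendsto_const_nhds).atTop_mul_const (abs_pos.2 hs)
  refine ((tendsto_pow_atTop two_ne_zero).comp h1).congr fun n => ?_
  simp [mul_pow]

theorem abs_softPos_sub_le {l : ℝ} (hl : 0 < l) (s : ℝ) :
    |softPos l s - max s 0| ≤ l⁻¹ := by
  have h := abs_lt_sqrt_one_add_sq (l * s)
  have h2 : √(1 + (l * s) ^ 2) ≤ 1 + |l * s| := by
    rw [Real.sqrt_le_left (by positivity)]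
    nlinarith [abs_nonneg (l * s), sq_abs (l * s)]
  have e : softPos l s - max s 0 = (√(1 + (l * s) ^ 2) - 1 - |l * s|) / (2 * l) := by
    rw [softPos, abs_mul, abs_of_pos hl, max_def]
    split_ifs with h
    · rw [abs_of_nonpos h]; field_simp; ring
    · rw [abs_of_pos (not_le.1 h)]; field_simp; ring
  rw [e, abs_div, abs_of_pos (by positivity : (0 : ℝ) < 2 * l), div_le_iff₀ (by positivity)]
  have : l⁻¹ * (2 * l) = 2 := by field_simp
  rw [this, abs_le]
  constructor <;> linarith

theorem tendsto_softPos (s : ℝ) :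
    Tendsto (fun n : ℕ => softPos (n + 1) s) atTop (𝓝 (max s 0)) := by
  rw [tendsto_iff_norm_sub_tendsto_zero]
  refine squeeze_zero (fun _ => norm_nonneg _) (fun n => abs_softPos_sub_le (by positivity) s) ?_
  exact tendsto_inv_atTop_zero.comp (tendsto_natCast_atTop_atTop.atTop_add tendsto_const_nhds)

theorem abs_softPos_le {l : ℝ} (hl : 0 < l) (s : ℝ) : |softPos l s| ≤ |s| := by
  have := convex_univ.norm_image_sub_le_of_norm_hasDerivWithin_le (f := softPos l)
    (f' := softStep l) (C := 1) (fun r _ => (hasDerivAt_softPos hl r).hasDerivWithinAt)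
    (fun r _ => abs_softStep_le l r) (mem_univ 0) (mem_univ s)
  simpa [softPos_zero] using this

/-- The functions `s * softStep l s` and `softPos l s` differ by at most `1 / l`. -/
theorem tendsto_mul_softStep (s : ℝ) :
    Tendsto (fun n : ℕ => s * softStep (n + 1) s) atTop (𝓝 (max s 0)) := by
  have key : ∀ n : ℕ, |s * softStep (n + 1) s - softPos (n + 1) s| ≤ ((n : ℝ) + 1)⁻¹ := by
    intro n
    have hl : (0 : ℝ) < (n : ℝ) + 1 := by positivity
    set l : ℝ := (n : ℝ) + 1
    have hp : (1 : ℝ) ≤ √(1 + (l * s) ^ 2) := by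
      rw [Real.one_le_sqrt]; nlinarith [sq_nonneg (l * s)]
    have h0 : (0 : ℝ) < √(1 + (l * s) ^ 2) := by linarith
    have hs : √(1 + (l * s) ^ 2) ^ 2 = 1 + (l * s) ^ 2 := Real.sq_sqrt (by positivity)
    have e : s * softStep l s - softPos l s = (1 - (√(1 + (l * s) ^ 2))⁻¹) / (2 * l) := by
      rw [softStep, softPos]
      set q := √(1 + (l * s) ^ 2)
      field_simp
      linear_combination (-1) * hs
    have h1 : (√(1 + (l * s) ^ 2))⁻¹ ≤ 1 := inv_le_one_of_one_le₀ hp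
    have h2 : 0 < (√(1 + (l * s) ^ 2))⁻¹ := inv_pos.2 h0
    rw [e, abs_of_nonneg (div_nonneg (by linarith) (by linarith)), div_le_iff₀ (by positivity)]
    have : l⁻¹ * (2 * l) = 2 := by field_simp
    linarith
  have h1 : Tendsto (fun n : ℕ => s * softStep (n + 1) s - softPos (n + 1) s) atTop (𝓝 0) :=
    squeeze_zero_norm key
      (tendsto_inv_atTop_zero.comp (tendsto_natCast_atTop_atTop.atTop_add tendsto_const_nhds))
  have := h1.add (tendsto_softPos s)
  simpa using this

/-- The `i`-th momentum coordinate. -/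
def momCoord (i : Fin d) (y : SpaceTime d) : ℝ := y.2.2 i

theorem isSmooth_momCoord (i : Fin d) : IsSmooth (momCoord i) :=
  isSmooth_comp_snd_snd (χ := fun p : Mom d => p i) (by fun_prop)

theorem hasDerivAlong_momCoord_dirX (i : Fin d) :
    HasDerivAlong (line (dirX i)) (momCoord i) (fun _ => 0) := by
  intro y
  have : (fun s : ℝ => momCoord i (y + line (dirX i) s)) = fun _ => momCoord i y := by
    ext s; simp [momCoord, line_apply, proj_apply, dirX]
  rw [this]
  exact hasDerivAt_const _ _

theorem hasDerivAlong_momCoord_dirP (i : Fin d) :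
    HasDerivAlong (line (dirP i)) (momCoord i) (fun _ => 1) := by
  intro y
  have : (fun s : ℝ => momCoord i (y + line (dirP i) s)) = fun s => momCoord i y + s := by
    ext s; simp [momCoord, line_apply, proj_apply, dirP]
  rw [this]
  exact (hasDerivAt_id _).const_add _

theorem dirD_momCoord_mul_dirX {φ : SpaceTime d → ℝ} (h : IsTestFunction φ) (i : Fin d) :
    dirD (dirX i) (fun y => momCoord i y * φ y) = fun y => momCoord i y * dirD (dirX i) φ y := by
  have h1 := (hasDerivAlong_momCoord_dirX i).mul (h.hasDerivAlong (dirX i))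
  rw [((h.mul_left (isSmooth_momCoord i)).hasDerivAlong (dirX i)).unique h1]
  ext y; ring

theorem dirD_momCoord_mul_dirP {φ : SpaceTime d → ℝ} (h : IsTestFunction φ) (i : Fin d) :
    dirD (dirP i) (fun y => momCoord i y * φ y)
      = fun y => φ y + momCoord i y * dirD (dirP i) φ y := by
  have h1 := (hasDerivAlong_momCoord_dirP i).mul (h.hasDerivAlong (dirP i))
  rw [((h.mul_left (isSmooth_momCoord i)).hasDerivAlong (dirP i)).unique h1]
  ext y; ring

theorem tsupport_momCoord_mul_subset (i : Fin d) (φ : SpaceTime d → ℝ) :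
    tsupport (fun y => momCoord i y * φ y) ⊆ tsupport φ :=
  tsupport_mul_subset_right

theorem integrable_mul_test {X q : SpaceTime d → ℝ} (hX : Integrable X) (hq : IsTestFunction q) :
    Integrable (fun y => X y * q y) := by
  obtain ⟨C, hC⟩ := hq.2.exists_bound_of_continuous hq.continuous
  exact hX.mul_bdd hq.continuous.aestronglyMeasurable (Eventually.of_forall hC)

/-- Two functions `f`, `g` on space-time with weak first derivatives `Fx, Fp, Gx, Gp` on the open
set `Ω`, bounded in momentum, on which the difference of the equations for `f` and `g` holds. -/
structure IsSolutionPair (Ω : Set (SpaceTime d)) (κ : ℝ) (f g : SpaceTime d → ℝ)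
    (Fx Fp Gx Gp : Fin d → SpaceTime d → ℝ) : Prop where
  isOpen : IsOpen Ω
  bounded : ∃ R, ∀ y ∈ Ω, ∀ i, |momCoord i y| ≤ R
  memf : MemL1L2 f
  memg : MemL1L2 g
  memFx : ∀ i, MemL1L2 (Fx i)
  memFp : ∀ i, MemL1L2 (Fp i)
  memGx : ∀ i, MemL1L2 (Gx i)
  memGp : ∀ i, MemL1L2 (Gp i)
  weakFx : ∀ i, HasWeakDeriv Ω (dirX i) f (Fx i)
  weakFp : ∀ i, HasWeakDeriv Ω (dirP i) f (Fp i)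
  weakGx : ∀ i, HasWeakDeriv Ω (dirX i) g (Gx i)
  weakGp : ∀ i, HasWeakDeriv Ω (dirP i) g (Gp i)
  equation : ∀ φ : SpaceTime d → ℝ, IsTestFunction φ → tsupport φ ⊆ Ω →
    (∫ y, (f y - g y) * (dirD dirT φ y + ∑ i, dirD (dirP i) (dirD (dirP i) φ) y))
      + ∑ i, ∫ y, ((f y - g y) + κ * (f y * f y - g y * g y))
          * (momCoord i y * (dirD (dirX i) φ y - dirD (dirP i) φ y)) = 0

theorem integrable_flux {κ : ℝ} {f g : SpaceTime d → ℝ} (hf : MemL1L2 f) (hg : MemL1L2 g) :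
    Integrable (fun y => (f y - g y) + κ * (f y * f y - g y * g y)) := by
  refine (memLp_one_iff_integrable.1 (hf.1.sub hg.1)).add (Integrable.const_mul ?_ κ)
  exact (memLp_one_iff_integrable.1 (hf.2.mul' hf.2)).sub
    (memLp_one_iff_integrable.1 (hg.2.mul' hg.2))

theorem integrable_flux_deriv {κ : ℝ} {f g F G : SpaceTime d → ℝ} (hf : MemL1L2 f)
    (hg : MemL1L2 g) (hF : MemL1L2 F) (hG : MemL1L2 G) :
    Integrable (fun y => (F y - G y) + 2 * κ * (f y * F y - g y * G y)) := by
  refine (memLp_one_iff_integrable.1 (hF.1.sub hG.1)).add (Integrable.const_mul ?_ (2 * κ))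
  exact (memLp_one_iff_integrable.1 (hF.2.mul' hf.2)).sub
    (memLp_one_iff_integrable.1 (hG.2.mul' hg.2))

theorem integrable_flux_delta {κ : ℝ} {f g F G : SpaceTime d → ℝ} (hf : MemL1L2 f)
    (hg : MemL1L2 g) (hF : MemL1L2 F) (hG : MemL1L2 G) :
    Integrable (fun y => (F y - G y) + κ * ((f y + g y) * (F y - G y))) := by
  refine (memLp_one_iff_integrable.1 (hF.1.sub hG.1)).add (Integrable.const_mul ?_ κ)
  exact memLp_one_iff_integrable.1 ((hF.2.sub hG.2).mul' (hf.2.add hg.2))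

/-- The inequality satisfied by `softPos l (f - g)`: renormalization, followed by the chain rule
which moves the derivatives of the flux back to the test function. -/
theorem IsSolutionPair.softPos_le {Ω : Set (SpaceTime d)} {κ : ℝ} {f g : SpaceTime d → ℝ}
    {Fx Fp Gx Gp : Fin d → SpaceTime d → ℝ} (h : IsSolutionPair Ω κ f g Fx Fp Gx Gp)
    {l : ℝ} (hl : 0 < l) {ψ : SpaceTime d → ℝ} (hψ : IsTestFunction ψ) (hψΩ : tsupport ψ ⊆ Ω)
    (hψ0 : ∀ y, 0 ≤ ψ y) :
    -∫ y, dirD dirT ψ y * softPos l (f y - g y)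
      ≤ ∑ i, ((∫ y, (momCoord i y * (dirD (dirX i) ψ y - dirD (dirP i) ψ y)
              * softStep l (f y - g y)) * ((f y - g y) + κ * (f y * f y - g y * g y)))
          + (∫ y, ((momCoord i y * ψ y) * ((f y - g y) * softDelta l (f y - g y)))
              * ((Fx i y - Gx i y) + κ * ((f y + g y) * (Fx i y - Gx i y))))
          - (∫ y, ((momCoord i y * ψ y) * ((f y - g y) * softDelta l (f y - g y)))
              * ((Fp i y - Gp i y) + κ * ((f y + g y) * (Fp i y - Gp i y)))))
        + ∑ i, ∫ y, dirD (dirP i) (dirD (dirP i) ψ) y * softPos l (f y - g y) := by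
  obtain ⟨R, hR⟩ := h.bounded
  set w : SpaceTime d → ℝ := fun y => (f y - g y) + κ * (f y * f y - g y * g y) with hw
  set Wx : Fin d → SpaceTime d → ℝ :=
    fun i y => (Fx i y - Gx i y) + 2 * κ * (f y * Fx i y - g y * Gx i y) with hWx
  set Wp : Fin d → SpaceTime d → ℝ :=
    fun i y => (Fp i y - Gp i y) + 2 * κ * (f y * Fp i y - g y * Gp i y) with hWp
  have iw : Integrable w := integrable_flux h.memf h.memg
  have iWx : ∀ i, Integrable (Wx i) := fun i =>
    integrable_flux_deriv h.memf h.memg (h.memFx i) (h.memGx i)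
  have iWp : ∀ i, Integrable (Wp i) := fun i =>
    integrable_flux_deriv h.memf h.memg (h.memFp i) (h.memGp i)
  have dWx : ∀ i, HasWeakDeriv Ω (dirX i) w (Wx i) := fun i =>
    hasWeakDeriv_flux h.isOpen h.memf h.memg (h.memFx i) (h.memGx i) (h.weakFx i) (h.weakGx i)
  have dWp : ∀ i, HasWeakDeriv Ω (dirP i) w (Wp i) := fun i =>
    hasWeakDeriv_flux h.isOpen h.memf h.memg (h.memFp i) (h.memGp i) (h.weakFp i) (h.weakGp i)
  -- The momentum coordinates are cut off outside `Ω`, which makes the source term integrable.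
  set c : Fin d → SpaceTime d → ℝ := fun i => Ω.indicator (momCoord i) with hc
  have cm : ∀ i, AEStronglyMeasurable (c i) volume := fun i =>
    ((isSmooth_momCoord i).continuous.measurable.indicator
      h.isOpen.measurableSet).aestronglyMeasurable
  have cb : ∀ i y, ‖c i y‖ ≤ max R 0 := fun i y => by
    by_cases hy : y ∈ Ω
    · simp only [hc, indicator_of_mem hy]
      exact (hR y hy i).trans (le_max_left _ _)
    · simp [hc, indicator_of_notMem hy]
  have icx : ∀ i, Integrable fun y => c i y * Wx i y := fun i =>
    (iWx i).bdd_mul (cm i) (Eventually.of_forall (cb i))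
  have icp : ∀ i, Integrable fun y => c i y * Wp i y := fun i =>
    (iWp i).bdd_mul (cm i) (Eventually.of_forall (cb i))
  set A : SpaceTime d → ℝ := fun y => ∑ i, (c i y * Wp i y - c i y * Wx i y + w y) with hA
  have iAi : ∀ i, Integrable fun y => c i y * Wp i y - c i y * Wx i y + w y := fun i =>
    ((icp i).sub (icx i)).add iw
  have iA : Integrable A := integrable_finsetSum _ fun i _ => iAi i
  have cq : ∀ {q : SpaceTime d → ℝ}, tsupport q ⊆ Ω → ∀ i y,
      c i y * q y = momCoord i y * q y := by
    intro q hq i y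
    by_cases hy : y ∈ Ω
    · simp only [hc, indicator_of_mem hy]
    · simp [image_eq_zero_of_notMem_tsupport fun h' => hy (hq h')]
  have heq : ∀ φ : SpaceTime d → ℝ, IsTestFunction φ → tsupport φ ⊆ Ω →
      ∫ y, (f y - g y) * (dirD dirT φ y + ∑ i, dirD (dirP i) (dirD (dirP i) φ) y)
        = -∫ y, A y * φ y := by
    intro φ hφ hφΩ
    have h1 := h.equation φ hφ hφΩ
    have h2 : ∀ i, ∫ y, w y * (momCoord i y * (dirD (dirX i) φ y - dirD (dirP i) φ y))
        = ∫ y, (c i y * Wp i y - c i y * Wx i y + w y) * φ y := by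
      intro i
      have hm := hφ.mul_left (isSmooth_momCoord i)
      have hmΩ := (tsupport_momCoord_mul_subset i φ).trans hφΩ
      have a1 := dWx i _ hm hmΩ
      have a2 := dWp i _ hm hmΩ
      rw [dirD_momCoord_mul_dirX hφ] at a1
      rw [dirD_momCoord_mul_dirP hφ] at a2
      have j1 : Integrable fun y => w y * (momCoord i y * dirD (dirX i) φ y) :=
        integrable_mul_test iw ((hφ.dirD _).mul_left (isSmooth_momCoord i))
      have j2 : Integrable fun y => w y * (momCoord i y * dirD (dirP i) φ y) :=
        integrable_mul_test iw ((hφ.dirD _).mul_left (isSmooth_momCoord i))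
      have j3 : Integrable fun y => w y * φ y := integrable_mul_test iw hφ
      have j4 := integrable_mul_test (iWx i) hm
      have j5 := integrable_mul_test (iWp i) hm
      simp only [mul_add] at a2
      rw [integral_add j3 j2] at a2
      have e1 : ∀ y, w y * (momCoord i y * (dirD (dirX i) φ y - dirD (dirP i) φ y))
          = w y * (momCoord i y * dirD (dirX i) φ y)
            - w y * (momCoord i y * dirD (dirP i) φ y) := fun y => by ring
      have e2 : ∀ y, (c i y * Wp i y - c i y * Wx i y + w y) * φ y
          = Wp i y * (momCoord i y * φ y) - Wx i y * (momCoord i y * φ y) + w y * φ y :=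
        fun y => by rw [← cq hφΩ i y]; ring
      simp only [e1, e2]
      have j6 : Integrable fun y =>
          Wp i y * (momCoord i y * φ y) - Wx i y * (momCoord i y * φ y) := j5.sub j4
      rw [integral_sub j1 j2, integral_add j6 j3, integral_sub j5 j4]
      simp only at a1
      linarith
    rw [Finset.sum_congr rfl fun i _ => h2 i] at h1
    simp only [hA, Finset.sum_mul]
    rw [integral_finsetSum _ fun i _ => integrable_mul_test (iAi i) hφ]
    linarith
  have main := renormalization_le h.isOpen (h.memf.1.sub h.memg.1)
    (memLp_one_iff_integrable.2 iA) heq (hasDerivAt_softPos hl) (hasDerivAt_softStep l)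
    (continuous_softDelta l) (abs_softStep_le l) (softDelta_nonneg hl) (softPos_zero l)
    hψ hψΩ hψ0
  refine main.trans (add_le_add (le_of_eq ?_) le_rfl)
  have cH : Continuous (softStep l) :=
    continuous_iff_continuousAt.2 fun r => (hasDerivAt_softStep l r).continuousAt
  have mH : AEStronglyMeasurable (fun y => softStep l (f y - g y)) volume :=
    cH.comp_aestronglyMeasurable (h.memf.1.1.sub h.memg.1.1)
  have iH : ∀ {X : SpaceTime d → ℝ}, Integrable X →
      Integrable fun y => softStep l (f y - g y) * X y := fun hX =>
    hX.bdd_mul mH (Eventually.of_forall fun y => abs_softStep_le l _)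
  have e0 : ∀ y, ψ y * softStep l ((f - g) y) * A y
      = ∑ i, (softStep l (f y - g y) * (c i y * Wp i y - c i y * Wx i y + w y)) * ψ y :=
    fun y => by
      simp only [hA, Pi.sub_apply, Finset.mul_sum]
      exact Finset.sum_congr rfl fun i _ => by ring
  simp only [e0]
  rw [integral_finsetSum _ fun i _ => integrable_mul_test (iH (iAi i)) hψ]
  refine Finset.sum_congr rfl fun i _ => ?_
  have hm := hψ.mul_left (isSmooth_momCoord i)
  have hmΩ := (tsupport_momCoord_mul_subset i ψ).trans hψΩ
  have b1 := weak_chain_rule (κ := κ) h.isOpen h.memf h.memg (h.memFx i) (h.memGx i) (h.weakFx i)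
    (h.weakGx i) (hasDerivAt_softStep l) (continuous_softDelta l) (abs_softStep_le l)
    (abs_mul_softDelta_le_one l) hm hmΩ
  have b2 := weak_chain_rule (κ := κ) h.isOpen h.memf h.memg (h.memFp i) (h.memGp i) (h.weakFp i)
    (h.weakGp i) (hasDerivAt_softStep l) (continuous_softDelta l) (abs_softStep_le l)
    (abs_mul_softDelta_le_one l) hm hmΩ
  rw [dirD_momCoord_mul_dirX hψ] at b1
  rw [dirD_momCoord_mul_dirP hψ] at b2
  have k1 : Integrable fun y => (softStep l (f y - g y) * w y) * (momCoord i y * dirD (dirX i) ψ y) :=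
    integrable_mul_test (iH iw) ((hψ.dirD _).mul_left (isSmooth_momCoord i))
  have k2 : Integrable fun y => (softStep l (f y - g y) * w y) * (momCoord i y * dirD (dirP i) ψ y) :=
    integrable_mul_test (iH iw) ((hψ.dirD _).mul_left (isSmooth_momCoord i))
  have k3 : Integrable fun y => (softStep l (f y - g y) * w y) * ψ y :=
    integrable_mul_test (iH iw) hψ
  have k4 : Integrable fun y => (softStep l (f y - g y) * Wx i y) * (momCoord i y * ψ y) :=
    integrable_mul_test (iH (iWx i)) hm
  have k5 : Integrable fun y => (softStep l (f y - g y) * Wp i y) * (momCoord i y * ψ y) :=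
    integrable_mul_test (iH (iWp i)) hm
  have r1 : ∫ y, (momCoord i y * dirD (dirX i) ψ y * softStep l (f y - g y)) * w y
      = ∫ y, (softStep l (f y - g y) * w y) * (momCoord i y * dirD (dirX i) ψ y) :=
    integral_congr_ae (Eventually.of_forall fun y => by ring)
  have r2 : ∫ y, ((ψ y + momCoord i y * dirD (dirP i) ψ y) * softStep l (f y - g y)) * w y
      = (∫ y, (softStep l (f y - g y) * w y) * ψ y)
        + ∫ y, (softStep l (f y - g y) * w y) * (momCoord i y * dirD (dirP i) ψ y) := by
    rw [← integral_add k3 k2]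
    exact integral_congr_ae (Eventually.of_forall fun y => by ring)
  have r3 : ∀ W : SpaceTime d → ℝ, ∫ y, (momCoord i y * ψ y * softStep l (f y - g y)) * W y
      = ∫ y, (softStep l (f y - g y) * W y) * (momCoord i y * ψ y) := fun W =>
    integral_congr_ae (Eventually.of_forall fun y => by ring)
  have r4 : ∫ y, (momCoord i y * (dirD (dirX i) ψ y - dirD (dirP i) ψ y)
        * softStep l (f y - g y)) * w y
      = (∫ y, (softStep l (f y - g y) * w y) * (momCoord i y * dirD (dirX i) ψ y))
        - ∫ y, (softStep l (f y - g y) * w y) * (momCoord i y * dirD (dirP i) ψ y) := by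
    rw [← integral_sub k1 k2]
    exact integral_congr_ae (Eventually.of_forall fun y => by ring)
  have r5 : ∫ y, (softStep l (f y - g y) * (c i y * Wp i y - c i y * Wx i y + w y)) * ψ y
      = (∫ y, (softStep l (f y - g y) * Wp i y) * (momCoord i y * ψ y))
        - (∫ y, (softStep l (f y - g y) * Wx i y) * (momCoord i y * ψ y))
        + ∫ y, (softStep l (f y - g y) * w y) * ψ y := by
    have k6 : Integrable fun y => (softStep l (f y - g y) * Wp i y) * (momCoord i y * ψ y)
        - (softStep l (f y - g y) * Wx i y) * (momCoord i y * ψ y) := k5.sub k4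
    rw [← integral_sub k5 k4, ← integral_add k6 k3]
    refine integral_congr_ae (Eventually.of_forall fun y => ?_)
    simp only [← cq hψΩ i y]
    ring
  rw [r1, r3 (Wx i)] at b1
  rw [r2, r3 (Wp i)] at b2
  rw [r5, r4]
  linarith

/-- Kato's inequality: the positive part of the difference of two solutions is a subsolution of
the difference of the equations. -/
theorem IsSolutionPair.kato {Ω : Set (SpaceTime d)} {κ : ℝ} {f g : SpaceTime d → ℝ}
    {Fx Fp Gx Gp : Fin d → SpaceTime d → ℝ} (h : IsSolutionPair Ω κ f g Fx Fp Gx Gp)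
    {ψ : SpaceTime d → ℝ} (hψ : IsTestFunction ψ) (hψΩ : tsupport ψ ⊆ Ω) (hψ0 : ∀ y, 0 ≤ ψ y) :
    -∫ y, dirD dirT ψ y * max (f y - g y) 0
      ≤ ∑ i, (∫ y, (momCoord i y * (dirD (dirX i) ψ y - dirD (dirP i) ψ y))
              * ((1 + κ * (f y + g y)) * max (f y - g y) 0))
        + ∑ i, ∫ y, dirD (dirP i) (dirD (dirP i) ψ) y * max (f y - g y) 0 := by
  have mu : AEStronglyMeasurable (fun y => f y - g y) volume := h.memf.1.1.sub h.memg.1.1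
  have iu : Integrable (fun y => f y - g y) := memLp_one_iff_integrable.1 (h.memf.1.sub h.memg.1)
  have lpos : ∀ n : ℕ, (0 : ℝ) < (n : ℝ) + 1 := fun n => by positivity
  have cΦ : ∀ n : ℕ, Continuous (softPos ((n : ℝ) + 1)) := fun n =>
    continuous_iff_continuousAt.2 fun r => (hasDerivAt_softPos (lpos n) r).continuousAt
  have cH : ∀ n : ℕ, Continuous (softStep ((n : ℝ) + 1)) := fun n =>
    continuous_iff_continuousAt.2 fun r => (hasDerivAt_softStep _ r).continuousAt
  have limΦ : ∀ q : SpaceTime d → ℝ, IsTestFunction q →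
      Tendsto (fun n : ℕ => ∫ y, q y * softPos (n + 1) (f y - g y)) atTop
        (𝓝 (∫ y, q y * max (f y - g y) 0)) := by
    intro q hq
    refine tendsto_integral_of_dominated_convergence (fun y => ‖q y * (f y - g y)‖)
      (fun n => hq.continuous.aestronglyMeasurable.mul ((cΦ n).comp_aestronglyMeasurable mu)) ?_
      (fun n => Eventually.of_forall fun y => ?_)
      (Eventually.of_forall fun y => (tendsto_softPos _).const_mul _)
    · simpa only [mul_comm] using (integrable_mul_test iu hq).norm
    · rw [norm_mul, norm_mul]
      exact mul_le_mul_of_nonneg_left (abs_softPos_le (lpos n) _) (norm_nonneg _)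
  have limH : ∀ q : SpaceTime d → ℝ, IsTestFunction q →
      Tendsto (fun n : ℕ => ∫ y, (q y * softStep (n + 1) (f y - g y))
          * ((f y - g y) + κ * (f y * f y - g y * g y))) atTop
        (𝓝 (∫ y, q y * ((1 + κ * (f y + g y)) * max (f y - g y) 0))) := by
    intro q hq
    have iw := integrable_flux (κ := κ) h.memf h.memg
    refine tendsto_integral_of_dominated_convergence
      (fun y => ‖q y * ((f y - g y) + κ * (f y * f y - g y * g y))‖)
      (fun n => (hq.continuous.aestronglyMeasurable.mul
        ((cH n).comp_aestronglyMeasurable mu)).mul iw.1) ?_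
      (fun n => Eventually.of_forall fun y => ?_) (Eventually.of_forall fun y => ?_)
    · simpa only [mul_comm] using (integrable_mul_test iw hq).norm
    · rw [norm_mul, norm_mul, norm_mul]
      refine mul_le_mul_of_nonneg_right ?_ (norm_nonneg _)
      exact mul_le_of_le_one_right (norm_nonneg _) (abs_softStep_le _ _)
    · have := (tendsto_mul_softStep (f y - g y)).const_mul (q y * (1 + κ * (f y + g y)))
      rw [mul_assoc] at this
      refine this.congr fun n => ?_
      ring
  have lim0 : ∀ q Z : SpaceTime d → ℝ, IsTestFunction q → Integrable Z →
      Tendsto (fun n : ℕ => ∫ y, (q y * ((f y - g y) * softDelta (n + 1) (f y - g y))) * Z y)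
        atTop (𝓝 0) := by
    intro q Z hq hZ
    rw [← integral_zero (SpaceTime d) ℝ]
    refine tendsto_integral_of_dominated_convergence (fun y => ‖q y * Z y‖)
      (fun n => (hq.continuous.aestronglyMeasurable.mul
        (mu.mul ((continuous_softDelta _).comp_aestronglyMeasurable mu))).mul hZ.1) ?_
      (fun n => Eventually.of_forall fun y => ?_) (Eventually.of_forall fun y => ?_)
    · simpa only [mul_comm] using (integrable_mul_test hZ hq).norm
    · rw [norm_mul, norm_mul (q y), norm_mul (q y) (Z y)]
      refine mul_le_mul_of_nonneg_right ?_ (norm_nonneg _)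
      exact mul_le_of_le_one_right (norm_nonneg _) (abs_mul_softDelta_le_one _ _)
    · have := ((tendsto_mul_softDelta (f y - g y)).const_mul (q y)).mul_const (Z y)
      simpa using this
  have hX : ∀ i, IsTestFunction fun y =>
      momCoord i y * (dirD (dirX i) ψ y - dirD (dirP i) ψ y) := fun i =>
    IsTestFunction.mul_left (φ := fun y => dirD (dirX i) ψ y - dirD (dirP i) ψ y)
      ⟨ContDiff.sub (hψ.dirD (dirX i)).1 (hψ.dirD (dirP i)).1,
        (hψ.dirD (dirX i)).2.sub (hψ.dirD (dirP i)).2⟩ (isSmooth_momCoord i)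
  have lim := (tendsto_finsetSum Finset.univ fun i _ =>
      ((limH _ (hX i)).add (lim0 _ _ (hψ.mul_left (isSmooth_momCoord i))
        (integrable_flux_delta (κ := κ) h.memf h.memg (h.memFx i) (h.memGx i)))).sub
        (lim0 _ _ (hψ.mul_left (isSmooth_momCoord i))
        (integrable_flux_delta (κ := κ) h.memf h.memg (h.memFp i) (h.memGp i)))).add
    (tendsto_finsetSum Finset.univ fun i _ => limΦ _ ((hψ.dirD (dirP i)).dirD (dirP i)))
  simp only [add_zero, sub_zero] at lim
  exact le_of_tendsto_of_tendsto' (limΦ _ (hψ.dirD dirT)).neg lim fun n =>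
    h.softPos_le (lpos n) hψ hψΩ hψ0

end Kato

/-! ### From the weak formulation to space-time integrals -/

section Restriction

variable {d : ℕ}

/-- The function `u(t, z)` restricted to `0 < t < T` and extended by zero, as a function on
space-time. -/
noncomputable def cut (T : ℝ) (u : ℝ → Phase d → ℝ) : SpaceTime d → ℝ :=
  (Ioo 0 T ×ˢ univ).indicator fun y => u y.1 y.2

theorem cut_of_mem {T : ℝ} {u : ℝ → Phase d → ℝ} {y : SpaceTime d} (hy : y.1 ∈ Ioo 0 T) :
    cut T u y = u y.1 y.2 :=
  indicator_of_mem (show y ∈ Ioo 0 T ×ˢ univ from ⟨hy, mem_univ _⟩) _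

theorem cut_of_notMem {T : ℝ} {u : ℝ → Phase d → ℝ} {y : SpaceTime d} (hy : y.1 ∉ Ioo 0 T) :
    cut T u y = 0 := indicator_of_notMem (fun h => hy h.1) _

theorem measurableSet_slab (T : ℝ) : MeasurableSet (Ioo 0 T ×ˢ (univ : Set (Phase d))) :=
  measurableSet_Ioo.prod MeasurableSet.univ

theorem JointlyMeasurable.cut {u : ℝ → Phase d → ℝ} (hu : JointlyMeasurable u) (T : ℝ) :
    AEStronglyMeasurable (QFP.cut T u) volume := by
  refine (aestronglyMeasurable_indicator_iff (measurableSet_slab T)).2 ?_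
  have e : (volume : Measure (SpaceTime d)) = (volume : Measure ℝ).prod volume := rfl
  have hu' : AEStronglyMeasurable (fun y : SpaceTime d => u y.1 y.2)
      (volume.restrict (Ioi (0 : ℝ) ×ˢ univ)) := by
    rw [e, ← Measure.prod_restrict, Measure.restrict_univ]
    exact hu
  exact hu'.mono_set (prod_mono Ioo_subset_Ioi_self le_rfl)

theorem memLp_cut {u : ℝ → Phase d → ℝ} (hu : JointlyMeasurable u) {T : ℝ} {p : ENNReal}
    (hp0 : p ≠ 0) (hp : p ≠ ⊤)
    (h : ∫⁻ t in Ioo 0 T, eLpNorm (u t) p volume ^ p.toReal < ⊤) : MemLp (cut T u) p volume := by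
  have hm := hu.cut T
  have hq : 0 < p.toReal := ENNReal.toReal_pos hp0 hp
  refine ⟨hm, (eLpNorm_lt_top_iff_lintegral_rpow_enorm_lt_top hp0 hp).2 ?_⟩
  refine lt_of_le_of_lt (le_of_eq ?_) h
  have e : (volume : Measure (SpaceTime d)) = (volume : Measure ℝ).prod volume := rfl
  rw [e] at hm ⊢
  rw [lintegral_prod _ (hm.enorm.pow_const _), ← lintegral_indicator measurableSet_Ioo]
  refine lintegral_congr fun t => ?_
  by_cases ht : t ∈ Ioo 0 T
  · rw [indicator_of_mem ht, eLpNorm_eq_lintegral_rpow_enorm_toReal hp0 hp, ← ENNReal.rpow_mul,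
      one_div, inv_mul_cancel₀ hq.ne', ENNReal.rpow_one]
    exact lintegral_congr fun z => by rw [cut_of_mem (y := (t, z)) ht]
  · rw [indicator_of_notMem ht]
    simp [cut_of_notMem (u := u) (y := (t, _)) ht, hq]

/-- A function continuous in time with values in `L^p` is bounded on compact time intervals. -/
theorem exists_eLpNorm_le_of_tendsto {u : ℝ → Phase d → ℝ} {p : ENNReal} (hp : 1 ≤ p)
    (hmem : ∀ t, 0 ≤ t → MemLp (u t) p volume)
    (hcont : ∀ t, 0 ≤ t → Tendsto (fun s => eLpNorm (u s - u t) p volume) (𝓝[Ici 0] t) (𝓝 0))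
    (T : ℝ) : ∃ C : ENNReal, C < ⊤ ∧ ∀ t ∈ Icc 0 T, eLpNorm (u t) p volume ≤ C := by
  refine isCompact_Icc.induction_on
    (p := fun s => ∃ C : ENNReal, C < ⊤ ∧ ∀ t ∈ s ∩ Icc 0 T, eLpNorm (u t) p volume ≤ C)
    (s := Icc 0 T) ?_ ?_ ?_ ?_ |>.imp fun C hC => by simpa using hC
  · exact ⟨0, by simp, by simp⟩
  · rintro s t hst ⟨C, hC, h⟩
    exact ⟨C, hC, fun r hr => h r ⟨hst hr.1, hr.2⟩⟩
  · rintro s t ⟨C, hC, h⟩ ⟨C', hC', h'⟩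
    refine ⟨max C C', max_lt hC hC', fun r hr => ?_⟩
    rcases hr.1 with h1 | h1
    · exact (h r ⟨h1, hr.2⟩).trans (le_max_left _ _)
    · exact (h' r ⟨h1, hr.2⟩).trans (le_max_right _ _)
  · intro t ht
    have h1 : ∀ᶠ s in 𝓝[Icc 0 T] t, eLpNorm (u s - u t) p volume < 1 :=
      ((hcont t ht.1).eventually (Iio_mem_nhds zero_lt_one)).filter_mono
        (nhdsWithin_mono t Icc_subset_Ici_self)
    refine ⟨_, h1, 1 + eLpNorm (u t) p volume,
      ENNReal.add_lt_top.2 ⟨ENNReal.one_lt_top, (hmem t ht.1).2⟩, fun s hs => ?_⟩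
    have e : u s = (u s - u t) + u t := by simp
    rw [e]
    refine (eLpNorm_add_le ((hmem s hs.2.1).sub (hmem t ht.1)).1 (hmem t ht.1).1 hp).trans ?_
    exact add_le_add (le_of_lt hs.1) le_rfl

theorem IsContL1L2.memL1L2_cut {u : ℝ → Phase d → ℝ} (hu : IsContL1L2 u) (T : ℝ) :
    MemL1L2 (cut T u) := by
  have key : ∀ p : ENNReal, 1 ≤ p → p ≠ ⊤ → (∀ t, 0 ≤ t → MemLp (u t) p volume) →
      (∀ t, 0 ≤ t → Tendsto (fun s => eLpNorm (u s - u t) p volume) (𝓝[Ici 0] t) (𝓝 0)) →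
      MemLp (cut T u) p volume := by
    intro p hp1 hp hmem hcont
    obtain ⟨C, hC, h⟩ := exists_eLpNorm_le_of_tendsto hp1 hmem hcont T
    refine memLp_cut hu.measurable (zero_lt_one.trans_le hp1).ne' hp ?_
    calc ∫⁻ t in Ioo 0 T, eLpNorm (u t) p volume ^ p.toReal
        ≤ ∫⁻ _t in Ioo 0 T, C ^ p.toReal := by
          refine setLIntegral_mono' measurableSet_Ioo fun t ht => ?_
          exact ENNReal.rpow_le_rpow (h t ⟨ht.1.le, ht.2.le⟩) ENNReal.toReal_nonneg
      _ < ⊤ := by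
          rw [setLIntegral_const]
          exact ENNReal.mul_lt_top (ENNReal.rpow_lt_top_of_nonneg ENNReal.toReal_nonneg hC.ne)
            measure_Ioo_lt_top
  exact ⟨key 1 le_rfl (by simp) hu.memLp_one hu.cont_one,
    key 2 (by norm_num) (by simp) hu.memLp_two hu.cont_two⟩

theorem IsL2locL1L2.memL1L2_cut {G : ℝ → Phase d → Mom d} (hG : IsL2locL1L2 G) {T : ℝ}
    (hT : 0 < T) (i : Fin d) :
    MemL1L2 (cut T fun t z => ⟪G t z, EuclideanSpace.single i 1⟫) := by
  have hm : JointlyMeasurable fun t z => ⟪G t z, EuclideanSpace.single i (1 : ℝ)⟫ :=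
    hG.measurable.inner aestronglyMeasurable_const
  have hle : ∀ (p : ENNReal) t, eLpNorm (fun z => ⟪G t z, EuclideanSpace.single i (1 : ℝ)⟫) p volume
      ≤ eLpNorm (G t) p volume := fun p t => eLpNorm_mono fun z => by
    simpa using norm_inner_le_norm (𝕜 := ℝ) (G t z) (EuclideanSpace.single i (1 : ℝ))
  constructor
  · refine memLp_cut hm (by simp) (by simp) ?_
    calc ∫⁻ t in Ioo 0 T, _ ≤ ∫⁻ t in Ioo 0 T, (1 + eLpNorm (G t) 1 volume ^ 2) := by
          refine lintegral_mono fun t => ?_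
          simp only [ENNReal.toReal_one, ENNReal.rpow_one]
          refine (hle 1 t).trans ?_
          rcases le_total (eLpNorm (G t) 1 volume) 1 with h | h
          · exact h.trans le_self_add
          · exact (le_self_pow₀ h two_ne_zero).trans le_add_self
      _ < ⊤ := by
          rw [lintegral_add_left measurable_const, setLIntegral_const, one_mul]
          exact ENNReal.add_lt_top.2 ⟨measure_Ioo_lt_top, hG.sq_one T hT⟩
  · refine memLp_cut hm (by simp) (by simp) (lt_of_le_of_lt ?_ (hG.sq_two T hT))
    refine lintegral_mono fun t => ?_
    simp only [ENNReal.toReal_ofNat, ENNReal.rpow_ofNat]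
    gcongr
    exact hle 2 t

/-- Fubini's theorem for the iterated integrals of the weak formulation. -/
theorem integral_Ioi_eq_integral_cut {T : ℝ} {B : ℝ → Phase d → ℝ} (hB : Integrable (cut T B))
    (h0 : ∀ t z, T ≤ t → B t z = 0) :
    ∫ t in Ioi (0 : ℝ), ∫ z, B t z = ∫ y, cut T B y := by
  have e : (volume : Measure (SpaceTime d)) = (volume : Measure ℝ).prod volume := rfl
  rw [e] at hB ⊢
  rw [integral_prod _ hB, ← integral_indicator measurableSet_Ioi]
  refine integral_congr_ae (Eventually.of_forall fun t => ?_)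
  by_cases ht : t ∈ Ioi (0 : ℝ)
  · simp only [indicator_of_mem ht]
    refine integral_congr_ae (Eventually.of_forall fun z => ?_)
    by_cases hT : t < T
    · exact (cut_of_mem (y := (t, z)) ⟨ht, hT⟩).symm
    · simp only [h0 t z (not_lt.1 hT)]
      exact (cut_of_notMem (y := (t, z)) fun h => hT h.2).symm
  · simp only [indicator_of_notMem ht]
    rw [← integral_zero (Phase d) ℝ]
    refine integral_congr_ae (Eventually.of_forall fun z => ?_)
    exact (cut_of_notMem (y := (t, z)) fun h => ht h.1).symm

/-- The space-time region `0 < t < T`, `|p| < R`. -/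
def region (d : ℕ) (T R : ℝ) : Set (SpaceTime d) := {y | y.1 ∈ Ioo 0 T ∧ ‖y.2.2‖ < R}

theorem isOpen_region (T R : ℝ) : IsOpen (region d T R) :=
  (isOpen_Ioo.preimage continuous_fst).inter
    (isOpen_lt continuous_snd.snd.norm continuous_const)

theorem IsTestFunction.dirD_eq_zero {φ : SpaceTime d → ℝ} (hφ : IsTestFunction φ) (v : Cover d)
    {y : SpaceTime d} (hy : y ∉ tsupport φ) : QFP.dirD v φ y = 0 :=
  image_eq_zero_of_notMem_tsupport fun h => hy (hφ.tsupport_dirD v h)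

theorem hasWeakDeriv_cut {T R : ℝ} {u F : ℝ → Phase d → ℝ} (hu : MemL1L2 (cut T u))
    (hF : MemL1L2 (cut T F)) {v : Cover d}
    (h : ∀ φ : SpaceTime d → ℝ, IsTestFunction φ → tsupport φ ⊆ {y | 0 < y.1} →
      ∫ t in Ioi (0 : ℝ), ∫ z, u t z * dirD v φ (t, z)
        = -∫ t in Ioi (0 : ℝ), ∫ z, F t z * φ (t, z)) :
    HasWeakDeriv (region d T R) v (cut T u) (cut T F) := by
  intro φ hφ hφΩ
  have key : ∀ (w : ℝ → Phase d → ℝ) (q : SpaceTime d → ℝ), MemL1L2 (cut T w) →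
      IsTestFunction q → tsupport q ⊆ region d T R →
      ∫ t in Ioi (0 : ℝ), ∫ z, w t z * q (t, z) = ∫ y, cut T w y * q y := by
    intro w q hw hq hqΩ
    have e : cut T (fun t z => w t z * q (t, z)) = fun y => cut T w y * q y := by
      ext y
      by_cases hy : y.1 ∈ Ioo 0 T
      · rw [cut_of_mem hy, cut_of_mem hy]
      · rw [cut_of_notMem hy, cut_of_notMem hy, zero_mul]
    rw [integral_Ioi_eq_integral_cut (T := T), e]
    · rw [e]
      exact integrable_mul_test (memLp_one_iff_integrable.1 hw.1) hq
    · intro t z ht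
      rw [image_eq_zero_of_notMem_tsupport (f := q), mul_zero]
      exact fun h' => absurd (hqΩ h').1.2 (not_lt.2 ht)
  rw [← key u _ hu (hφ.dirD v) ((hφ.tsupport_dirD v).trans hφΩ), ← key F φ hF hφ hφΩ]
  exact h φ hφ (hφΩ.trans fun y hy => hy.1.1)

/-- The weak formulation as an identity between space-time integrals. -/
theorem IsWeakSolution.integral_cut {κ : ℝ} {f : ℝ → Phase d → ℝ} {f₀ : Phase d → ℝ}
    (hf : IsWeakSolution κ f f₀) {T : ℝ} {φ : SpaceTime d → ℝ} (hφ : IsTestFunction φ)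
    (hφT : tsupport φ ⊆ {y | y.1 < T}) :
    (∫ y, cut T f y * dirD dirT φ y)
      + (∑ i, ∫ y, cut T f y * dirD (dirP i) (dirD (dirP i) φ) y)
      + (∑ i, ∫ y, (cut T f y + κ * (cut T f y * cut T f y))
          * (momCoord i y * (dirD (dirX i) φ y - dirD (dirP i) φ y)))
      + ∫ z, φ (0, z) * f₀ z = 0 := by
  have hm := hf.cont.memL1L2_cut T
  have if1 : Integrable (cut T f) := memLp_one_iff_integrable.1 hm.1
  have iw : Integrable fun y => cut T f y + κ * (cut T f y * cut T f y) :=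
    if1.add (Integrable.const_mul (memLp_one_iff_integrable.1 (hm.2.mul' hm.2)) κ)
  have hX : ∀ i, IsTestFunction fun y =>
      momCoord i y * (dirD (dirX i) φ y - dirD (dirP i) φ y) := fun i =>
    IsTestFunction.mul_left (φ := fun y => dirD (dirX i) φ y - dirD (dirP i) φ y)
      ⟨ContDiff.sub (hφ.dirD (dirX i)).1 (hφ.dirD (dirP i)).1,
        (hφ.dirD (dirX i)).2.sub (hφ.dirD (dirP i)).2⟩ (isSmooth_momCoord i)
  have j1 : Integrable fun y => cut T f y * dirD dirT φ y := integrable_mul_test if1 (hφ.dirD _)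
  have j2 : ∀ i, Integrable fun y => cut T f y * dirD (dirP i) (dirD (dirP i) φ) y := fun i =>
    integrable_mul_test if1 ((hφ.dirD _).dirD _)
  have j3 : ∀ i, Integrable fun y => (cut T f y + κ * (cut T f y * cut T f y))
      * (momCoord i y * (dirD (dirX i) φ y - dirD (dirP i) φ y)) := fun i =>
    integrable_mul_test iw (hX i)
  have j2' := integrable_finsetSum Finset.univ fun i _ => j2 i
  have j3' := integrable_finsetSum Finset.univ fun i _ => j3 i
  have e : cut T (fun t z => f t z * (derivT φ t z + (1 + κ * f t z) * derivX φ z.2 t z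
        - (1 + κ * f t z) * derivP φ z.2 t z + laplaceP φ t z))
      = fun y => cut T f y * dirD dirT φ y
        + (∑ i, cut T f y * dirD (dirP i) (dirD (dirP i) φ) y)
        + ∑ i, (cut T f y + κ * (cut T f y * cut T f y))
          * (momCoord i y * (dirD (dirX i) φ y - dirD (dirP i) φ y)) := by
    ext y
    by_cases hy : y.1 ∈ Ioo 0 T
    · simp only [cut_of_mem hy]
      rw [derivT_eq, hφ.isSmooth.derivX_eq_sum, hφ.isSmooth.derivP_eq_sum,
        hφ.isSmooth.laplaceP_eq, ← Finset.mul_sum, ← Finset.mul_sum]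
      simp only [mul_sub, Finset.sum_sub_distrib, momCoord]
      ring
    · simp only [cut_of_notMem hy]
      simp
  have h1 := hf.weak_eq φ hφ
  rw [integral_Ioi_eq_integral_cut (T := T), e] at h1
  · have j12 : Integrable fun y => cut T f y * dirD dirT φ y
        + ∑ i, cut T f y * dirD (dirP i) (dirD (dirP i) φ) y := j1.add j2'
    rw [integral_add j12 j3', integral_add j1 j2', integral_finsetSum _ fun i _ => j2 i,
      integral_finsetSum _ fun i _ => j3 i] at h1
    exact h1
  · rw [e]
    exact (j1.add j2').add j3'
  · intro t z ht
    have hn : ((t, z) : SpaceTime d) ∉ tsupport φ := fun h' => absurd (hφT h') (not_lt.2 ht)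
    rw [derivT_eq, hφ.isSmooth.derivX_eq_sum, hφ.isSmooth.derivP_eq_sum,
        hφ.isSmooth.laplaceP_eq]
    simp [hφ.dirD_eq_zero _ hn, (hφ.dirD _).dirD_eq_zero _ fun h' => hn (hφ.tsupport_dirD _ h')]

/-- Two regular weak solutions form a solution pair on every bounded region. -/
theorem exists_isSolutionPair {κ : ℝ} {f g : ℝ → Phase d → ℝ} {f₀ g₀ : Phase d → ℝ}
    (hf : IsWeakSolution κ f f₀) (hg : IsWeakSolution κ g g₀) (hrf : HasGradRegularity f)
    (hrg : HasGradRegularity g) {T : ℝ} (hT : 0 < T) (R : ℝ) :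
    ∃ Fx Fp Gx Gp, IsSolutionPair (region d T R) κ (cut T f) (cut T g) Fx Fp Gx Gp := by
  obtain ⟨⟨Fx, hFx, rFx⟩, ⟨Fp, hFp, rFp⟩⟩ := hrf
  obtain ⟨⟨Gx, hGx, rGx⟩, ⟨Gp, hGp, rGp⟩⟩ := hrg
  have mf := hf.cont.memL1L2_cut T
  have mg := hg.cont.memL1L2_cut T
  have wx : ∀ {u : ℝ → Phase d → ℝ} {F : ℝ → Phase d → Mom d}, IsWeakGradX u F →
      IsL2locL1L2 F → MemL1L2 (cut T u) → ∀ i, HasWeakDeriv (region d T R) (dirX i) (cut T u)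
        (cut T fun t z => ⟪F t z, EuclideanSpace.single i 1⟫) := by
    intro u F hF rF mu i
    refine hasWeakDeriv_cut mu (rF.memL1L2_cut hT i) fun φ hφ hφ0 => ?_
    have := hF φ hφ hφ0 (EuclideanSpace.single i 1)
    simp only [derivX_eq] at this
    exact this
  have wp : ∀ {u : ℝ → Phase d → ℝ} {F : ℝ → Phase d → Mom d}, IsWeakGradP u F →
      IsL2locL1L2 F → MemL1L2 (cut T u) → ∀ i, HasWeakDeriv (region d T R) (dirP i) (cut T u)
        (cut T fun t z => ⟪F t z, EuclideanSpace.single i 1⟫) := by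
    intro u F hF rF mu i
    refine hasWeakDeriv_cut mu (rF.memL1L2_cut hT i) fun φ hφ hφ0 => ?_
    have := hF φ hφ hφ0 (EuclideanSpace.single i 1)
    simp only [hφ.isSmooth.derivP_eq] at this
    exact this
  refine ⟨_, _, _, _, ⟨isOpen_region T R, ⟨R, fun y hy i => ?_⟩, mf, mg,
    fun i => rFx.memL1L2_cut hT i, fun i => rFp.memL1L2_cut hT i,
    fun i => rGx.memL1L2_cut hT i, fun i => rGp.memL1L2_cut hT i,
    wx hFx rFx mf, wp hFp rFp mf, wx hGx rGx mg, wp hGp rGp mg, fun φ hφ hφΩ => ?_⟩⟩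
  · have := PiLp.norm_apply_le y.2.2 i
    exact this.trans hy.2.le
  · have hφT : tsupport φ ⊆ {y | y.1 < T} := fun y hy => (hφΩ hy).1.2
    have h0 : ∀ z : Phase d, φ (0, z) = 0 := fun z =>
      image_eq_zero_of_notMem_tsupport fun h' => lt_irrefl _ (hφΩ h').1.1
    have h1 := hf.integral_cut hφ hφT
    have h2 := hg.integral_cut hφ hφT
    simp only [h0, zero_mul, integral_zero, add_zero] at h1 h2
    have iu : ∀ {u : ℝ → Phase d → ℝ}, MemL1L2 (cut T u) → Integrable (cut T u) := fun hu =>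
      memLp_one_iff_integrable.1 hu.1
    have iw : ∀ {u : ℝ → Phase d → ℝ}, MemL1L2 (cut T u) →
        Integrable fun y => cut T u y + κ * (cut T u y * cut T u y) := fun hm =>
      (iu hm).add (Integrable.const_mul (memLp_one_iff_integrable.1 (hm.2.mul' hm.2)) κ)
    have hX : ∀ i, IsTestFunction fun y =>
        momCoord i y * (dirD (dirX i) φ y - dirD (dirP i) φ y) := fun i =>
      IsTestFunction.mul_left (φ := fun y => dirD (dirX i) φ y - dirD (dirP i) φ y)
        ⟨ContDiff.sub (hφ.dirD (dirX i)).1 (hφ.dirD (dirP i)).1,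
          (hφ.dirD (dirX i)).2.sub (hφ.dirD (dirP i)).2⟩ (isSmooth_momCoord i)
    have e1 : ∫ y, (cut T f y - cut T g y)
          * (dirD dirT φ y + ∑ i, dirD (dirP i) (dirD (dirP i) φ) y)
        = ((∫ y, cut T f y * dirD dirT φ y)
          + ∑ i, ∫ y, cut T f y * dirD (dirP i) (dirD (dirP i) φ) y)
        - ((∫ y, cut T g y * dirD dirT φ y)
          + ∑ i, ∫ y, cut T g y * dirD (dirP i) (dirD (dirP i) φ) y) := by
      have a1 := integrable_mul_test (iu mf) (hφ.dirD dirT)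
      have a2 := integrable_mul_test (iu mg) (hφ.dirD dirT)
      have b1 := fun i => integrable_mul_test (iu mf) ((hφ.dirD (dirP i)).dirD (dirP i))
      have b2 := fun i => integrable_mul_test (iu mg) ((hφ.dirD (dirP i)).dirD (dirP i))
      have b1' := integrable_finsetSum Finset.univ fun i _ => b1 i
      have b2' := integrable_finsetSum Finset.univ fun i _ => b2 i
      rw [← integral_finsetSum _ fun i _ => b1 i, ← integral_finsetSum _ fun i _ => b2 i,
        ← integral_add a1 b1', ← integral_add a2 b2']
      have e3 := integral_sub (a1.add b1') (a2.add b2')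
      simp only [Pi.add_apply] at e3
      rw [← e3]
      refine integral_congr_ae (Eventually.of_forall fun y => ?_)
      simp only [← Finset.mul_sum]
      ring
    have e2 : ∀ i, ∫ y, ((cut T f y - cut T g y)
          + κ * (cut T f y * cut T f y - cut T g y * cut T g y))
          * (momCoord i y * (dirD (dirX i) φ y - dirD (dirP i) φ y))
        = (∫ y, (cut T f y + κ * (cut T f y * cut T f y))
          * (momCoord i y * (dirD (dirX i) φ y - dirD (dirP i) φ y)))
        - ∫ y, (cut T g y + κ * (cut T g y * cut T g y))
          * (momCoord i y * (dirD (dirX i) φ y - dirD (dirP i) φ y)) := by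
      intro i
      rw [← integral_sub (integrable_mul_test (iw mf) (hX i)) (integrable_mul_test (iw mg) (hX i))]
      refine integral_congr_ae (Eventually.of_forall fun y => ?_)
      ring
    rw [e1, Finset.sum_congr rfl fun i _ => e2 i, Finset.sum_sub_distrib]
    linarith

end Restriction

/-! ### The `L¹` contraction estimate -/

section Comparison

variable {d : ℕ}

theorem hasDerivAlong_comp_fst {θ : ℝ → ℝ} (hθ : Differentiable ℝ θ) :
    HasDerivAlong (line (dirT (d := d))) (fun y => θ y.1) (fun y => deriv θ y.1) := by
  intro y
  have h1 : (fun s : ℝ => θ (y + line dirT s).1) = fun s => θ (y.1 + s) := by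
    ext s; simp [line_apply, proj_apply, dirT]
  rw [h1]
  have h2 : HasDerivAt θ (deriv θ y.1) (y.1 + 0) := by
    rw [add_zero]; exact (hθ y.1).hasDerivAt
  exact h2.comp_const_add y.1 0

theorem hasDerivAlong_comp_momentum {χ : Mom d → ℝ} (hχ : Differentiable ℝ χ) (i : Fin d) :
    HasDerivAlong (line (dirP i)) (fun y => χ y.2.2)
      (fun y => fderiv ℝ χ y.2.2 (EuclideanSpace.single i 1)) := by
  intro y
  have h1 : (fun s : ℝ => χ (y + line (dirP i) s).2.2)
      = fun s : ℝ => χ (y.2.2 + s • EuclideanSpace.single i (1 : ℝ)) := by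
    ext s; simp [line_apply, proj_apply, dirP]
  rw [h1]
  exact ((hχ y.2.2).hasFDerivAt.hasLineDerivAt (EuclideanSpace.single i (1 : ℝ)))

theorem hasDerivAlong_const {v : Cover d} {φ : SpaceTime d → ℝ}
    (h : ∀ y s, φ (y + line v s) = φ y) : HasDerivAlong (line v) φ (fun _ => 0) := by
  intro y
  simp only [h y]
  exact hasDerivAt_const _ _

theorem isTestFunction_mul {θ : ℝ → ℝ} {χ : Mom d → ℝ} (hθ : ContDiff ℝ ∞ θ)
    (hθc : HasCompactSupport θ) (hχ : ContDiff ℝ ∞ χ) (hχc : HasCompactSupport χ) :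
    IsTestFunction (fun y : SpaceTime d => θ y.1 * χ y.2.2) := by
  refine ⟨(isSmooth_comp_fst hθ).mul (isSmooth_comp_snd_snd hχ), ?_⟩
  refine HasCompactSupport.intro (K := tsupport θ ×ˢ (univ ×ˢ tsupport χ))
    (IsCompact.prod hθc (isCompact_univ.prod hχc)) fun y hy => ?_
  by_contra hn
  refine hy ⟨subset_tsupport θ fun h => hn ?_, mem_univ _, subset_tsupport χ fun h => hn ?_⟩
  · rw [h, zero_mul]
  · rw [h, mul_zero]

theorem tsupport_mul_subset_prod (θ : ℝ → ℝ) (χ : Mom d → ℝ) :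
    tsupport (fun y : SpaceTime d => θ y.1 * χ y.2.2)
      ⊆ {y | y.1 ∈ tsupport θ ∧ y.2.2 ∈ tsupport χ} := by
  refine closure_minimal (fun y hy => ⟨subset_tsupport θ ?_, subset_tsupport χ ?_⟩)
    (((isClosed_tsupport θ).preimage continuous_fst).inter
      ((isClosed_tsupport χ).preimage continuous_snd.snd))
  · exact left_ne_zero_of_mul hy
  · exact right_ne_zero_of_mul hy

theorem fderiv_comp_smul_apply {χ : Mom d → ℝ} (hχ : Differentiable ℝ χ) (ε : ℝ) (p v : Mom d) :
    fderiv ℝ (fun q => χ (ε • q)) p v = ε * fderiv ℝ χ (ε • p) v := by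
  have h1 : HasFDerivAt (fun q : Mom d => ε • q) (ε • ContinuousLinearMap.id ℝ (Mom d)) p :=
    (hasFDerivAt_id p).const_smul ε
  have h2 := ((hχ (ε • p)).hasFDerivAt.comp p h1).fderiv
  rw [Function.comp_def] at h2
  rw [h2]
  simp

/-- Kato's inequality tested with a function of time only. The momentum cutoffs `χ(ε p)` cost
nothing in the limit `ε → 0`: the functions `(ε p) · ∇χ(ε p)` are bounded and tend to zero, so that
the integrability of `f`, `g`, `f²` and `g²` suffices and no momentum moment is required. -/
theorem integral_deriv_mul_posPart_nonneg {κ T : ℝ} {f g : SpaceTime d → ℝ}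
    (h : ∀ R, ∃ Fx Fp Gx Gp, IsSolutionPair (region d T R) κ f g Fx Fp Gx Gp)
    {θ : ℝ → ℝ} (hθ : ContDiff ℝ ∞ θ) (hθc : HasCompactSupport θ) (hθT : tsupport θ ⊆ Ioo 0 T)
    (hθ0 : ∀ t, 0 ≤ θ t) :
    0 ≤ ∫ y, deriv θ y.1 * max (f y - g y) 0 := by
  have hfg : MemL1L2 f ∧ MemL1L2 g := by
    obtain ⟨Fx, Fp, Gx, Gp, h0⟩ := h 0
    exact ⟨h0.memf, h0.memg⟩
  have iu : Integrable (fun y => f y - g y) := memLp_one_iff_integrable.1 (hfg.1.1.sub hfg.2.1)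
  have iv : Integrable (fun y => max (f y - g y) 0) := iu.pos_part
  have iav : Integrable (fun y => (1 + κ * (f y + g y)) * max (f y - g y) 0) := by
    have iw := integrable_flux (κ := κ) hfg.1 hfg.2
    refine iw.mono ?_ (Eventually.of_forall fun y => ?_)
    · exact (aestronglyMeasurable_const.add ((hfg.1.1.1.add hfg.2.1.1).const_mul κ)).mul iv.1
    · have e : (f y - g y) + κ * (f y * f y - g y * g y)
          = (1 + κ * (f y + g y)) * (f y - g y) := by ring
      rw [e, norm_mul, norm_mul]
      refine mul_le_mul_of_nonneg_left ?_ (norm_nonneg _)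
      rw [Real.norm_eq_abs, Real.norm_eq_abs, abs_of_nonneg (le_max_right _ _)]
      exact max_le (le_abs_self _) (abs_nonneg _)
  let b : ContDiffBump (0 : Mom d) := ⟨1, 2, one_pos, one_lt_two⟩
  have hχ : ContDiff ℝ ∞ (b : Mom d → ℝ) := b.contDiff
  have hχc : HasCompactSupport (b : Mom d → ℝ) := b.hasCompactSupport
  have hχd : Differentiable ℝ (b : Mom d → ℝ) := hχ.differentiable (by simp)
  set χ₁ : Fin d → Mom d → ℝ := fun i q => fderiv ℝ b q (EuclideanSpace.single i 1) with hχ₁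
  have s1 : ∀ i, ContDiff ℝ ∞ (χ₁ i) := fun i =>
    (hχ.fderiv_right (m := ∞) (by simp)).clm_apply contDiff_const
  have c1 : ∀ i, HasCompactSupport (χ₁ i) := fun i =>
    hχc.fderiv_apply (𝕜 := ℝ) (EuclideanSpace.single i 1)
  have d1 : ∀ i, Differentiable ℝ (χ₁ i) := fun i => (s1 i).differentiable (by simp)
  set χ₂ : Fin d → Mom d → ℝ := fun i q => fderiv ℝ (χ₁ i) q (EuclideanSpace.single i 1) with hχ₂
  have s2 : ∀ i, ContDiff ℝ ∞ (χ₂ i) := fun i =>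
    ((s1 i).fderiv_right (m := ∞) (by simp)).clm_apply contDiff_const
  have c2 : ∀ i, HasCompactSupport (χ₂ i) := fun i =>
    (c1 i).fderiv_apply (𝕜 := ℝ) (EuclideanSpace.single i 1)
  have z1 : ∀ i q, ‖q‖ < 1 → χ₁ i q = 0 := by
    intro i q hq
    have : (b : Mom d → ℝ) =ᶠ[𝓝 q] fun _ => 1 := by
      filter_upwards [Metric.isOpen_ball.mem_nhds (mem_ball_zero_iff.2 hq)] with r hr
      exact b.one_of_mem_closedBall (Metric.ball_subset_closedBall hr)
    simp only [hχ₁]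
    rw [this.fderiv_eq]
    simp
  obtain ⟨K₀, hK₀⟩ := hθc.exists_bound_of_continuous hθ.continuous
  have hθ' : Continuous (deriv θ) := hθ.continuous_deriv (by simp)
  obtain ⟨K₁, hK₁⟩ := hθc.deriv.exists_bound_of_continuous hθ'
  have hK₀0 : 0 ≤ K₀ := (norm_nonneg _).trans (hK₀ 0)
  set ε : ℕ → ℝ := fun n => ((n : ℝ) + 1)⁻¹ with hε
  have ε0 : ∀ n, 0 < ε n := fun n => by positivity
  have ε1 : ∀ n, ε n ≤ 1 := fun n => inv_le_one_of_one_le₀ (by simp)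
  have εlim : Tendsto ε atTop (𝓝 0) :=
    tendsto_inv_atTop_zero.comp (tendsto_natCast_atTop_atTop.atTop_add tendsto_const_nhds)
  have small : ∀ p : Mom d, ∀ᶠ n in atTop, ‖ε n • p‖ < 1 := by
    intro p
    have h1 : Tendsto (fun n => ‖ε n • p‖) atTop (𝓝 0) := by
      simpa using (εlim.smul_const p).norm
    exact h1.eventually (Iio_mem_nhds one_pos)
  set Ψ : ℕ → SpaceTime d → ℝ := fun n y => θ y.1 * b (ε n • y.2.2) with hΨ
  have sb : ∀ n, ContDiff ℝ ∞ fun q : Mom d => b (ε n • q) := fun n =>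
    hχ.comp (contDiff_const_smul (ε n))
  have hΨt : ∀ n, IsTestFunction (Ψ n) := fun n =>
    isTestFunction_mul hθ hθc (sb n) (hχc.comp_smul (ε0 n).ne')
  have hΨs : ∀ n, tsupport (Ψ n) ⊆ region d T (3 * ((n : ℝ) + 1)) := by
    intro n y hy
    have h1 := tsupport_mul_subset_prod θ (fun q : Mom d => b (ε n • q)) hy
    refine ⟨hθT h1.1, ?_⟩
    have h2 : ε n • y.2.2 ∈ tsupport (b : Mom d → ℝ) :=
      tsupport_comp_subset_preimage (b : Mom d → ℝ) (f := fun q : Mom d => ε n • q)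
        (by fun_prop) h1.2
    rw [b.tsupport_eq, mem_closedBall_zero_iff, norm_smul, Real.norm_eq_abs,
      abs_of_pos (ε0 n)] at h2
    have h3 : ε n * ((n : ℝ) + 1) = 1 := inv_mul_cancel₀ (by positivity)
    have h4 : ε n * ‖y.2.2‖ ≤ 2 := h2
    have h5 : ‖y.2.2‖ = (ε n * ‖y.2.2‖) * ((n : ℝ) + 1) := by
      rw [mul_right_comm, h3, one_mul]
    rw [h5]
    nlinarith [(n.cast_nonneg : (0 : ℝ) ≤ n)]
  have hΨ0 : ∀ n y, 0 ≤ Ψ n y := fun n y => mul_nonneg (hθ0 _) b.nonneg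
  -- The derivatives of the cutoff.
  have DT : ∀ n, dirD dirT (Ψ n) = fun y => deriv θ y.1 * b (ε n • y.2.2) := by
    intro n
    have h1 := (hasDerivAlong_comp_fst (d := d) (hθ.differentiable (by simp))).mul
      (hasDerivAlong_const (v := dirT) (φ := fun y : SpaceTime d => b (ε n • y.2.2))
        fun y s => by simp [line_apply, proj_apply, dirT])
    rw [((hΨt n).hasDerivAlong dirT).unique h1]
    ext y; ring
  have DX : ∀ n i, dirD (dirX i) (Ψ n) = fun _ => 0 := fun n i =>
    ((hΨt n).hasDerivAlong (dirX i)).unique (hasDerivAlong_const fun y s => by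
      simp [hΨ, line_apply, proj_apply, dirX])
  have gen : ∀ (χ : Mom d → ℝ), Differentiable ℝ χ → ∀ n i (c : ℝ),
      HasDerivAlong (line (dirP i)) (fun y : SpaceTime d => θ y.1 * (c * χ (ε n • y.2.2)))
        (fun y => θ y.1 * ((c * ε n)
          * fderiv ℝ χ (ε n • y.2.2) (EuclideanSpace.single i 1))) := by
    intro χ hχ n i c
    have h1 := (hasDerivAlong_const (v := dirP i) (φ := fun y : SpaceTime d => θ y.1)
        fun y s => by simp [line_apply, proj_apply, dirP]).mul
      ((hasDerivAlong_comp_momentum (χ := fun q => χ (ε n • q))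
        (hχ.comp (differentiable_id.const_smul (ε n))) i).const_mul c)
    refine h1.congr fun y => ?_
    rw [fderiv_comp_smul_apply hχ]
    ring
  have DP : ∀ n i, dirD (dirP i) (Ψ n) = fun y => θ y.1 * (ε n * χ₁ i (ε n • y.2.2)) := by
    intro n i
    have h1 := gen b hχd n i 1
    simp only [one_mul] at h1
    exact ((hΨt n).hasDerivAlong (dirP i)).unique h1
  have DPP : ∀ n i, dirD (dirP i) (dirD (dirP i) (Ψ n))
      = fun y => θ y.1 * (ε n * ε n * χ₂ i (ε n • y.2.2)) := by
    intro n i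
    have h1 := ((hΨt n).dirD (dirP i)).hasDerivAlong (dirP i)
    have h2 := gen (χ₁ i) (d1 i) n i (ε n)
    rw [← DP n i] at h2
    exact h1.unique h2
  have cscale : ∀ {χ : Mom d → ℝ}, Continuous χ → ∀ n,
      Continuous fun y : SpaceTime d => χ (ε n • y.2.2) := fun hc n =>
    hc.comp (continuous_snd.snd.const_smul (ε n))
  have cθ : Continuous fun y : SpaceTime d => θ y.1 := hθ.continuous.comp continuous_fst
  have cθ' : Continuous fun y : SpaceTime d => deriv θ y.1 := hθ'.comp continuous_fst
  -- Passage to the limit in the three kinds of terms.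
  have limT : Tendsto (fun n => -∫ y, dirD dirT (Ψ n) y * max (f y - g y) 0) atTop
      (𝓝 (-∫ y, deriv θ y.1 * max (f y - g y) 0)) := by
    refine (tendsto_integral_of_dominated_convergence (fun y => K₁ * ‖max (f y - g y) 0‖)
      (fun n => ?_) (iv.norm.const_mul K₁) (fun n => Eventually.of_forall fun y => ?_)
      (Eventually.of_forall fun y => ?_)).neg
    · rw [DT]
      exact (cθ'.mul (cscale b.continuous n)).aestronglyMeasurable.mul iv.1
    · rw [DT, norm_mul, norm_mul]
      refine mul_le_mul_of_nonneg_right ?_ (norm_nonneg _)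
      refine (mul_le_of_le_one_right (norm_nonneg _) ?_).trans (hK₁ _)
      rw [Real.norm_eq_abs, abs_of_nonneg b.nonneg]
      exact b.le_one
    · refine Tendsto.congr' ?_ tendsto_const_nhds
      filter_upwards [small y.2.2] with n hn
      have e : (b : Mom d → ℝ) (ε n • y.2.2) = 1 :=
        b.one_of_mem_closedBall (mem_closedBall_zero_iff.2 hn.le)
      rw [DT]
      simp only [e, mul_one]
  have limX : ∀ i, Tendsto (fun n => ∫ y, (momCoord i y * (dirD (dirX i) (Ψ n) y
      - dirD (dirP i) (Ψ n) y)) * ((1 + κ * (f y + g y)) * max (f y - g y) 0)) atTop (𝓝 0) := by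
    intro i
    obtain ⟨K₂, hK₂⟩ := ((c1 i).mul_left (f := fun q : Mom d => q i)).exists_bound_of_continuous
      ((by fun_prop : Continuous fun q : Mom d => q i).mul (s1 i).continuous)
    have e : ∀ n y, momCoord i y * (dirD (dirX i) (Ψ n) y - dirD (dirP i) (Ψ n) y)
        = -(θ y.1 * ((ε n • y.2.2) i * χ₁ i (ε n • y.2.2))) := by
      intro n y
      rw [DX, DP, PiLp.smul_apply, smul_eq_mul, momCoord]
      ring
    simp only [e]
    suffices h0 : Tendsto _ atTop (𝓝 (∫ _ : SpaceTime d, (0 : ℝ))) by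
      rwa [integral_zero] at h0
    refine tendsto_integral_of_dominated_convergence
      (fun y => (K₀ * K₂) * ‖(1 + κ * (f y + g y)) * max (f y - g y) 0‖) (fun n => ?_)
      (iav.norm.const_mul _) (fun n => Eventually.of_forall fun y => ?_)
      (Eventually.of_forall fun y => ?_)
    · refine Continuous.aestronglyMeasurable ?_ |>.mul iav.1
      exact (cθ.mul ((cscale (χ := fun q : Mom d => q i) (by fun_prop) n).mul
        (cscale (s1 i).continuous n))).neg
    · rw [norm_mul, norm_neg, norm_mul (θ y.1)]
      refine mul_le_mul_of_nonneg_right ?_ (norm_nonneg _)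
      exact mul_le_mul (hK₀ _) (hK₂ _) (norm_nonneg _) hK₀0
    · refine Tendsto.congr' ?_ tendsto_const_nhds
      filter_upwards [small y.2.2] with n hn
      rw [z1 i _ hn]
      ring
  have limP : ∀ i, Tendsto (fun n => ∫ y, dirD (dirP i) (dirD (dirP i) (Ψ n)) y
      * max (f y - g y) 0) atTop (𝓝 0) := by
    intro i
    obtain ⟨K₂, hK₂⟩ := (c2 i).exists_bound_of_continuous (s2 i).continuous
    have hK₂0 : 0 ≤ K₂ := (norm_nonneg _).trans (hK₂ 0)
    simp only [DPP]
    suffices h0 : Tendsto _ atTop (𝓝 (∫ _ : SpaceTime d, (0 : ℝ))) by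
      rwa [integral_zero] at h0
    refine tendsto_integral_of_dominated_convergence
      (fun y => (K₀ * K₂) * ‖max (f y - g y) 0‖) (fun n => ?_)
      (iv.norm.const_mul _) (fun n => Eventually.of_forall fun y => ?_)
      (Eventually.of_forall fun y => ?_)
    · refine Continuous.aestronglyMeasurable ?_ |>.mul iv.1
      exact cθ.mul (continuous_const.mul (cscale (s2 i).continuous n))
    · rw [norm_mul, norm_mul (θ y.1), norm_mul (ε n * ε n)]
      refine mul_le_mul_of_nonneg_right ?_ (norm_nonneg _)
      refine mul_le_mul (hK₀ _) ?_ (mul_nonneg (norm_nonneg _) (norm_nonneg _)) hK₀0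
      refine (mul_le_of_le_one_left (norm_nonneg _) ?_).trans (hK₂ _)
      rw [norm_mul, Real.norm_eq_abs, abs_of_pos (ε0 n)]
      exact mul_le_one₀ (ε1 n) (ε0 n).le (ε1 n)
    · have l1 : Tendsto (fun n => θ y.1 * (ε n * ε n * χ₂ i (ε n • y.2.2)) * max (f y - g y) 0)
          atTop (𝓝 (θ y.1 * (0 * 0 * χ₂ i ((0 : ℝ) • y.2.2)) * max (f y - g y) 0)) :=
        (((εlim.mul εlim).mul (((s2 i).continuous.tendsto _).comp
          (εlim.smul_const y.2.2))).const_mul _).mul_const _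
      simpa using l1
  have lim := (tendsto_finsetSum Finset.univ fun i _ => limX i).add
    (tendsto_finsetSum Finset.univ fun i _ => limP i)
  simp only [Finset.sum_const_zero, add_zero] at lim
  have := le_of_tendsto_of_tendsto' limT lim fun n => by
    obtain ⟨Fx, Fp, Gx, Gp, hn⟩ := h (3 * ((n : ℝ) + 1))
    exact hn.kato (hΨt n) (hΨs n) (hΨ0 n)
  linarith

/-- A continuous function on `[0, ∞)` with nonpositive distributional derivative does not exceed
its initial value. -/
theorem le_initial_of_integral_deriv_mul_nonneg {U : ℝ → ℝ} (hU : ContinuousOn U (Ici 0))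
    (h : ∀ θ : ℝ → ℝ, ContDiff ℝ ∞ θ → HasCompactSupport θ → tsupport θ ⊆ Ioi 0 →
      (∀ t, 0 ≤ θ t) → 0 ≤ ∫ t, deriv θ t * U t) {t : ℝ} (ht : 0 ≤ t) : U t ≤ U 0 := by
  -- Extend `U` by its initial value and mollify: the mollified functions are antitone.
  set V : ℝ → ℝ := fun s => U (max s 0) with hV
  have hVc : Continuous V :=
    hU.comp_continuous (continuous_id.max continuous_const) fun s =>
      mem_Ici.2 (le_max_right _ _)
  have hVU : ∀ s, 0 ≤ s → V s = U s := fun s hs => by simp only [hV, max_eq_left hs]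
  let φ : ℕ → ContDiffBump (0 : ℝ) := fun n =>
    ⟨((n : ℝ) + 1)⁻¹ / 2, ((n : ℝ) + 1)⁻¹, by positivity, half_lt_self (by positivity)⟩
  have hφ0 : Tendsto (fun n => (φ n).rOut) atTop (𝓝 0) :=
    tendsto_inv_atTop_zero.comp (tendsto_natCast_atTop_atTop.atTop_add tendsto_const_nhds)
  set W : ℕ → ℝ → ℝ := fun n => conv volume V ((φ n).normed volume) with hW
  have hWlim : ∀ s, Tendsto (fun n => W n s) atTop (𝓝 (V s)) := by
    intro s
    have := ContDiffBump.convolution_tendsto_right_of_continuous (μ := volume) (φ := φ) hφ0 hVc s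
    refine this.congr fun n => ?_
    simp only [hW, conv, convolution, ContinuousLinearMap.lsmul_apply, smul_eq_mul]
    rw [← integral_sub_left_eq_self _ volume s]
    refine integral_congr_ae (Eventually.of_forall fun z => ?_)
    simp [mul_comm]
  have hs : ∀ n, ContDiff ℝ ∞ ((φ n).normed volume : ℝ → ℝ) := fun n => (φ n).contDiff_normed
  have hWd : ∀ n s, HasDerivAt (W n) (conv volume V (deriv ((φ n).normed volume)) s) s := by
    intro n s
    have hd : HasDerivAlong (AddMonoidHom.id ℝ) ((φ n).normed volume : ℝ → ℝ)
        (deriv ((φ n).normed volume)) := by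
      intro y
      have h2 : HasDerivAt ((φ n).normed volume) (deriv ((φ n).normed volume) y) (y + 0) := by
        rw [add_zero]
        exact ((hs n).differentiable (by simp) y).hasDerivAt
      exact h2.comp_const_add y 0
    have h1 := hasDerivAlong_conv (μ := volume) (γ := AddMonoidHom.id ℝ) continuous_id
      hVc.locallyIntegrable (hs n).continuous ((hs n).continuous_deriv (by simp))
      (φ n).hasCompactSupport_normed hd
    have h2 := h1.hasDerivAt 0 s
    simpa using h2
  have hle : ∀ n s, (φ n).rOut < s → conv volume V (deriv ((φ n).normed volume)) s ≤ 0 := by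
    intro n s hns
    set θ : ℝ → ℝ := fun r => (φ n).normed volume (s - r) with hθ
    have hθs : tsupport θ ⊆ Ioi 0 := by
      intro r hr
      have h1 : s - r ∈ tsupport ((φ n).normed volume : ℝ → ℝ) :=
        tsupport_comp_subset_preimage ((φ n).normed volume : ℝ → ℝ) (f := fun r => s - r)
          (by fun_prop) hr
      rw [(φ n).tsupport_normed_eq, mem_closedBall_zero_iff, Real.norm_eq_abs, abs_le] at h1
      have := h1.2
      simp only [mem_Ioi]
      linarith
    have hdθ : ∀ r, deriv θ r = -deriv ((φ n).normed volume) (s - r) := fun r =>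
      deriv_comp_const_sub _ s r
    have h1 := h θ ((hs n).comp (contDiff_const.sub contDiff_id))
      ((φ n).hasCompactSupport_normed.comp_homeomorph (Homeomorph.subLeft s)) hθs
      fun r => (φ n).nonneg_normed _
    have e : ∫ r, deriv θ r * U r = -conv volume V (deriv ((φ n).normed volume)) s := by
      rw [conv, ← integral_neg]
      refine integral_congr_ae (Eventually.of_forall fun r => ?_)
      rcases lt_or_ge 0 r with hr | hr
      · simp only [hVU r hr.le, hdθ]
        ring
      · have h0 : deriv θ r = 0 := by
          by_contra hne
          exact absurd (hθs (support_deriv_subset hne)) (not_lt.2 hr)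
        have h5 : deriv ((φ n).normed volume) (s - r) = 0 := by linarith [hdθ r]
        beta_reduce
        rw [h0, h5]
        ring
    rw [e] at h1
    linarith
  have mono : ∀ s r, 0 < s → s ≤ r → V r ≤ V s := by
    intro s r hs0 hsr
    refine le_of_tendsto_of_tendsto (hWlim r) (hWlim s) ?_
    filter_upwards [hφ0.eventually (Iio_mem_nhds hs0)] with n hn
    have hn' : (φ n).rOut < s := hn
    refine antitoneOn_of_deriv_nonpos (convex_Ici s)
      (fun x _ => (hWd n x).continuousAt.continuousWithinAt)
      (fun x _ => (hWd n x).differentiableAt.differentiableWithinAt) (fun x hx => ?_)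
      self_mem_Ici hsr hsr
    rw [(hWd n x).deriv]
    rw [interior_Ici] at hx
    exact hle n x (hn'.trans hx)
  rcases ht.eq_or_lt with rfl | ht0
  · exact le_rfl
  have h1 : Tendsto V (𝓝[>] 0) (𝓝 (V 0)) := (hVc.tendsto 0).mono_left nhdsWithin_le_nhds
  have h2 : V t ≤ V 0 := by
    refine ge_of_tendsto h1 ?_
    filter_upwards [Ioo_mem_nhdsGT ht0] with s hs
    exact mono s t hs.1 hs.2.le
  rwa [hVU t ht, hVU 0 le_rfl] at h2

theorem continuousOn_integral_posPart {f g : ℝ → Phase d → ℝ} (hf : IsContL1L2 f)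
    (hg : IsContL1L2 g) : ContinuousOn (fun t => ∫ z, max (f t z - g t z) 0) (Ici 0) := by
  intro t ht
  have hi : ∀ s, 0 ≤ s → Integrable fun z => max (f s z - g s z) 0 := fun s hs =>
    (memLp_one_iff_integrable.1 ((hf.memLp_one s hs).sub (hg.memLp_one s hs))).pos_part
  refine tendsto_integral_of_L1' _ (hi t ht).1 ?_ ?_
  · filter_upwards [self_mem_nhdsWithin] with s hs using hi s hs
  · have h1 := (hf.cont_one t ht).add (hg.cont_one t ht)
    rw [add_zero] at h1
    refine tendsto_of_tendsto_of_tendsto_of_le_of_le' tendsto_const_nhds h1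
      (Eventually.of_forall fun _ => zero_le) ?_
    filter_upwards [self_mem_nhdsWithin] with s hs
    have m1 : AEStronglyMeasurable (f s - f t) volume :=
      (hf.memLp_one s hs).1.sub (hf.memLp_one t ht).1
    have m2 : AEStronglyMeasurable (g s - g t) volume :=
      (hg.memLp_one s hs).1.sub (hg.memLp_one t ht).1
    refine le_trans (eLpNorm_mono_real (g := fun z => |(f s - f t) z| + |(g s - g t) z|)
      fun z => ?_) ((eLpNorm_add_le m1.norm m2.norm le_rfl).trans (le_of_eq ?_))
    · simp only [Pi.sub_apply, Real.norm_eq_abs]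
      refine (abs_max_sub_max_le_abs _ _ _).trans ?_
      have : f s z - g s z - (f t z - g t z) = (f s z - f t z) - (g s z - g t z) := by ring
      rw [this]
      exact abs_sub _ _
    · rw [eLpNorm_norm, eLpNorm_norm]

/-- The `L¹` contraction estimate for the positive part of the difference of two solutions. -/
theorem integral_posPart_le {κ : ℝ} {f g : ℝ → Phase d → ℝ} {f₀ g₀ : Phase d → ℝ}
    (hf : IsWeakSolution κ f f₀) (hg : IsWeakSolution κ g g₀) (hrf : HasGradRegularity f)
    (hrg : HasGradRegularity g) {t : ℝ} (ht : 0 ≤ t) :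
    ∫ z, max (f t z - g t z) 0 ≤ ∫ z, max (f 0 z - g 0 z) 0 := by
  refine le_initial_of_integral_deriv_mul_nonneg
    (continuousOn_integral_posPart hf.cont hg.cont) (fun θ hθ hθc hθ0 hθn => ?_) ht
  obtain ⟨T₀, hT₀⟩ := hθc.isCompact.bddAbove
  set T : ℝ := max T₀ 0 + 1 with hT
  have hT0 : 0 < T := by have := le_max_right T₀ 0; linarith
  have hθT : tsupport θ ⊆ Ioo 0 T := fun s hs =>
    ⟨hθ0 hs, by have := hT₀ hs; have := le_max_left T₀ 0; linarith⟩
  have key := integral_deriv_mul_posPart_nonneg (κ := κ)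
    (fun R => exists_isSolutionPair hf hg hrf hrg hT0 R) hθ hθc hθT hθn
  have hθ' : Continuous (deriv θ) := hθ.continuous_deriv (by simp)
  obtain ⟨K₁, hK₁⟩ := hθc.deriv.exists_bound_of_continuous hθ'
  have iv : Integrable (fun y : SpaceTime d => max (cut T f y - cut T g y) 0) :=
    (memLp_one_iff_integrable.1 ((hf.cont.memL1L2_cut T).1.sub
      (hg.cont.memL1L2_cut T).1)).pos_part
  have i1 : Integrable (fun y : SpaceTime d => deriv θ y.1 * max (cut T f y - cut T g y) 0) :=
    iv.bdd_mul (hθ'.comp continuous_fst).aestronglyMeasurable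
      (Eventually.of_forall fun y => hK₁ y.1)
  have e : (volume : Measure (SpaceTime d)) = (volume : Measure ℝ).prod volume := rfl
  rw [e] at key i1
  rw [integral_prod _ i1] at key
  refine key.trans (le_of_eq (integral_congr_ae (Eventually.of_forall fun s => ?_)))
  simp only [integral_const_mul]
  by_cases hs : s ∈ Ioo 0 T
  · congr 1
    refine integral_congr_ae (Eventually.of_forall fun z => ?_)
    simp only [cut_of_mem (y := ((s, z) : SpaceTime d)) hs]
  · have : deriv θ s = 0 := by
      by_contra hne
      exact hs (hθT (support_deriv_subset hne))
    rw [this, zero_mul, zero_mul]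

/-- The fundamental lemma of the calculus of variations on an open subset of space-time. -/
theorem ae_eq_zero_of_integral_mul_test {Ω : Set (SpaceTime d)} (hΩ : IsOpen Ω)
    {v : SpaceTime d → ℝ} (hv : MemLp v 1 volume)
    (h : ∀ φ : SpaceTime d → ℝ, IsTestFunction φ → tsupport φ ⊆ Ω → ∫ y, v y * φ y = 0) :
    ∀ᵐ y, y ∈ Ω → v y = 0 := by
  obtain ⟨ρ, hρ, hρt⟩ := exists_mollifier d
  obtain ⟨ns, hns, hae⟩ := (tendstoLp_conv le_rfl (by simp) hv hρ).exists_ae_tendsto le_rfl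
  filter_upwards [hae] with y hy hyΩ
  refine tendsto_nhds_unique hy (Tendsto.congr' ?_ tendsto_const_nhds)
  filter_upwards [hns.tendsto_atTop.eventually (hρ.eventually_tsupport_subset
    (isCompact_singleton (x := y)) hΩ (singleton_subset_iff.2 hyΩ))] with n hn
  exact (h _ ((hρt _).comp_sub_left y) (hn y rfl)).symm

end Comparison

/-! ### The initial datum and the comparison principle -/

section InitialDatum

variable {d : ℕ}

theorem IsTestFunction.hasCompactSupport_slice {φ : SpaceTime d → ℝ} (hφ : IsTestFunction φ)
    (t : ℝ) : HasCompactSupport fun z : Phase d => φ (t, z) :=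
  HasCompactSupport.intro (K := Prod.snd '' tsupport φ) (IsCompact.image hφ.2 continuous_snd)
    fun _ hz => image_eq_zero_of_notMem_tsupport fun h => hz ⟨_, h, rfl⟩

theorem hasCompactSupport_mul_slice {θ : ℝ → ℝ} {q : SpaceTime d → ℝ}
    (hθ : HasCompactSupport θ) (hq : HasCompactSupport q) (τ : ℝ) :
    HasCompactSupport (fun y : SpaceTime d => θ y.1 * q (τ, y.2)) := by
  refine HasCompactSupport.intro (K := tsupport θ ×ˢ (Prod.snd '' tsupport q))
    (IsCompact.prod hθ (IsCompact.image hq continuous_snd)) fun y hy => ?_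
  by_contra hn
  refine hy ⟨subset_tsupport θ (left_ne_zero_of_mul hn), ?_⟩
  exact ⟨(τ, y.2), subset_tsupport q (right_ne_zero_of_mul hn), rfl⟩

theorem IsTestFunction.mul_slice {θ : ℝ → ℝ} {q : SpaceTime d → ℝ} (hq : IsTestFunction q)
    (hθ : ContDiff ℝ ∞ θ) (hθc : HasCompactSupport θ) (τ : ℝ) :
    IsTestFunction (fun y : SpaceTime d => θ y.1 * q (τ, y.2)) := by
  refine ⟨(isSmooth_comp_fst hθ).mul (ψ := fun y => q (τ, y.2)) ?_,
    hasCompactSupport_mul_slice hθc hq.2 τ⟩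
  exact ContDiff.comp (f := fun x : Cover d => ((τ, x.2) : Cover d)) hq.1 (by fun_prop)

theorem IsTestFunction.dirD_mul_slice {θ : ℝ → ℝ} {q : SpaceTime d → ℝ} (hq : IsTestFunction q)
    (hθ : ContDiff ℝ ∞ θ) (hθc : HasCompactSupport θ) (τ : ℝ) {v : Cover d} (hv : v.1 = 0) :
    QFP.dirD v (fun y : SpaceTime d => θ y.1 * q (τ, y.2))
      = fun y => θ y.1 * QFP.dirD v q (τ, y.2) := by
  have h1 := (hasDerivAlong_const (v := v) (φ := fun y : SpaceTime d => θ y.1)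
    fun y s => by simp [line_apply, proj_apply, hv]).mul
    (ψ := fun y => q (τ, y.2)) (ψ' := fun y => QFP.dirD v q (τ, y.2)) (fun y => by
      refine (hq.hasDerivAlong v (τ, y.2)).congr_of_eventuallyEq (Eventually.of_forall fun s => ?_)
      simp [line_apply, proj_apply, hv])
  rw [((hq.mul_slice hθ hθc τ).hasDerivAlong v).unique h1]
  ext y; ring

theorem continuousOn_integral_mul {f : ℝ → Phase d → ℝ} (hf : IsContL1L2 f) {q : Phase d → ℝ}
    (hq : Continuous q) {K : ℝ} (hK : ∀ z, ‖q z‖ ≤ K) :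
    ContinuousOn (fun t => ∫ z, f t z * q z) (Ici 0) := by
  intro t ht
  have hi : ∀ s, 0 ≤ s → Integrable fun z => f s z * q z := fun s hs =>
    (memLp_one_iff_integrable.1 (hf.memLp_one s hs)).mul_bdd hq.aestronglyMeasurable
      (Eventually.of_forall hK)
  refine tendsto_integral_of_L1' _ (hi t ht).1 ?_ ?_
  · filter_upwards [self_mem_nhdsWithin] with s hs using hi s hs
  · have h1 := ENNReal.Tendsto.const_mul (a := ENNReal.ofReal K) (hf.cont_one t ht)
      (Or.inr ENNReal.ofReal_ne_top)
    rw [mul_zero] at h1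
    refine tendsto_of_tendsto_of_tendsto_of_le_of_le tendsto_const_nhds h1
      (fun _ => zero_le) fun s =>
        eLpNorm_le_mul_eLpNorm_of_ae_le_mul (Eventually.of_forall fun z => ?_) 1
    simp only [Pi.sub_apply]
    rw [← sub_mul, norm_mul, mul_comm]
    exact mul_le_mul_of_nonneg_right (hK z) (norm_nonneg _)

/-- The initial datum tested against a slice `q(τ, ·)` of a test function. The test functions
`η(a t) q(τ, z)` concentrate at the initial time as `a → ∞`. -/
theorem IsWeakSolution.integral_initial {κ : ℝ} {f : ℝ → Phase d → ℝ} {f₀ : Phase d → ℝ}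
    (hf : IsWeakSolution κ f f₀) {q : SpaceTime d → ℝ} (hq : IsTestFunction q) (τ : ℝ) :
    ∫ z, q (τ, z) * f₀ z = ∫ z, f 0 z * q (τ, z) := by
  let η : ContDiffBump (0 : ℝ) := ⟨1 / 2, 1, by norm_num, by norm_num⟩
  have hη : ContDiff ℝ ∞ (η : ℝ → ℝ) := η.contDiff
  have hηc : HasCompactSupport (η : ℝ → ℝ) := η.hasCompactSupport
  have hη0 : (η : ℝ → ℝ) 0 = 1 := η.one_of_mem_closedBall (by simp [η])
  have hηz : ∀ s : ℝ, 1 < s → s ∉ tsupport (η : ℝ → ℝ) := fun s hs h => by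
    rw [η.tsupport_eq, mem_closedBall_zero_iff, Real.norm_eq_abs] at h
    have h' : |s| ≤ 1 := h
    linarith [le_abs_self s]
  have hη' : Continuous (deriv (η : ℝ → ℝ)) := hη.continuous_deriv (by simp)
  have hηz' : ∀ s : ℝ, 1 < s → deriv (η : ℝ → ℝ) s = 0 := fun s hs => by
    by_contra hne
    exact hηz s hs (support_deriv_subset hne)
  set a : ℕ → ℝ := fun n => (n : ℝ) + 2 with ha
  have a2 : ∀ n, 2 ≤ a n := fun n => by simp [ha]
  have a0 : ∀ n, 0 < a n := fun n => by linarith [a2 n]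
  have alim : Tendsto a atTop atTop := tendsto_natCast_atTop_atTop.atTop_add tendsto_const_nhds
  set θ : ℕ → ℝ → ℝ := fun n t => η (a n * t) with hθ
  have sθ : ∀ n, ContDiff ℝ ∞ (θ n) := fun n => hη.comp (contDiff_const.mul contDiff_id)
  have cθ : ∀ n, HasCompactSupport (θ n) := fun n => by
    have := hηc.comp_smul (a0 n).ne'
    simpa only [smul_eq_mul] using this
  have dθ : ∀ n t, deriv (θ n) t = a n * deriv (η : ℝ → ℝ) (a n * t) := fun n t => by
    have := deriv_comp_mul_left (a n) (η : ℝ → ℝ) t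
    simpa only [smul_eq_mul] using this
  have tθ : ∀ n, tsupport (θ n) ⊆ {t | t < 1} := fun n t ht => by
    have h1 : a n * t ∈ tsupport (η : ℝ → ℝ) :=
      tsupport_comp_subset_preimage (η : ℝ → ℝ) (f := fun t => a n * t) (by fun_prop) ht
    by_contra hn
    simp only [mem_ofPred_eq, not_lt] at hn
    exact hηz _ (by nlinarith [a2 n]) h1
  set Φ : ℕ → SpaceTime d → ℝ := fun n y => θ n y.1 * q (τ, y.2) with hΦ
  have hΦt : ∀ n, IsTestFunction (Φ n) := fun n => hq.mul_slice (sθ n) (cθ n) τ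
  have hΦs : ∀ n, tsupport (Φ n) ⊆ {y | y.1 < 1} := fun n y hy => by
    refine tθ n (tsupport_comp_subset_preimage (θ n) (f := fun y : SpaceTime d => y.1)
      (by fun_prop) ?_)
    exact tsupport_mul_subset_left (g := fun y : SpaceTime d => q (τ, y.2)) hy
  have hm := hf.cont.memL1L2_cut 1
  have if1 : Integrable (cut 1 f) := memLp_one_iff_integrable.1 hm.1
  have iw : Integrable fun y => cut 1 f y + κ * (cut 1 f y * cut 1 f y) :=
    if1.add (Integrable.const_mul (memLp_one_iff_integrable.1 (hm.2.mul' hm.2)) κ)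
  -- Terms in which the time derivative does not appear vanish in the limit.
  have lim0 : ∀ X w : SpaceTime d → ℝ, Integrable X → (∀ y, y.1 ≤ 0 → X y = 0) →
      IsTestFunction w → Tendsto (fun n => ∫ y, X y * (θ n y.1 * w (τ, y.2))) atTop (𝓝 0) := by
    intro X w hX hX0 hw
    obtain ⟨K, hK⟩ := hw.2.exists_bound_of_continuous hw.continuous
    suffices h0 : Tendsto _ atTop (𝓝 (∫ _ : SpaceTime d, (0 : ℝ))) by
      rwa [integral_zero] at h0
    refine tendsto_integral_of_dominated_convergence (fun y => ‖X y‖ * K) (fun n => ?_)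
      (hX.norm.mul_const K) (fun n => Eventually.of_forall fun y => ?_)
      (Eventually.of_forall fun y => ?_)
    · exact hX.1.mul (hw.mul_slice (sθ n) (cθ n) τ).continuous.aestronglyMeasurable
    · rw [norm_mul, norm_mul (θ n y.1)]
      refine mul_le_mul_of_nonneg_left ?_ (norm_nonneg _)
      refine (mul_le_of_le_one_left (norm_nonneg _) ?_).trans (hK _)
      rw [Real.norm_eq_abs, abs_of_nonneg η.nonneg]
      exact η.le_one
    · rcases le_or_gt y.1 0 with hy | hy
      · simp [hX0 y hy]
      · refine Tendsto.congr' ?_ tendsto_const_nhds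
        filter_upwards [(alim.atTop_mul_const hy).eventually_gt_atTop 1] with n hn
        have : θ n y.1 = 0 :=
          image_eq_zero_of_notMem_tsupport (f := (η : ℝ → ℝ)) (hηz _ hn)
        rw [this, zero_mul, mul_zero]
  have cut0 : ∀ y : SpaceTime d, y.1 ≤ 0 → cut 1 f y = 0 := fun y hy =>
    cut_of_notMem fun h => absurd h.1 (not_lt.2 hy)
  have vX : ∀ i : Fin d, (dirX i).1 = 0 := fun i => rfl
  have vP : ∀ i : Fin d, (dirP i).1 = 0 := fun i => rfl
  have limP : ∀ i, Tendsto (fun n => ∫ y, cut 1 f y * dirD (dirP i) (dirD (dirP i) (Φ n)) y)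
      atTop (𝓝 0) := by
    intro i
    refine (lim0 _ _ if1 cut0 ((hq.dirD (dirP i)).dirD (dirP i))).congr fun n => ?_
    rw [hΦ]
    simp only
    rw [hq.dirD_mul_slice (sθ n) (cθ n) τ (vP i),
      (hq.dirD (dirP i)).dirD_mul_slice (sθ n) (cθ n) τ (vP i)]
  have limX : ∀ i, Tendsto (fun n => ∫ y, (cut 1 f y + κ * (cut 1 f y * cut 1 f y))
      * (momCoord i y * (dirD (dirX i) (Φ n) y - dirD (dirP i) (Φ n) y))) atTop (𝓝 0) := by
    intro i
    have hw : IsTestFunction fun y => momCoord i y * (dirD (dirX i) q y - dirD (dirP i) q y) :=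
      IsTestFunction.mul_left (φ := fun y => dirD (dirX i) q y - dirD (dirP i) q y)
      ⟨ContDiff.sub (hq.dirD (dirX i)).1 (hq.dirD (dirP i)).1,
        (hq.dirD (dirX i)).2.sub (hq.dirD (dirP i)).2⟩ (isSmooth_momCoord i)
    refine (lim0 _ _ iw (fun y hy => by simp [cut0 y hy]) hw).congr fun n => ?_
    rw [hΦ]
    simp only
    rw [hq.dirD_mul_slice (sθ n) (cθ n) τ (vP i), hq.dirD_mul_slice (sθ n) (cθ n) τ (vX i)]
    refine integral_congr_ae (Eventually.of_forall fun y => ?_)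
    simp only [momCoord]
    ring
  have cq : Continuous fun z : Phase d => q (τ, z) := hq.continuous.comp (by fun_prop)
  obtain ⟨K, hK⟩ := hq.2.exists_bound_of_continuous hq.continuous
  set J : ℝ → ℝ := fun t => ∫ z, f (max t 0) z * q (τ, z) with hJ
  have cJ : Continuous J := (continuousOn_integral_mul hf.cont cq fun z => hK _).comp_continuous
    (continuous_id.max continuous_const) fun s => mem_Ici.2 (le_max_right _ _)
  obtain ⟨C, hC⟩ := (isCompact_Icc (a := (0 : ℝ)) (b := 1)).exists_bound_of_continuousOn
    cJ.continuousOn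
  have limT : Tendsto (fun n => ∫ y, cut 1 f y * dirD dirT (Φ n) y) atTop (𝓝 (-J 0)) := by
    have e1 : ∀ n, dirD dirT (Φ n) = fun y => deriv (θ n) y.1 * q (τ, y.2) := by
      intro n
      have h1 := (hasDerivAlong_comp_fst (d := d) ((sθ n).differentiable (by simp))).mul
        (hasDerivAlong_const (v := dirT) (φ := fun y : SpaceTime d => q (τ, y.2))
          fun y s => by
            have : y.2 + (0, 0) = y.2 := add_zero _
            simp [line_apply, proj_apply, dirT, toTorus_zero, this])
      rw [((hΦt n).hasDerivAlong dirT).unique h1]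
      ext y; ring
    have e2 : ∀ n, ∫ y, cut 1 f y * dirD dirT (Φ n) y
        = ∫ s, (Ioi (0 : ℝ)).indicator (fun s => deriv (η : ℝ → ℝ) s * J ((a n)⁻¹ * s)) s := by
      intro n
      have i1 := integrable_mul_test if1 ((hΦt n).dirD dirT)
      have e : (volume : Measure (SpaceTime d)) = (volume : Measure ℝ).prod volume := rfl
      rw [e] at i1 ⊢
      rw [integral_prod _ i1]
      have h1 := Measure.integral_comp_mul_left (fun s => (Ioi (0 : ℝ)).indicator
        (fun s => deriv (η : ℝ → ℝ) s * J ((a n)⁻¹ * s)) s) (a n)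
      rw [abs_of_pos (inv_pos.2 (a0 n)), smul_eq_mul, inv_mul_eq_div,
        eq_div_iff (a0 n).ne'] at h1
      rw [← h1, mul_comm, ← integral_const_mul]
      refine integral_congr_ae (Eventually.of_forall fun t => ?_)
      simp only [e1, dθ]
      by_cases ht : t ∈ Ioo (0 : ℝ) 1
      · have ht' : a n * t ∈ Ioi (0 : ℝ) := mul_pos (a0 n) ht.1
        rw [indicator_of_mem ht', inv_mul_cancel_left₀ (a0 n).ne']
        simp only [hJ, max_eq_left ht.1.le]
        rw [← integral_const_mul, ← integral_const_mul]
        refine integral_congr_ae (Eventually.of_forall fun z => ?_)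
        simp only [cut_of_mem (y := ((t, z) : SpaceTime d)) ht]
        ring
      · have h0 : ∀ z, cut 1 f (t, z) = 0 := fun z => cut_of_notMem (y := ((t, z) : SpaceTime d)) ht
        simp only [h0, zero_mul, integral_zero]
        rcases le_or_gt t 0 with h | h
        · rw [indicator_of_notMem, mul_zero]
          simp only [mem_Ioi, not_lt]
          exact mul_nonpos_of_nonneg_of_nonpos (a0 n).le h
        · have h1' : 1 ≤ t := not_lt.1 fun h' => ht ⟨h, h'⟩
          have h2 : 1 < a n * t := by nlinarith [a2 n]
          simp [indicator, hηz' _ h2]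
    have e3 : ∫ s, (Ioi (0 : ℝ)).indicator (fun s => deriv (η : ℝ → ℝ) s * J 0) s = -J 0 := by
      rw [integral_indicator measurableSet_Ioi, integral_mul_const,
        HasCompactSupport.integral_Ioi_deriv_eq (hη.of_le (by simp)) hηc, hη0]
      ring
    simp only [e2]
    rw [← e3]
    have C0 : 0 ≤ C := (norm_nonneg _).trans (hC 0 (by simp))
    have iη : Integrable (deriv (η : ℝ → ℝ)) := hη'.integrable_of_hasCompactSupport hηc.deriv
    refine tendsto_integral_of_dominated_convergence
      (fun s => ‖deriv (η : ℝ → ℝ) s‖ * C) (fun n => ?_) (iη.norm.mul_const C)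
      (fun n => Eventually.of_forall fun s => ?_) (Eventually.of_forall fun s => ?_)
    · refine (Continuous.aestronglyMeasurable ?_).indicator measurableSet_Ioi
      exact hη'.mul (cJ.comp (continuous_const.mul continuous_id))
    · by_cases hs : s ∈ Ioi (0 : ℝ)
      · rw [indicator_of_mem hs, norm_mul]
        rcases lt_or_ge 1 s with h | h
        · simp [hηz' s h]
        · refine mul_le_mul_of_nonneg_left (hC _ ⟨?_, ?_⟩) (norm_nonneg _)
          · exact mul_nonneg (inv_nonneg.2 (a0 n).le) (le_of_lt hs)
          · have : (a n)⁻¹ ≤ 1 := inv_le_one_of_one_le₀ (by linarith [a2 n])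
            exact mul_le_one₀ this (le_of_lt hs) h
      · rw [indicator_of_notMem hs, norm_zero]
        positivity
    · have l1 : Tendsto (fun n => J ((a n)⁻¹ * s)) atTop (𝓝 (J 0)) := by
        have : Tendsto (fun n => (a n)⁻¹ * s) atTop (𝓝 0) := by
          simpa using (tendsto_inv_atTop_zero.comp alim).mul_const s
        exact (cJ.tendsto 0).comp this
      by_cases hs : s ∈ Ioi (0 : ℝ)
      · simp only [indicator_of_mem hs]
        exact l1.const_mul _
      · simp only [indicator_of_notMem hs]
        exact tendsto_const_nhds
  have lim := (((limT.add (tendsto_finsetSum Finset.univ fun i _ => limP i)).add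
    (tendsto_finsetSum Finset.univ fun i _ => limX i)).add
    (tendsto_const_nhds (x := ∫ z, q (τ, z) * f₀ z)))
  have hz : ∀ n, ∫ z, Φ n (0, z) * f₀ z = ∫ z, q (τ, z) * f₀ z := fun n => by
    simp only [hΦ, hθ, mul_zero, hη0, one_mul]
  have := tendsto_nhds_unique (lim.congr fun n => by
    rw [← hz n]; exact hf.integral_cut (hΦt n) (hΦs n)) tendsto_const_nhds
  simp only [Finset.sum_const_zero, add_zero] at this
  have hJ0 : J 0 = ∫ z, f 0 z * q (τ, z) := by simp only [hJ, max_self]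
  linarith

/-- A weak solution attains its initial datum, which enters the definition through the test
functions only. -/
theorem IsWeakSolution.initial {κ : ℝ} {f : ℝ → Phase d → ℝ} {f₀ : Phase d → ℝ}
    (hf : IsWeakSolution κ f f₀) : f 0 =ᵐ[volume] f₀ := by
  have key : ∀ R : ℕ, ∀ᵐ z : Phase d, ‖z.2‖ < R → f 0 z = f₀ z := by
    intro R
    set B : Set (Phase d) := univ ×ˢ Metric.closedBall 0 R with hB
    have hBc : IsCompact B := isCompact_univ.prod (isCompact_closedBall _ _)
    have hBm : MeasurableSet B := hBc.isClosed.measurableSet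
    have if0 : Integrable (f 0) := memLp_one_iff_integrable.1 (hf.cont.memLp_one 0 le_rfl)
    have iD : Integrable (B.indicator fun z => f 0 z - f₀ z) :=
      (integrable_indicator_iff hBm).2
        (if0.integrableOn.sub (hf.init_locallyIntegrable.integrableOn_isCompact hBc))
    have iI : Integrable ((Ioo (0 : ℝ) 1).indicator fun _ => (1 : ℝ)) :=
      (integrable_indicator_iff measurableSet_Ioo).2 (integrableOn_const measure_Ioo_lt_top.ne)
    have iv : Integrable (fun y : SpaceTime d => (Ioo (0 : ℝ) 1).indicator (fun _ => (1 : ℝ)) y.1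
        * B.indicator (fun z => f 0 z - f₀ z) y.2) := iI.mul_prod iD
    have h0 := ae_eq_zero_of_integral_mul_test (isOpen_region (d := d) 1 R)
      (memLp_one_iff_integrable.2 iv) fun φ hφ hφΩ => by
        have i1 := integrable_mul_test iv hφ
        have e : (volume : Measure (SpaceTime d)) = (volume : Measure ℝ).prod volume := rfl
        rw [e] at i1 ⊢
        rw [integral_prod _ i1]
        refine integral_eq_zero_of_ae (Eventually.of_forall fun t => ?_)
        simp only [mul_assoc, Pi.zero_apply]
        rw [integral_const_mul]
        have e1 : ∀ z, B.indicator (fun z => f 0 z - f₀ z) z * φ (t, z)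
            = f 0 z * φ (t, z) - φ (t, z) * f₀ z := by
          intro z
          by_cases hz : z ∈ B
          · rw [indicator_of_mem hz]; ring
          · have : φ (t, z) = 0 := image_eq_zero_of_notMem_tsupport fun h => hz
              ⟨mem_univ _, mem_closedBall_zero_iff.2 (hφΩ h).2.le⟩
            rw [this]; ring
        have c1 : Continuous fun z : Phase d => φ (t, z) := hφ.continuous.comp (by fun_prop)
        obtain ⟨K, hK⟩ := hφ.2.exists_bound_of_continuous hφ.continuous
        have cs := hφ.hasCompactSupport_slice t
        have i2 : Integrable fun z => f 0 z * φ (t, z) :=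
          if0.mul_bdd c1.aestronglyMeasurable (Eventually.of_forall fun z => hK _)
        have i3 : Integrable fun z => φ (t, z) * f₀ z :=
          hf.init_locallyIntegrable.integrable_smul_left_of_hasCompactSupport c1 cs
        simp only [e1]
        rw [integral_sub i2 i3, hf.integral_initial hφ t, sub_self, mul_zero]
    have e : (volume : Measure (SpaceTime d)) = (volume : Measure ℝ).prod volume := rfl
    rw [e] at h0
    have h1 := Measure.ae_ae_of_ae_prod h0
    -- Any time in `(0, 1)` outside a null set gives the claim.
    obtain ⟨t, ht, ht'⟩ : ∃ t ∈ Ioo (0 : ℝ) 1, ∀ᵐ z : Phase d, (t, z) ∈ region d 1 R →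
        (Ioo (0 : ℝ) 1).indicator (fun _ => (1 : ℝ)) t
          * B.indicator (fun z => f 0 z - f₀ z) z = 0 := by
      by_contra hcon
      push Not at hcon
      have h2 : ∀ᵐ t : ℝ, t ∉ Ioo (0 : ℝ) 1 := by
        filter_upwards [h1] with t h3 h4
        exact not_eventually.2 ((hcon t h4).mono fun z hz => Classical.not_imp.2 hz) h3
      have h3 : volume (Ioo (0 : ℝ) 1) = 0 := measure_eq_zero_iff_ae_notMem.2 h2
      simp at h3
    filter_upwards [ht'] with z hz hzR
    have h3 := hz ⟨ht, hzR⟩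
    rw [indicator_of_mem ht, one_mul,
      indicator_of_mem (show z ∈ B from ⟨mem_univ _, mem_closedBall_zero_iff.2 hzR.le⟩)] at h3
    exact sub_eq_zero.1 h3
  filter_upwards [ae_all_iff.2 key] with z hz
  obtain ⟨R, hR⟩ := exists_nat_gt ‖z.2‖
  exact hz R hR

/-- The comparison principle for regular weak solutions: the integral of `(f - g)⁺` does not grow,
and it vanishes initially. -/
theorem comparison {κ : ℝ} {f g : ℝ → Phase d → ℝ} {f₀ g₀ : Phase d → ℝ}
    (hf : IsWeakSolution κ f f₀) (hg : IsWeakSolution κ g g₀) (hrf : HasGradRegularity f)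
    (hrg : HasGradRegularity g) (h0 : ∀ᵐ z, f₀ z ≤ g₀ z) {t : ℝ} (ht : 0 ≤ t) :
    ∀ᵐ z, f t z ≤ g t z := by
  have h1 := integral_posPart_le hf hg hrf hrg ht
  have h2 : ∫ z, max (f 0 z - g 0 z) 0 = 0 := by
    refine integral_eq_zero_of_ae ?_
    filter_upwards [hf.initial, hg.initial, h0] with z a b c
    rw [a, b]
    exact max_eq_right (by linarith)
  have hi : Integrable fun z => max (f t z - g t z) 0 :=
    (memLp_one_iff_integrable.1 ((hf.cont.memLp_one t ht).sub (hg.cont.memLp_one t ht))).pos_part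
  have hn : 0 ≤ fun z => max (f t z - g t z) 0 := fun z => le_max_right _ _
  have h3 := (integral_eq_zero_iff_of_nonneg hn hi).1
    (le_antisymm (h1.trans h2.le) (integral_nonneg hn))
  filter_upwards [h3] with z hz
  have : f t z - g t z ≤ 0 := by
    have := le_max_left (f t z - g t z) 0
    exact this.trans hz.le
  linarith

end InitialDatum

/-! ### Equilibria as stationary solutions -/

section Equilibria

variable {d : ℕ}

/-- The one-parameter subgroup of phase space with velocity `v`. -/
def phaseLine (v : Mom d × Mom d) : ℝ →+ Phase d where
  toFun s := (toTorus (s • v.1), s • v.2)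
  map_zero' := by simp [toTorus_zero]
  map_add' s r := by simp [add_smul, toTorus_add]

theorem phaseLine_apply (v : Mom d × Mom d) (s : ℝ) :
    phaseLine v s = (toTorus (s • v.1), s • v.2) := rfl

theorem continuous_phaseLine (v : Mom d × Mom d) : Continuous (phaseLine v) :=
  (continuous_toTorus.comp (by fun_prop)).prodMk (by fun_prop)

theorem IsSmooth.contDiff_time {φ : SpaceTime d → ℝ} (h : IsSmooth φ) (z : Phase d) :
    ContDiff ℝ ∞ (fun t => φ (t, z)) := by
  obtain ⟨x, hx⟩ := isOpenQuotientMap_toTorus.surjective z.1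
  have e : (fun t => φ (t, z)) = fun t => φ (proj (t, x, z.2)) := by
    simp only [proj_apply, hx]
  rw [e]
  exact ContDiff.comp (f := fun t : ℝ => ((t, x, z.2) : Cover d)) h (by fun_prop)

theorem IsTestFunction.continuous_slice {φ : SpaceTime d → ℝ} (hφ : IsTestFunction φ) (t : ℝ) :
    Continuous fun z : Phase d => φ (t, z) := hφ.continuous.comp (by fun_prop)

/-- Integration by parts in phase space at a fixed time. -/
theorem IsTestFunction.integral_mul_dirD_slice {φ : SpaceTime d → ℝ} (hφ : IsTestFunction φ)
    (t : ℝ) {v : Mom d × Mom d} {u u' : Phase d → ℝ} (hu : Continuous u) (hu' : Continuous u')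
    (h : HasDerivAlong (phaseLine v) u u') :
    ∫ z, u z * QFP.dirD (0, v) φ (t, z) = -∫ z, u' z * φ (t, z) := by
  refine integral_mul_deriv_eq_neg (continuous_phaseLine v) hu hu' (hφ.continuous_slice t)
    ((hφ.dirD _).continuous_slice t) (hφ.hasCompactSupport_slice t) h fun z => ?_
  refine (hφ.hasDerivAlong (0, v) (t, z)).congr_of_eventuallyEq (Eventually.of_forall fun s => ?_)
  simp [line_apply, proj_apply, phaseLine_apply, Prod.add_def]

theorem memLp_comp_snd {F : Type*} [NormedAddCommGroup F] {E : Mom d → F} {p : ENNReal}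
    (hE : MemLp E p volume) : MemLp (fun z : Phase d => E z.2) p volume :=
  hE.comp_snd volume

theorem isContL1L2_const {u : Phase d → ℝ} (h1 : MemLp u 1 volume) (h2 : MemLp u 2 volume) :
    IsContL1L2 fun _ => u where
  measurable := h1.1.comp_snd
  memLp_one _ _ := h1
  memLp_two _ _ := h2
  cont_one _ _ := by simp [tendsto_const_nhds]
  cont_two _ _ := by simp [tendsto_const_nhds]

theorem isL2locL1L2_const {G : Phase d → Mom d} (h1 : MemLp G 1 volume) (h2 : MemLp G 2 volume) :
    IsL2locL1L2 fun _ => G where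
  measurable := h1.1.comp_snd
  sq_one T _ := by
    rw [setLIntegral_const]
    exact ENNReal.mul_lt_top (ENNReal.pow_lt_top h1.2) measure_Ioo_lt_top
  sq_two T _ := by
    rw [setLIntegral_const]
    exact ENNReal.mul_lt_top (ENNReal.pow_lt_top h2.2) measure_Ioo_lt_top

/-- The first order equation `∇E = -p (E + κ E²)` of the equilibria, in terms of directional
derivatives. -/
def IsStationaryProfile (κ : ℝ) (E : Mom d → ℝ) : Prop :=
  ∀ p v : Mom d, HasDerivAt (fun s : ℝ => E (p + s • v)) (-(⟪p, v⟫ * (E p * (1 + κ * E p)))) 0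

theorem IsStationaryProfile.hasDerivAlong {κ : ℝ} {E : Mom d → ℝ} (h : IsStationaryProfile κ E)
    (v : Mom d × Mom d) : HasDerivAlong (phaseLine v) (fun z => E z.2)
      fun z => -(⟪z.2, v.2⟫ * (E z.2 * (1 + κ * E z.2))) := fun z => h z.2 v.2

/-- A profile `E(p)` with gradient `-p (E + κ E²)` is a stationary solution: it does not depend on
the position, and the momentum flux `∇E + p (E + κ E²)` vanishes. -/
theorem IsStationaryProfile.isWeakSolution {κ : ℝ} {E : Mom d → ℝ} (hD : IsStationaryProfile κ E)
    (hE : Continuous E) (h1 : MemLp E 1 volume) (h2 : MemLp E 2 volume) :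
    IsWeakSolution κ (fun _ z => E z.2) fun z : Phase d => E z.2 := by
  have m1 := memLp_comp_snd h1
  refine ⟨isContL1L2_const m1 (memLp_comp_snd h2),
    (memLp_one_iff_integrable.1 m1).locallyIntegrable, fun φ hφ => ?_⟩
  have cE : Continuous fun z : Phase d => E z.2 := hE.comp continuous_snd
  have cp : ∀ i : Fin d, Continuous fun z : Phase d => z.2 i := fun i => by fun_prop
  set w : Fin d → Phase d → ℝ := fun i z => z.2 i * (E z.2 * (1 + κ * E z.2)) with hw
  have cw : ∀ i, Continuous (w i) := fun i => by fun_prop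
  have int : ∀ {u : Phase d → ℝ}, Continuous u → ∀ {q : SpaceTime d → ℝ}, IsTestFunction q →
      ∀ t, Integrable fun z => u z * q (t, z) := fun hu _ hq t =>
    (hu.mul (hq.continuous_slice t)).integrable_of_hasCompactSupport
      (hq.hasCompactSupport_slice t).mul_left
  have inner : ∀ t, ∫ z : Phase d, E z.2 * (derivT φ t z + (1 + κ * E z.2) * derivX φ z.2 t z
      - (1 + κ * E z.2) * derivP φ z.2 t z + laplaceP φ t z)
      = ∫ z : Phase d, E z.2 * dirD dirT φ (t, z) := by
    intro t
    have eX : ∀ i, ∫ z, w i z * dirD (dirX i) φ (t, z) = 0 := fun i => by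
      have := hφ.integral_mul_dirD_slice t (v := (EuclideanSpace.single i 1, 0)) (cw i)
        (continuous_const (y := 0)) fun z => by
          simp only [hw, phaseLine_apply, smul_zero, Prod.snd_add, add_zero]
          exact hasDerivAt_const _ _
      exact this.trans (by simp)
    have eP : ∀ i, ∫ z : Phase d, E z.2 * dirD (dirP i) (dirD (dirP i) φ) (t, z)
        = ∫ z, w i z * dirD (dirP i) φ (t, z) := fun i => by
      have := (hφ.dirD (dirP i)).integral_mul_dirD_slice t
        (v := (0, EuclideanSpace.single i 1)) cE (by fun_prop) (hD.hasDerivAlong _)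
      refine this.trans ?_
      rw [← integral_neg]
      refine integral_congr_ae (Eventually.of_forall fun z => ?_)
      simp [hw, EuclideanSpace.inner_single_right]
    have iT := int cE (hφ.dirD dirT) t
    have iX := fun i => int (cw i) (hφ.dirD (dirX i)) t
    have iP := fun i => int (cw i) (hφ.dirD (dirP i)) t
    have iL := fun i => int cE ((hφ.dirD (dirP i)).dirD (dirP i)) t
    have iX' := integrable_finsetSum Finset.univ fun i _ => iX i
    have iP' := integrable_finsetSum Finset.univ fun i _ => iP i
    have iL' := integrable_finsetSum Finset.univ fun i _ => iL i
    have e : ∀ z : Phase d, E z.2 * (derivT φ t z + (1 + κ * E z.2) * derivX φ z.2 t z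
        - (1 + κ * E z.2) * derivP φ z.2 t z + laplaceP φ t z)
        = E z.2 * dirD dirT φ (t, z) + ∑ i, w i z * dirD (dirX i) φ (t, z)
          - ∑ i, w i z * dirD (dirP i) φ (t, z)
          + ∑ i, E z.2 * dirD (dirP i) (dirD (dirP i) φ) (t, z) := by
      intro z
      rw [derivT_eq, hφ.isSmooth.derivX_eq_sum, hφ.isSmooth.derivP_eq_sum,
        hφ.isSmooth.laplaceP_eq]
      simp only [hw, mul_add, mul_sub, Finset.mul_sum]
      congr 2
      · congr 1
        exact Finset.sum_congr rfl fun i _ => by ring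
      · exact Finset.sum_congr rfl fun i _ => by ring
    simp only [e]
    rw [integral_add (by exact (iT.add iX').sub iP') iL', integral_sub (by exact iT.add iX') iP',
      integral_add iT iX', integral_finsetSum _ fun i _ => iX i,
      integral_finsetSum _ fun i _ => iP i, integral_finsetSum _ fun i _ => iL i]
    simp [eX, eP]
  simp only [inner]
  have cE' : Continuous fun y : SpaceTime d => E y.2.2 := hE.comp (by fun_prop)
  have iS : Integrable (fun y : SpaceTime d => E y.2.2 * dirD dirT φ y) :=
    (cE'.mul (hφ.dirD dirT).continuous).integrable_of_hasCompactSupport (hφ.dirD dirT).2.mul_left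
  have iS' : Integrable (fun y : SpaceTime d => E y.2.2 * dirD dirT φ y)
      ((volume.restrict (Ioi (0 : ℝ))).prod volume) := by
    have h3 := iS.restrict (s := Ioi (0 : ℝ) ×ˢ univ)
    have e : (volume : Measure (SpaceTime d)) = (volume : Measure ℝ).prod volume := rfl
    rwa [e, ← Measure.prod_restrict, Measure.restrict_univ] at h3
  have i0 : Integrable fun z : Phase d => φ (0, z) * E z.2 :=
    (int cE hφ 0).congr (Eventually.of_forall fun z => mul_comm _ _)
  have swap := integral_integral_swap (f := fun t (z : Phase d) => E z.2 * dirD dirT φ (t, z)) iS'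
  rw [swap, ← integral_add (by exact iS'.integral_prod_right) i0]
  refine integral_eq_zero_of_ae (Eventually.of_forall fun z => ?_)
  have s2 : HasCompactSupport fun t => φ (t, z) :=
    HasCompactSupport.intro (K := Prod.fst '' tsupport φ) (IsCompact.image hφ.2 continuous_fst)
      fun _ ht => image_eq_zero_of_notMem_tsupport fun h => ht ⟨_, h, rfl⟩
  have s3 := HasCompactSupport.integral_Ioi_deriv_eq
    ((hφ.isSmooth.contDiff_time z).of_le (by simp)) s2 0
  have s4 : ∀ t, dirD dirT φ (t, z) = deriv (fun t => φ (t, z)) t := fun t =>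
    (derivT_eq φ t z).symm
  simp only [s4, integral_const_mul, s3, Pi.zero_apply]
  ring

theorem IsStationaryProfile.hasGradRegularity {κ : ℝ} {E : Mom d → ℝ}
    (hD : IsStationaryProfile κ E) (hE : Continuous E)
    (h1 : MemLp (fun p => (E p * (1 + κ * E p)) • p) 1 volume)
    (h2 : MemLp (fun p => (E p * (1 + κ * E p)) • p) 2 volume) :
    HasGradRegularity fun _ (z : Phase d) => E z.2 := by
  have cE : Continuous fun z : Phase d => E z.2 := hE.comp continuous_snd
  refine ⟨⟨fun _ _ => 0, fun φ hφ _ v => ?_, isL2locL1L2_const MemLp.zero' MemLp.zero'⟩,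
    ⟨fun _ z => -((E z.2 * (1 + κ * E z.2)) • z.2), fun φ hφ _ v => ?_,
      isL2locL1L2_const (memLp_comp_snd h1.neg) (memLp_comp_snd h2.neg)⟩⟩
  · have (t : ℝ) := hφ.integral_mul_dirD_slice t (v := (v, 0)) cE (by fun_prop) (hD.hasDerivAlong _)
    simp only [derivX_eq, this]
    simp
  · have (t : ℝ) := hφ.integral_mul_dirD_slice t (v := (0, v)) cE (by fun_prop) (hD.hasDerivAlong _)
    simp only [hφ.isSmooth.derivP_eq, this, integral_neg]
    simp only [inner_neg_left, real_inner_smul_left, mul_comm]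

theorem maxwellian_pos (p : Mom d) : 0 < maxwellian p := by
  unfold maxwellian
  positivity

theorem continuous_maxwellian : Continuous (maxwellian (d := d)) := by
  unfold maxwellian
  fun_prop

theorem maxwellian_le (p : Mom d) : maxwellian p ≤ 1 / (2 * Real.pi) ^ ((d : ℝ) / 2) := by
  unfold maxwellian
  refine mul_le_of_le_one_right (by positivity) (Real.exp_le_one_iff.2 ?_)
  nlinarith [sq_nonneg ‖p‖]

theorem hasDerivAt_maxwellian (p v : Mom d) :
    HasDerivAt (fun s : ℝ => maxwellian (p + s • v)) (-(⟪p, v⟫ * maxwellian p)) 0 := by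
  have h1 : HasDerivAt (fun s : ℝ => p + s • v) v 0 := by
    simpa using ((hasDerivAt_id (0 : ℝ)).smul_const v).const_add p
  have h2 := ((h1.norm_sq.neg.div_const 2).exp).const_mul (1 / (2 * Real.pi) ^ ((d : ℝ) / 2))
  refine h2.congr_deriv ?_
  simp only [Pi.neg_apply, zero_smul, add_zero, maxwellian]
  ring

/-- The admissible range of `β`: the denominator of the equilibrium is bounded away from zero. -/
theorem exists_le_one_sub {κ β : ℝ} (hκ : κ = -1 ∨ κ = 0 ∨ κ = 1) (hβ : 0 < β)
    (h : κ = 1 → β < (2 * Real.pi) ^ ((d : ℝ) / 2)) :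
    ∃ δ > 0, ∀ p : Mom d, δ ≤ 1 - κ * β * maxwellian p := by
  rcases hκ with rfl | rfl | rfl
  · exact ⟨1, one_pos, fun p => by nlinarith [mul_pos hβ (maxwellian_pos p)]⟩
  · exact ⟨1, one_pos, fun p => by simp⟩
  · refine ⟨1 - β * (1 / (2 * Real.pi) ^ ((d : ℝ) / 2)), ?_, fun p => ?_⟩
    · rw [mul_one_div, gt_iff_lt, sub_pos, div_lt_one (by positivity)]
      exact h rfl
    · have := mul_le_mul_of_nonneg_left (maxwellian_le p) hβ.le
      linarith

variable {κ β : ℝ}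

theorem one_add_equilibrium {p : Mom d} (h : 1 - κ * β * maxwellian p ≠ 0) :
    1 + κ * equilibrium κ β p = (1 - κ * β * maxwellian p)⁻¹ := by
  unfold equilibrium
  field_simp
  ring

theorem isStationaryProfile_equilibrium (h : ∀ p : Mom d, 1 - κ * β * maxwellian p ≠ 0) :
    IsStationaryProfile κ (equilibrium κ β : Mom d → ℝ) := by
  intro p v
  have hM := hasDerivAt_maxwellian p v
  have h1 : HasDerivAt (fun s : ℝ => equilibrium κ β (p + s • v)) _ 0 :=
    (hM.const_mul β).fun_div ((hM.const_mul (κ * β)).const_sub 1) (by simpa using h p)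
  refine h1.congr_deriv ?_
  have := h p
  rw [one_add_equilibrium (h p)]
  simp only [zero_smul, add_zero, equilibrium]
  field_simp
  ring

theorem continuous_equilibrium (h : ∀ p : Mom d, 1 - κ * β * maxwellian p ≠ 0) :
    Continuous (equilibrium κ β : Mom d → ℝ) :=
  (continuous_maxwellian.const_mul β).div
    (continuous_const.sub (continuous_maxwellian.const_mul _)) h

theorem integrable_exp_neg_mul_sq_norm {b : ℝ} (hb : 0 < b) :
    Integrable fun p : Mom d => Real.exp (-b * ‖p‖ ^ 2) := by
  have := (GaussianFourier.integrable_cexp_neg_mul_sq_norm_add (V := Mom d) (b := (b : ℂ))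
    (by simpa using hb) 0 0).norm
  refine this.congr (Eventually.of_forall fun p => ?_)
  simp only [Complex.norm_exp]
  norm_num [← Complex.ofReal_pow]

theorem memLp_of_norm_le_gaussian {F : Type*} [NormedAddCommGroup F] {u : Mom d → F}
    (hu : AEStronglyMeasurable u volume) {C : ℝ}
    (h : ∀ p, ‖u p‖ ≤ C * Real.exp (-(1 / 4) * ‖p‖ ^ 2)) :
    MemLp u 1 volume ∧ MemLp u 2 volume := by
  have hc : Continuous fun p : Mom d => C * Real.exp (-(1 / 4) * ‖p‖ ^ 2) := by fun_prop
  have h1 := (integrable_exp_neg_mul_sq_norm (d := d) (b := 1 / 4) (by norm_num)).const_mul C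
  have h2 : MemLp (fun p : Mom d => C * Real.exp (-(1 / 4) * ‖p‖ ^ 2)) 2 volume := by
    rw [memLp_two_iff_integrable_sq hc.aestronglyMeasurable]
    refine ((integrable_exp_neg_mul_sq_norm (d := d) (b := 1 / 2)
      (by norm_num)).const_mul (C ^ 2)).congr (Eventually.of_forall fun p => ?_)
    simp only [mul_pow, ← Real.exp_nat_mul]
    congr 2
    push_cast
    ring
  exact ⟨(memLp_one_iff_integrable.2 h1).mono' hu (Eventually.of_forall h),
    h2.mono' hu (Eventually.of_forall h)⟩

theorem equilibrium_pos (hβ : 0 < β) {p : Mom d} (h : 0 < 1 - κ * β * maxwellian p) :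
    0 < equilibrium κ β p := div_pos (mul_pos hβ (maxwellian_pos p)) h

theorem maxwellian_eq (p : Mom d) : maxwellian p = 1 / (2 * Real.pi) ^ ((d : ℝ) / 2)
    * (Real.exp (-(1 / 4) * ‖p‖ ^ 2) * Real.exp (-(1 / 4) * ‖p‖ ^ 2)) := by
  rw [maxwellian, ← Real.exp_add]
  congr 2
  ring

/-- The equilibria are regular weak solutions. -/
theorem isWeakSolution_equilibrium (hκ : κ = -1 ∨ κ = 0 ∨ κ = 1) (hβ : 0 < β)
    (h : κ = 1 → β < (2 * Real.pi) ^ ((d : ℝ) / 2)) :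
    IsWeakSolution κ (fun _ z => equilibrium κ β z.2) (fun z : Phase d => equilibrium κ β z.2)
      ∧ HasGradRegularity fun _ (z : Phase d) => equilibrium κ β z.2 := by
  obtain ⟨δ, δ0, hδ⟩ := exists_le_one_sub (d := d) hκ hβ h
  have hp : ∀ p : Mom d, 0 < 1 - κ * β * maxwellian p := fun p => δ0.trans_le (hδ p)
  have hn : ∀ p : Mom d, 1 - κ * β * maxwellian p ≠ 0 := fun p => (hp p).ne'
  have hD := isStationaryProfile_equilibrium hn
  have hc := continuous_equilibrium hn
  set c : ℝ := 1 / (2 * Real.pi) ^ ((d : ℝ) / 2) with hcd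
  have c0 : 0 < c := by positivity
  have bE : ∀ p : Mom d, equilibrium κ β p ≤ β * maxwellian p / δ := fun p =>
    div_le_div_of_nonneg_left (mul_pos hβ (maxwellian_pos p)).le δ0 (hδ p)
  have e1 : ∀ p : Mom d, Real.exp (-(1 / 4) * ‖p‖ ^ 2) ≤ 1 := fun p =>
    Real.exp_le_one_iff.2 (by nlinarith [sq_nonneg ‖p‖])
  -- `|p| ≤ 1 + |p|² / 4 ≤ exp (|p|² / 4)`
  have e2 : ∀ p : Mom d, ‖p‖ * Real.exp (-(1 / 4) * ‖p‖ ^ 2) ≤ 1 := fun p => by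
    have h1 := Real.add_one_le_exp (1 / 4 * ‖p‖ ^ 2)
    rw [neg_mul, Real.exp_neg, ← div_eq_mul_inv, div_le_one (Real.exp_pos _)]
    nlinarith [sq_nonneg (‖p‖ / 2 - 1)]
  have m1 := memLp_of_norm_le_gaussian (C := β * c / δ) hc.aestronglyMeasurable fun p => by
    rw [Real.norm_eq_abs, abs_of_pos (equilibrium_pos hβ (hp p))]
    refine (bE p).trans ?_
    have h1 : β * maxwellian p / δ = β * c / δ
        * (Real.exp (-(1 / 4) * ‖p‖ ^ 2) * Real.exp (-(1 / 4) * ‖p‖ ^ 2)) := by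
      rw [maxwellian_eq]; ring
    rw [h1]
    refine mul_le_mul_of_nonneg_left ?_ (by positivity)
    exact mul_le_of_le_one_right (Real.exp_pos _).le (e1 p)
  have cG : Continuous fun p : Mom d =>
      (equilibrium κ β p * (1 + κ * equilibrium κ β p)) • p := by fun_prop
  have m2 := memLp_of_norm_le_gaussian (C := β * c / δ * δ⁻¹) cG.aestronglyMeasurable fun p => by
    rw [one_add_equilibrium (hn p), norm_smul, Real.norm_eq_abs,
      abs_of_pos (mul_pos (equilibrium_pos hβ (hp p)) (inv_pos.2 (hp p)))]
    have h1 : equilibrium κ β p * (1 - κ * β * maxwellian p)⁻¹ ≤ β * maxwellian p / δ * δ⁻¹ :=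
      mul_le_mul (bE p) (inv_anti₀ δ0 (hδ p)) (inv_pos.2 (hp p)).le
        (div_nonneg (mul_pos hβ (maxwellian_pos p)).le δ0.le)
    refine (mul_le_mul_of_nonneg_right h1 (norm_nonneg p)).trans ?_
    have h2 : β * maxwellian p / δ * δ⁻¹ * ‖p‖ = β * c / δ * δ⁻¹
        * (Real.exp (-(1 / 4) * ‖p‖ ^ 2) * (‖p‖ * Real.exp (-(1 / 4) * ‖p‖ ^ 2))) := by
      rw [maxwellian_eq]; ring
    rw [h2]
    refine mul_le_mul_of_nonneg_left ?_ (by positivity)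
    exact mul_le_of_le_one_right (Real.exp_pos _).le (e2 p)
  exact ⟨hD.isWeakSolution hc m1.1 m1.2, hD.hasGradRegularity hc m2.1 m2.2⟩

/-- For bosons, a lower bound by the profile of parameter `β₁` and an upper bound by that of
parameter `β₂ < (2π)^{d/2}` force `β₁ < (2π)^{d/2}` as well: at large momenta, where
`β₁ M < 1`, the profiles are ordered like the parameters. -/
theorem lt_of_equilibrium_le (hd : 1 ≤ d) {β₁ β₂ : ℝ} (h1 : 0 < β₁)
    (h2 : β₂ < (2 * Real.pi) ^ ((d : ℝ) / 2))
    (h : ∀ᵐ z : Phase d, equilibrium 1 β₁ z.2 ≤ equilibrium 1 β₂ z.2) :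
    β₁ < (2 * Real.pi) ^ ((d : ℝ) / 2) := by
  by_contra! hge
  set c : ℝ := 1 / (2 * Real.pi) ^ ((d : ℝ) / 2) with hc
  have c0 : 0 < c := by positivity
  set U : Set (Phase d) := {z | β₁ * maxwellian z.2 < 1} with hU
  have hUo : IsOpen U := isOpen_lt
    (continuous_const.mul (continuous_maxwellian.comp continuous_snd)) continuous_const
  have hUn : U.Nonempty := by
    -- At a momentum with `|p|² = 2 β₁ c` the bound `x + 1 ≤ exp x` gives `β₁ M(p) < 1`.
    refine ⟨(0, EuclideanSpace.single ⟨0, hd⟩ (Real.sqrt (2 * (β₁ * c)))), ?_⟩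
    have h3 := Real.add_one_le_exp (β₁ * c)
    simp only [hU, mem_ofPred_eq, maxwellian, PiLp.norm_single, Real.norm_eq_abs, sq_abs]
    rw [Real.sq_sqrt (by positivity), ← hc, ← mul_assoc, neg_div, mul_div_cancel_left₀ _ two_ne_zero,
      Real.exp_neg, ← div_eq_mul_inv, div_lt_one (Real.exp_pos _)]
    linarith
  have h4 : ∀ᵐ z : Phase d, z ∉ U := by
    filter_upwards [h] with z hz hzU
    have hzU' : β₁ * maxwellian z.2 < 1 := hzU
    have h5 : β₂ * maxwellian z.2 < β₁ * maxwellian z.2 :=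
      mul_lt_mul_of_pos_right (h2.trans_le hge) (maxwellian_pos _)
    -- `x ↦ x / (1 - x)` is strictly increasing for `x < 1`.
    refine absurd hz (not_le.2 ?_)
    unfold equilibrium
    rw [one_mul, one_mul, div_lt_div_iff₀ (by linarith) (by linarith)]
    nlinarith
  exact (hUo.measure_pos volume hUn).ne' (measure_eq_zero_iff_ae_notMem.2 h4)

end Equilibria

end QFP

theorem corollary3p5 (d : ℕ) (hd : 1 ≤ d) (κ : ℝ) (hκ : κ = -1 ∨ κ = 0 ∨ κ = 1) :
    (∀ (f g : ℝ → QFP.Phase d → ℝ) (f₀ g₀ : QFP.Phase d → ℝ),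
      QFP.IsWeakSolution κ f f₀ → QFP.IsWeakSolution κ g g₀ →
      QFP.HasGradRegularity f → QFP.HasGradRegularity g →
      (∀ᵐ z, f₀ z ≤ g₀ z) →
      ∀ t : ℝ, 0 ≤ t → ∀ᵐ z, f t z ≤ g t z) ∧
    (∀ (f : ℝ → QFP.Phase d → ℝ) (f₀ : QFP.Phase d → ℝ),
      QFP.IsWeakSolution κ f f₀ → QFP.HasGradRegularity f →
      ∀ β₁ β₂ : ℝ, 0 < β₁ → 0 < β₂ →
      (κ = 1 → β₂ < (2 * Real.pi) ^ ((d : ℝ) / 2)) →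
      (∀ᵐ z : QFP.Phase d,
        QFP.equilibrium κ β₁ z.2 ≤ f₀ z ∧ f₀ z ≤ QFP.equilibrium κ β₂ z.2) →
      ∀ t : ℝ, 0 ≤ t → ∀ᵐ z : QFP.Phase d,
        QFP.equilibrium κ β₁ z.2 ≤ f t z ∧ f t z ≤ QFP.equilibrium κ β₂ z.2) := by
  refine ⟨fun f g f₀ g₀ hf hg hrf hrg h0 t ht => QFP.comparison hf hg hrf hrg h0 ht,
    fun f f₀ hf hrf β₁ β₂ h1 h2 hβ₂ h0 t ht => ?_⟩
  have hβ₁ : κ = 1 → β₁ < (2 * Real.pi) ^ ((d : ℝ) / 2) := by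
    rintro rfl
    refine QFP.lt_of_equilibrium_le hd h1 (hβ₂ rfl) ?_
    filter_upwards [h0] with z hz using hz.1.trans hz.2
  have E₁ := QFP.isWeakSolution_equilibrium hκ h1 hβ₁
  have E₂ := QFP.isWeakSolution_equilibrium hκ h2 hβ₂
  filter_upwards [QFP.comparison E₁.1 hf E₁.2 hrf (h0.mono fun z hz => hz.1) ht,
    QFP.comparison hf E₂.1 hrf E₂.2 (h0.mono fun z hz => hz.2) ht] with z a b using ⟨a, b⟩
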